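/- Let $S$ be an inverse semigroup with idempotent semilattice $E$, and let $\mathcal A=\{\mathcal A_s\}_{s\in S}$ be a Fell bundle over $S$: a family of complex Banach spaces with an associative bilinear multiplication $\mathcal A_s\times\mathcal A_t\to\mathcal A_{st}$, a conjugate-linear involution $\mathcal A_s\to\mathcal A_{s^*}$, and isometric linear inclusions $j_{t,s}\colon\mathcal A_s\to\mathcal A_t$ for $s\le t$, such that $\|ab\|\le\|a\|\|b\|$, $(a^*)^*=a$, $\|a^*\|=\|a\|$, $(ab)^*=b^*a^*$, $\|a^*a\|=\|a\|^2$, $a^*a$ is positive in the C*-algebra $\mathcal A_{s^*s}$ for $a\in\mathcal A_s$, $j_{t,r}=j_{t,s}\circ j_{s,r}$ for $r\le s\le t$, and the inclusions are compatible with multiplication and involution. Assume that $\mathcal A$ is saturated ($\mathcal A_s\mathcal A_t$ spans a dense subspace of $\mathcal A_{st}$ for all $s,t$) and semi-abelian ($\mathcal A_e$ is commutative for every $e\in E$). Let $X$ be the spectrum of $C^*(\mathcal E)$, where $\mathcal E=\{\mathcal A_e\}_{e\in E}$; that is, $X$ is the set of nonzero one-dimensional representations of $\mathcal E$ with the topology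 of pointwise convergence. Write $a(x)$ for the value of $a\in\mathcal A_e$ at $x\in X$, and let $\mathcal U_e=\{x\in X: a(x)\ne0\text{ for some }a\in\mathcal A_e\}$. Then there is an action $\theta$ of $S$ on $X$ by homeomorphisms $\theta_s\colon\mathcal U_{s^*s}\to\mathcal U_{ss^*}$ (so $\theta_s\circ\theta_t=\theta_{st}$ as partial maps) such that $(a^*ba)(x)=(a^*a)(x)\,b(\theta_s(x))$ for all $s\in S$, $x\in\mathcal U_{s^*s}$, $a\in\mathcal A_s$ with $(a^*a)(x)\neq0$, and all $b\in\mathcal A_e$, $e\in E$. Let $\mathcal G=\mathcal G(\mathcal A)$ be the set of germs $[s,x]$, $s\in S$, $x\in\mathcal U_{s^*s}$, where $[s,x]=[t,y]$ iff $x=y$ and $se=te$ for some $e\in E$ with $x\in\mathcal U_e$, with the topology generated by the sets $\mathcal O(s,U)=\{[s,x]:x\in U\}$, $U\subseteq\mathcal U_{s^*s}$ open. With source $x$ and range $\theta_s(x)$ of $[s,x]$, product $[s,x][t,y]=[st,y]$ if $\theta_t(y)=x$, inverse $[s,x]^{-1}=[s^*,\theta_s(x)]$, and units $[e,x]$ ($e\in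 E$, $x\in\mathcal U_e$) identified with the points $x\in X$, $\mathcal G$ is an étale groupoid: a (not necessarily Hausdorff) topological groupoid with locally compact Hausdorff unit space $X$ and with range map a local homeomorphism. Let $L$ be the quotient of the set of triples $(a,s,x)$ with $a\in\mathcal A_s$, $x\in\mathcal U_{s^*s}$, by the equivalence relation in which $(a,s,x)\sim(a',s',x')$ iff $x=x'$ and there are $e\in E$ and $b\in\mathcal A_e$ with $b(x)\ne0$, $se=s'e$ and $\big((ab-a'b)^*(ab-a'b)\big)(x)=0$. Let $[a,s,x]$ be the class of $(a,s,x)$, and let $\pi\colon L\to\mathcal G$, $[a,s,x]\mapsto[s,x]$. Then the fibers of $\pi$ are Banach spaces with the operations and norm $[a,s,x]+[b,t,x]=[ac+bc,se,x]$ (for any $e\in E$ and $c\in\mathcal A_e$ with $se=te$ and $c(x)=1$), in particular $[a,s,x]+[b,s,x]=[a+b,s,x]$, $\lambda[a,s,x]=[\lambda a,s,x]$ and $\|[a,s,x]\|=\sqrt{(a^*a)(x)}$; and there is a unique topology on $L$ which makes it an upper semicontinuous Banach bundle over $\mathcal G$ and makes all the local sections $\hat a\colon\mathcal O(s,\mathcal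 U_{s^*s})\to L$, $\hat a([s,x])=[a,s,x]$ ($s\in S$, $a\in\mathcal A_s$), continuous. With this topology, the multiplication $[a,s,x][b,t,y]=[ab,st,y]$ (if $\theta_t(y)=x$) and the involution $[a,s,x]^*=[a^*,s^*,\theta_s(x)]$, $L$ is a Fell line bundle over $\mathcal G$: a Fell bundle over $\mathcal G$ with continuous norm, with one-dimensional fibers, and locally trivial as a complex line bundle. Equivalently, this gives a twisted étale groupoid $(\mathcal G(\mathcal A),\Sigma(\mathcal A))$: with the structure inherited from $L$, the space $\Sigma=\Sigma(\mathcal A)$ of unitary elements of $L$ is a locally compact topological groupoid and $$\mathbb T\times X\xrightarrow{\ \iota\ }\Sigma\xrightarrow{\ \pi\ }\mathcal G,\qquad \iota(z,x)=z\cdot1_x,$$ ($1_x$ the unit element of the fiber of $L$ over $x$) is a central extension of topological groupoids in which $\iota$ is a homeomorphism onto its image and $\pi$ is a continuous open surjection; and $L$ is recovered from it as $L\cong(\mathbb C\times\Sigma)/\mathbb T$ through $(\lambda,\sigma)\mapsto\lambda\sigma$, where $z\in\mathbb T$ acts by $(\lambda,\sigma)\mapsto(z^{-1}\lambda,z\sigma)$.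 -/

import Mathlib

/-! # Inverse semigroups -/

/-- An inverse semigroup: a regular semigroup whose idempotents commute.
The element `s⁻¹` (usually written `s*`) is then the unique generalized inverse of `s`. -/
class InverseSemigroup (S : Type*) extends Semigroup S, Inv S where
  mul_inv_mul : ∀ s : S, s * s⁻¹ * s = s
  inv_mul_inv : ∀ s : S, s⁻¹ * s * s⁻¹ = s⁻¹
  idem_comm : ∀ e f : S, e * e = e → f * f = f → e * f = f * e

namespace InverseSemigroup

section

variable {S : Type*} [InverseSemigroup S]

/-- Idempotent elements. -/
def Idem (e : S) : Prop := e * e = e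

/-- The natural partial order of an inverse semigroup: `s ≤ t` iff `s = t s* s`. -/
def Le (s t : S) : Prop := s = t * (s⁻¹ * s)

theorem idem_inv_mul (s : S) : Idem (s⁻¹ * s) := by
  unfold Idem
  rw [← mul_assoc, inv_mul_inv]

theorem idem_mul_inv (s : S) : Idem (s * s⁻¹) := by
  unfold Idem
  rw [← mul_assoc, mul_inv_mul]

theorem Idem.comm {e f : S} (he : Idem e) (hf : Idem f) : e * f = f * e :=
  idem_comm e f he hf

theorem Idem.mul {e f : S} (he : Idem e) (hf : Idem f) : Idem (e * f) := by
  unfold Idem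
  calc e * f * (e * f) = e * (f * e) * f := by simp only [mul_assoc]
    _ = e * (e * f) * f := by rw [hf.comm he]
    _ = e * e * (f * f) := by simp only [mul_assoc]
    _ = e * f := by rw [he, hf]

/-- Generalized inverses are unique. -/
theorem inv_unique {s t : S} (h₁ : s * t * s = s) (h₂ : t * s * t = t) : t = s⁻¹ := by
  have i₁ : Idem (t * s) := by unfold Idem; rw [← mul_assoc, h₂]
  have i₂ : Idem (s * t) := by unfold Idem; rw [← mul_assoc, h₁]
  have e₁ : t * s = s⁻¹ * s := by
    calc t * s = t * (s * s⁻¹ * s) := by rw [mul_inv_mul]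
      _ = (t * s) * (s⁻¹ * s) := by simp only [mul_assoc]
      _ = (s⁻¹ * s) * (t * s) := i₁.comm (idem_inv_mul s)
      _ = s⁻¹ * (s * t * s) := by simp only [mul_assoc]
      _ = s⁻¹ * s := by rw [h₁]
  have e₂ : s * t = s * s⁻¹ := by
    calc s * t = (s * s⁻¹ * s) * t := by rw [mul_inv_mul]
      _ = (s * s⁻¹) * (s * t) := by simp only [mul_assoc]
      _ = (s * t) * (s * s⁻¹) := (idem_mul_inv s).comm i₂
      _ = (s * t * s) * s⁻¹ := by simp only [mul_assoc]
      _ = s * s⁻¹ := by rw [h₁]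
  calc t = t * s * t := h₂.symm
    _ = s⁻¹ * (s * t) := by rw [e₁, mul_assoc]
    _ = s⁻¹ * s * s⁻¹ := by rw [e₂, mul_assoc]
    _ = s⁻¹ := inv_mul_inv s

theorem Idem.inv_eq {e : S} (he : Idem e) : e⁻¹ = e := by
  have h : e * e * e = e := by rw [he, he]
  exact (inv_unique h h).symm

theorem Idem.inv {e : S} (he : Idem e) : Idem e⁻¹ := by
  rw [he.inv_eq]; exact he

theorem inv_inv_eq (s : S) : s⁻¹⁻¹ = s :=
  (inv_unique (inv_mul_inv s) (mul_inv_mul s)).symm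

theorem mul_inv_rev_eq (s t : S) : (s * t)⁻¹ = t⁻¹ * s⁻¹ := by
  have hc : t * t⁻¹ * (s⁻¹ * s) = s⁻¹ * s * (t * t⁻¹) :=
    (idem_mul_inv t).comm (idem_inv_mul s)
  refine (inv_unique ?_ ?_).symm
  · calc s * t * (t⁻¹ * s⁻¹) * (s * t) = s * (t * t⁻¹ * (s⁻¹ * s)) * t := by
          simp only [mul_assoc]
      _ = (s * s⁻¹ * s) * (t * t⁻¹ * t) := by rw [hc]; simp only [mul_assoc]
      _ = s * t := by rw [mul_inv_mul, mul_inv_mul]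
  · calc t⁻¹ * s⁻¹ * (s * t) * (t⁻¹ * s⁻¹) = t⁻¹ * (s⁻¹ * s * (t * t⁻¹)) * s⁻¹ := by
          simp only [mul_assoc]
      _ = (t⁻¹ * t * t⁻¹) * (s⁻¹ * s * s⁻¹) := by rw [← hc]; simp only [mul_assoc]
      _ = t⁻¹ * s⁻¹ := by rw [inv_mul_inv, inv_mul_inv]

/-- `s* e s` is idempotent if `e` is. -/
theorem Idem.conj {e : S} (he : Idem e) (s : S) : Idem (s⁻¹ * (e * s)) := by
  unfold Idem
  calc s⁻¹ * (e * s) * (s⁻¹ * (e * s)) = s⁻¹ * (e * (s * s⁻¹)) * (e * s) := by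
        simp only [mul_assoc]
    _ = s⁻¹ * (s * s⁻¹ * e) * (e * s) := by rw [he.comm (idem_mul_inv s)]
    _ = (s⁻¹ * s * s⁻¹) * ((e * e) * s) := by simp only [mul_assoc]
    _ = s⁻¹ * (e * s) := by rw [inv_mul_inv, he]

theorem le_of_eq_mul_idem {s t e : S} (he : Idem e) (h : s = t * e) : Le s t := by
  have hi : s⁻¹ = e * t⁻¹ := by rw [h, mul_inv_rev_eq, he.inv_eq]
  unfold Le
  rw [hi, h]
  calc t * e = (t * t⁻¹ * t) * (e * e) := by rw [mul_inv_mul, he]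
    _ = t * ((t⁻¹ * t * e) * e) := by simp only [mul_assoc]
    _ = t * ((e * (t⁻¹ * t)) * e) := by rw [(idem_inv_mul t).comm he]
    _ = t * (e * t⁻¹ * (t * e)) := by simp only [mul_assoc]

theorem Le.mul {s t u v : S} (h : Le s t) (h' : Le u v) : Le (s * u) (t * v) := by
  have hc := (idem_inv_mul s).conj v
  refine le_of_eq_mul_idem (hc.mul (idem_inv_mul u)) ?_
  calc s * u = t * (s⁻¹ * s) * (v * (u⁻¹ * u)) := by
        conv_lhs => rw [show s = t * (s⁻¹ * s) from h, show u = v * (u⁻¹ * u) from h']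
    _ = t * ((s⁻¹ * s) * (v * v⁻¹)) * v * (u⁻¹ * u) := by
        conv_lhs => rw [show v = v * v⁻¹ * v from (mul_inv_mul v).symm]
        simp only [mul_assoc]
    _ = t * ((v * v⁻¹) * (s⁻¹ * s)) * v * (u⁻¹ * u) := by
        rw [(idem_inv_mul s).comm (idem_mul_inv v)]
    _ = t * v * (v⁻¹ * (s⁻¹ * s * v) * (u⁻¹ * u)) := by simp only [mul_assoc]

theorem Le.inv {s t : S} (h : Le s t) : Le s⁻¹ t⁻¹ := by
  have hi := idem_inv_mul s
  have e₁ : s⁻¹ = (s⁻¹ * s) * t⁻¹ := by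
    conv_lhs => rw [show s = t * (s⁻¹ * s) from h]
    rw [mul_inv_rev_eq, hi.inv_eq]
  have hc := hi.conj t⁻¹
  rw [inv_inv_eq] at hc
  refine le_of_eq_mul_idem hc ?_
  calc s⁻¹ = (s⁻¹ * s) * (t⁻¹ * t * t⁻¹) := by rw [inv_mul_inv]; exact e₁
    _ = (s⁻¹ * s * (t⁻¹ * t)) * t⁻¹ := by simp only [mul_assoc]
    _ = (t⁻¹ * t * (s⁻¹ * s)) * t⁻¹ := by rw [hi.comm (idem_inv_mul t)]
    _ = t⁻¹ * (t * (s⁻¹ * s * t⁻¹)) := by simp only [mul_assoc]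

end

end InverseSemigroup

open InverseSemigroup

/-! # Fell bundles over inverse semigroups -/

/-- A Fell bundle over the inverse semigroup `S` whose fibers are the Banach spaces `A s`.
Equalities between elements of fibers over elements of `S` which are only provably equal are
stated in the disjoint union `Σ s, A s`. -/
structure FellBundle (S : Type*) [InverseSemigroup S] (A : S → Type*)
    [∀ s, NormedAddCommGroup (A s)] [∀ s, NormedSpace ℂ (A s)] [∀ s, CompleteSpace (A s)] where
  /-- the multiplication `A_s × A_t → A_{st}` -/
  mul : ∀ {s t : S}, A s →ₗ[ℂ] A t →ₗ[ℂ] A (s * t)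
  /-- the conjugate linear involution `A_s → A_{s*}` -/
  star : ∀ {s : S}, A s →ₗ⋆[ℂ] A s⁻¹
  /-- the isometric inclusion `j_{t,s} : A_s → A_t` for `s ≤ t` -/
  incl : ∀ {s t : S}, Le s t → A s →ₗᵢ[ℂ] A t
  mul_assoc : ∀ {r s t : S} (a : A r) (b : A s) (c : A t),
    (⟨r * s * t, mul (mul a b) c⟩ : Σ s, A s) = ⟨r * (s * t), mul a (mul b c)⟩
  norm_mul_le : ∀ {s t : S} (a : A s) (b : A t), ‖mul a b‖ ≤ ‖a‖ * ‖b‖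
  star_star : ∀ {s : S} (a : A s), (⟨s⁻¹⁻¹, star (star a)⟩ : Σ s, A s) = ⟨s, a⟩
  norm_star : ∀ {s : S} (a : A s), ‖star a‖ = ‖a‖
  star_mul : ∀ {s t : S} (a : A s) (b : A t),
    (⟨(s * t)⁻¹, star (mul a b)⟩ : Σ s, A s) = ⟨t⁻¹ * s⁻¹, mul (star b) (star a)⟩
  norm_star_mul_self : ∀ {s : S} (a : A s), ‖mul (star a) a‖ = ‖a‖ ^ 2
  /-- `a* a` is positive in the C*-algebra `A_{s* s}`, i.e. of the form `c* c` -/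
  star_mul_self_pos : ∀ {s : S} (a : A s), ∃ c : A (s⁻¹ * s),
    (⟨s⁻¹ * s, mul (star a) a⟩ : Σ s, A s) =
      ⟨(s⁻¹ * s)⁻¹ * (s⁻¹ * s), mul (star c) c⟩
  incl_trans : ∀ {r s t : S} (hrs : Le r s) (hst : Le s t) (hrt : Le r t) (a : A r),
    incl hrt a = incl hst (incl hrs a)
  mul_incl : ∀ {s t u v : S} (hst : Le s t) (huv : Le u v) (a : A s) (b : A u),
    mul (incl hst a) (incl huv b) = incl (hst.mul huv) (mul a b)
  star_incl : ∀ {s t : S} (hst : Le s t) (a : A s),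
    star (incl hst a) = incl hst.inv (star a)

namespace FellBundle

section

variable {S : Type*} [InverseSemigroup S] {A : S → Type*}
  [∀ s, NormedAddCommGroup (A s)] [∀ s, NormedSpace ℂ (A s)] [∀ s, CompleteSpace (A s)]

/-- Saturated: `A_s · A_t` spans a dense subspace of `A_{st}`. -/
def IsSaturated (𝓐 : FellBundle S A) : Prop :=
  ∀ s t : S, Dense
    (Submodule.span ℂ {c : A (s * t) | ∃ (a : A s) (b : A t), c = 𝓐.mul a b} : Set (A (s * t)))

/-- Semi-abelian: the C*-algebras `A_e`, for `e` idempotent, are commutative. -/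
def IsSemiAbelian (𝓐 : FellBundle S A) : Prop :=
  ∀ e : S, Idem e → ∀ a b : A e, 𝓐.mul a b = 𝓐.mul b a

/-- A point of the spectrum of `C*(E)`, where `E` is the restriction of the Fell bundle to the
idempotents of `S`. By the universal property of `C*(E)` (its `*`-homomorphisms are the
representations of `E`), a character of `C*(E)` is the same as a nonzero one-dimensional
representation of `E`: a family of functionals on the fibers `A_e` which is multiplicative,
`*`-preserving, compatible with the inclusions, and not identically zero. -/
@[ext]
structure Spectrum (𝓐 : FellBundle S A) where
  /-- the value `a(x)` of `a ∈ A_e` at the point `x` -/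
  eval : ∀ {e : S}, Idem e → A e →L[ℂ] ℂ
  eval_mul : ∀ {e f : S} (he : Idem e) (hf : Idem f) (a : A e) (b : A f),
    eval (he.mul hf) (𝓐.mul a b) = eval he a * eval hf b
  eval_star : ∀ {e : S} (he : Idem e) (a : A e),
    eval he.inv (𝓐.star a) = (starRingEnd ℂ) (eval he a)
  eval_incl : ∀ {e f : S} (he : Idem e) (hf : Idem f) (h : Le e f) (a : A e),
    eval hf (𝓐.incl h a) = eval he a
  nonzero : ∃ (e : S) (he : Idem e) (a : A e), eval he a ≠ 0

variable (𝓐 : FellBundle S A)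

/-- The Gelfand topology: pointwise convergence. -/
noncomputable instance : TopologicalSpace 𝓐.Spectrum :=
  TopologicalSpace.induced
    (fun (x : 𝓐.Spectrum) (p : Σ e : {e : S // Idem e}, A e.1) => x.eval p.1.2 p.2) inferInstance

/-- The open set `U_e` of the spectrum with `A_e = C₀(U_e)`. -/
def dom {e : S} (he : Idem e) : Set 𝓐.Spectrum := {x | ∃ a : A e, x.eval he a ≠ 0}

/-- `U_{s* s}` -/
def srcDom (s : S) : Set 𝓐.Spectrum := 𝓐.dom (idem_inv_mul s)

/-- `U_{s s*}` -/
def rngDom (s : S) : Set 𝓐.Spectrum := 𝓐.dom (idem_mul_inv s)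

/-- The complex number `(a* b)(x)`, for `a` and `b` in `A_s`. -/
noncomputable def innerAt {s : S} (x : 𝓐.Spectrum) (a b : A s) : ℂ :=
  x.eval (idem_inv_mul s) (𝓐.mul (𝓐.star a) b)

/-- The homeomorphisms `θ_s : U_{s* s} → U_{s s*}` are those of the canonical action of `S` on
the spectrum: they satisfy `(a* b a)(x) = (a* a)(x) b(θ_s(x))` for all `a` in `A_s` with
`(a* a)(x) ≠ 0` and all `b` in a fiber over an idempotent, and `θ_s ∘ θ_t = θ_{st}` as partial
maps. -/
structure IsCanonicalAction (θ : ∀ s : S, 𝓐.srcDom s ≃ₜ 𝓐.rngDom s) : Prop where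
  formula : ∀ (s : S) (x : 𝓐.srcDom s) (a : A s), 𝓐.innerAt x.1 a a ≠ 0 →
    ∀ (e : S) (he : Idem e) (b : A e),
      x.1.eval (he.conj s) (𝓐.mul (𝓐.star a) (𝓐.mul b a)) =
        𝓐.innerAt x.1 a a * (θ s x).1.eval he b
  mem_comp : ∀ (s t : S) (y : 𝓐.Spectrum),
    y ∈ 𝓐.srcDom (s * t) ↔ ∃ hy : y ∈ 𝓐.srcDom t, (θ t ⟨y, hy⟩).1 ∈ 𝓐.srcDom s
  comp : ∀ (s t : S) (y : 𝓐.Spectrum) (hst : y ∈ 𝓐.srcDom (s * t)) (hy : y ∈ 𝓐.srcDom t)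
    (hx : (θ t ⟨y, hy⟩).1 ∈ 𝓐.srcDom s),
    (θ (s * t) ⟨y, hst⟩).1 = (θ s ⟨(θ t ⟨y, hy⟩).1, hx⟩).1

/-! ## The groupoid of germs -/

/-- Pairs `(s, x)` with `x ∈ U_{s* s}`. -/
structure GermPair where
  s : S
  x : 𝓐.Spectrum
  mem : x ∈ 𝓐.srcDom s

/-- `(s, x)` and `(t, y)` have the same germ iff `x = y` and `se = te` for some idempotent `e`
with `x ∈ U_e`. -/
def GermRel (p q : 𝓐.GermPair) : Prop :=
  p.x = q.x ∧ ∃ (e : S) (he : Idem e), p.x ∈ 𝓐.dom he ∧ p.s * e = q.s * e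

/-- The set of germs. -/
def Germ : Type _ := Quot 𝓐.GermRel

/-- The germ `[s, x]`. -/
def germ (s : S) (x : 𝓐.Spectrum) (hx : x ∈ 𝓐.srcDom s) : 𝓐.Germ := Quot.mk _ ⟨s, x, hx⟩

/-- The source `x` of the germ `[s, x]`. -/
def germSrc : 𝓐.Germ → 𝓐.Spectrum := Quot.lift (fun p => p.x) fun _ _ h => h.1

/-- The set `O(s, U)` of the germs `[s, x]` with `x ∈ U`. -/
def germSet (s : S) (U : Set 𝓐.Spectrum) : Set 𝓐.Germ :=
  {g | ∃ (x : 𝓐.Spectrum) (hx : x ∈ 𝓐.srcDom s), x ∈ U ∧ g = 𝓐.germ s x hx}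

/-- The topology generated by the sets `O(s, U)`, for `U` an open subset of `U_{s* s}`. -/
instance : TopologicalSpace 𝓐.Germ :=
  TopologicalSpace.generateFrom
    {W | ∃ (s : S) (U : Set 𝓐.Spectrum), IsOpen U ∧ U ⊆ 𝓐.srcDom s ∧ W = 𝓐.germSet s U}

theorem germSrc_mem {s : S} (g : 𝓐.germSet s (𝓐.srcDom s)) :
    𝓐.germSrc g.1 ∈ 𝓐.srcDom s := by
  obtain ⟨g, x, hx, _, rfl⟩ := g
  exact hx

/-! ## The total space of the line bundle -/

/-- Triples `(a, s, x)` with `a ∈ A_s` and `x ∈ U_{s* s}`. -/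
structure Trip where
  s : S
  a : A s
  x : 𝓐.Spectrum
  mem : x ∈ 𝓐.srcDom s

/-- The relation `a =ₓ b`, i.e. `((a - b)* (a - b))(x) = 0`, for `a` and `b` in the same fiber;
the fiber is written as `A s` and as `A t` with `s = t`. -/
def EqAt {s t : S} (h : s = t) (x : 𝓐.Spectrum) (a : A s) (b : A t) : Prop :=
  𝓐.innerAt x ((h ▸ a : A t) - b) ((h ▸ a : A t) - b) = 0

/-- `(a, s, x) ∼ (a', s', x')` iff `x = x'` and there are an idempotent `e` and `b ∈ A_e` such
that `b(x) ≠ 0`, `se = s'e` and `ab =ₓ a'b`. -/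
def TripRel (p q : 𝓐.Trip) : Prop :=
  p.x = q.x ∧ ∃ (e : S) (he : Idem e) (b : A e), p.x.eval he b ≠ 0 ∧
    ∃ h : p.s * e = q.s * e, 𝓐.EqAt h p.x (𝓐.mul p.a b) (𝓐.mul q.a b)

/-- The total space `L` of the line bundle. -/
def L : Type _ := Quot 𝓐.TripRel

/-- The class `[a, s, x]`. -/
def cls (s : S) (a : A s) (x : 𝓐.Spectrum) (hx : x ∈ 𝓐.srcDom s) : 𝓐.L :=
  Quot.mk _ ⟨s, a, x, hx⟩

/-- The projection `[a, s, x] ↦ [s, x]` of `L` onto the set of germs. -/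
def proj : 𝓐.L → 𝓐.Germ :=
  Quot.map (fun p => ⟨p.s, p.x, p.mem⟩)
    fun _ _ h => ⟨h.1, h.2.choose, h.2.choose_spec.choose,
      ⟨h.2.choose_spec.choose_spec.choose, h.2.choose_spec.choose_spec.choose_spec.1⟩,
      h.2.choose_spec.choose_spec.choose_spec.2.choose⟩

/-- The local section `â` of `L` over `O_s`, given by `â([s, x]) = [a, s, x]`. -/
def hat {s : S} (a : A s) (g : 𝓐.germSet s (𝓐.srcDom s)) : 𝓐.L :=
  𝓐.cls s a (𝓐.germSrc g.1) (𝓐.germSrc_mem g)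

end

end FellBundle

/-! # Topological groupoids -/

/-- A groupoid with set of arrows `G` and set of units `X`. -/
structure GroupoidStr (G X : Type*) where
  src : G → X
  rng : G → X
  /-- the inclusion of the units into the arrows -/
  unit : X → G
  /-- the product `gh` of two composable arrows -/
  mul : ∀ g h : G, src g = rng h → G
  inv : G → G
  src_unit : ∀ x, src (unit x) = x
  rng_unit : ∀ x, rng (unit x) = x
  src_mul : ∀ g h (c : src g = rng h), src (mul g h c) = src h
  rng_mul : ∀ g h (c : src g = rng h), rng (mul g h c) = rng g
  src_inv : ∀ g, src (inv g) = rng g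
  rng_inv : ∀ g, rng (inv g) = src g
  mul_assoc : ∀ g h k (c : src g = rng h) (c' : src h = rng k)
    (d : src (mul g h c) = rng k) (d' : src g = rng (mul h k c')),
    mul (mul g h c) k d = mul g (mul h k c') d'
  unit_mul : ∀ g (c : src (unit (rng g)) = rng g), mul (unit (rng g)) g c = g
  mul_unit : ∀ g (c : src g = rng (unit (src g))), mul g (unit (src g)) c = g
  mul_inv : ∀ g (c : src g = rng (inv g)), mul g (inv g) c = unit (rng g)
  inv_mul : ∀ g (c : src (inv g) = rng g), mul (inv g) g c = unit (src g)

namespace GroupoidStr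

/-- Topological groupoids (not necessarily Hausdorff). The topological space `X` of units is
homeomorphic to its image in `G`. -/
structure IsTopological {G X : Type*} [TopologicalSpace G] [TopologicalSpace X]
    (𝓖 : GroupoidStr G X) : Prop where
  isEmbedding_unit : Topology.IsEmbedding 𝓖.unit
  continuous_src : Continuous 𝓖.src
  continuous_rng : Continuous 𝓖.rng
  continuous_mul :
    Continuous fun q : {q : G × G // 𝓖.src q.1 = 𝓖.rng q.2} => 𝓖.mul q.1.1 q.1.2 q.2
  continuous_inv : Continuous 𝓖.inv

/-- Étale groupoids: the unit space is locally compact and Hausdorff and the range map is a local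
homeomorphism. -/
structure IsEtale {G X : Type*} [TopologicalSpace G] [TopologicalSpace X]
    (𝓖 : GroupoidStr G X) : Prop extends 𝓖.IsTopological where
  t2Space : T2Space X
  locallyCompactSpace : LocallyCompactSpace X
  isLocalHomeomorph_rng : IsLocalHomeomorph 𝓖.rng

end GroupoidStr

/-! # Banach bundles and Fell bundles over groupoids -/

/-- The fiber of `p` over `b`. (It carries the topology of its norm.) -/
def BundleFiber {B E : Type*} (p : E → B) (b : B) : Type _ := {v : E // p v = b}

/-- A structure of complex Banach space on every fiber of `p`. -/
class BanachFibers {B E : Type*} (p : E → B) where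
  [normedAddCommGroup : ∀ b, NormedAddCommGroup (BundleFiber p b)]
  [normedSpace : ∀ b, NormedSpace ℂ (BundleFiber p b)]
  [completeSpace : ∀ b, CompleteSpace (BundleFiber p b)]

instance {B E : Type*} (p : E → B) [BanachFibers p] (b : B) :
    NormedAddCommGroup (BundleFiber p b) := BanachFibers.normedAddCommGroup b

instance {B E : Type*} (p : E → B) [BanachFibers p] (b : B) :
    NormedSpace ℂ (BundleFiber p b) := BanachFibers.normedSpace b

instance {B E : Type*} (p : E → B) [BanachFibers p] (b : B) :
    CompleteSpace (BundleFiber p b) := BanachFibers.completeSpace b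

section

variable {B E : Type*} (p : E → B)

/-- An element of the total space, seen in its own fiber. -/
def toFiber (v : E) : BundleFiber p (p v) := ⟨v, rfl⟩

/-- Upper semicontinuous Banach bundles. The last condition is about nets in the total space,
replaced by filters. -/
structure IsUSCBanachBundle [TopologicalSpace B] [TopologicalSpace E] [BanachFibers p] :
    Prop where
  continuous_proj : Continuous p
  isOpenMap_proj : IsOpenMap p
  surjective_proj : Function.Surjective p
  upperSemicontinuous_norm : UpperSemicontinuous fun v : E => ‖toFiber p v‖
  continuous_add : Continuous fun q : {q : E × E // p q.1 = p q.2} =>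
    ((⟨q.1.1, q.2⟩ + toFiber p q.1.2 : BundleFiber p (p q.1.2)).1 : E)
  continuous_smul : ∀ c : ℂ, Continuous fun v : E => ((c • toFiber p v).1 : E)
  le_nhds_zero : ∀ (b : B) (l : Filter E), Filter.Tendsto p l (nhds b) →
    Filter.Tendsto (fun v : E => ‖toFiber p v‖) l (nhds 0) →
    l ≤ nhds ((0 : BundleFiber p b).1 : E)

/-- Local triviality as a complex line bundle: there are fiberwise linear local trivializations
with model fiber `ℂ`. -/
def IsLocallyTrivialLine [TopologicalSpace B] [TopologicalSpace E] [BanachFibers p] : Prop :=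
  ∀ b : B, ∃ e : Bundle.Trivialization ℂ p, b ∈ e.baseSet ∧
    ∀ b' ∈ e.baseSet, IsLinearMap ℂ fun v : BundleFiber p b' => (e v.1).2

end

/-- A Fell bundle over the topological groupoid `𝓖`, with projection `p`. -/
structure GroupoidFellBundle {G X E : Type*} [TopologicalSpace G] [TopologicalSpace E]
    (𝓖 : GroupoidStr G X) (p : E → G) [BanachFibers p] where
  isUSCBanachBundle : IsUSCBanachBundle p
  /-- the bilinear multiplication of two fibers over composable arrows -/
  mul : ∀ {g h : G} (c : 𝓖.src g = 𝓖.rng h),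
    BundleFiber p g →ₗ[ℂ] BundleFiber p h →ₗ[ℂ] BundleFiber p (𝓖.mul g h c)
  /-- the conjugate linear involution -/
  star : ∀ {g : G}, BundleFiber p g →ₗ⋆[ℂ] BundleFiber p (𝓖.inv g)
  mul_assoc : ∀ {g h k : G} (c : 𝓖.src g = 𝓖.rng h) (c' : 𝓖.src h = 𝓖.rng k)
    (d : 𝓖.src (𝓖.mul g h c) = 𝓖.rng k) (d' : 𝓖.src g = 𝓖.rng (𝓖.mul h k c'))
    (u : BundleFiber p g) (v : BundleFiber p h) (w : BundleFiber p k),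
    (mul d (mul c u v) w).1 = (mul d' u (mul c' v w)).1
  continuous_mul : Continuous fun q : {q : E × E // 𝓖.src (p q.1) = 𝓖.rng (p q.2)} =>
    ((mul q.2 (toFiber p q.1.1) (toFiber p q.1.2)).1 : E)
  norm_mul_le : ∀ {g h : G} (c : 𝓖.src g = 𝓖.rng h) (u : BundleFiber p g)
    (v : BundleFiber p h), ‖mul c u v‖ ≤ ‖u‖ * ‖v‖
  star_star : ∀ {g : G} (u : BundleFiber p g), (star (star u)).1 = u.1
  norm_star : ∀ {g : G} (u : BundleFiber p g), ‖star u‖ = ‖u‖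
  star_mul : ∀ {g h : G} (c : 𝓖.src g = 𝓖.rng h)
    (c' : 𝓖.src (𝓖.inv h) = 𝓖.rng (𝓖.inv g)) (u : BundleFiber p g) (v : BundleFiber p h),
    (star (mul c u v)).1 = (mul c' (star v) (star u)).1
  continuous_star : Continuous fun v : E => ((star (toFiber p v)).1 : E)
  norm_star_mul_self : ∀ {g : G} (c : 𝓖.src (𝓖.inv g) = 𝓖.rng g) (u : BundleFiber p g),
    ‖mul c (star u) u‖ = ‖u‖ ^ 2
  /-- `u* u` is positive in the C*-algebra over the unit `s(g)`, i.e. of the form `w* w` with `w`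
  in this C*-algebra -/
  star_mul_self_pos : ∀ {g : G} (c : 𝓖.src (𝓖.inv g) = 𝓖.rng g) (u : BundleFiber p g),
    ∃ (w : BundleFiber p (𝓖.unit (𝓖.src g)))
      (d : 𝓖.src (𝓖.inv (𝓖.unit (𝓖.src g))) = 𝓖.rng (𝓖.unit (𝓖.src g))),
      (mul c (star u) u).1 = (mul d (star w) w).1

namespace GroupoidFellBundle

section

variable {G X E : Type*} [TopologicalSpace G] [TopologicalSpace X] [TopologicalSpace E]
  {𝓖 : GroupoidStr G X} {p : E → G} [BanachFibers p] (𝓛 : GroupoidFellBundle 𝓖 p)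

/-- Fell line bundles: one-dimensional, locally trivial, continuous Fell bundles. -/
structure IsFellLineBundle (_𝓛 : GroupoidFellBundle 𝓖 p) : Prop where
  finrank_fiber : ∀ g : G, Module.finrank ℂ (BundleFiber p g) = 1
  isLocallyTrivialLine : IsLocallyTrivialLine p
  continuous_norm : Continuous fun v : E => ‖toFiber p v‖

/-- The product of two composable elements of the total space. -/
def tmul (v w : E) (c : 𝓖.src (p v) = 𝓖.rng (p w)) : E :=
  (𝓛.mul c (toFiber p v) (toFiber p w)).1

/-- The involution on the total space. -/
def tstar (v : E) : E := (𝓛.star (toFiber p v)).1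

/-- `u` is the unit element `1_x` of the fiber over the unit `x`. -/
def IsOne (x : X) (u : E) : Prop :=
  p u = 𝓖.unit x ∧ ∀ w : E, p w = 𝓖.unit x →
    (∃ c, 𝓛.tmul u w c = w) ∧ (∃ c, 𝓛.tmul w u c = w)

/-- Unitary elements: `v* v` and `v v*` are the unit elements of the fibers over the source and
the range of `p v`. -/
def IsUnitary (v : E) : Prop :=
  (∃ c, 𝓛.IsOne (𝓖.src (p v)) (𝓛.tmul (𝓛.tstar v) v c)) ∧
    (∃ c, 𝓛.IsOne (𝓖.rng (p v)) (𝓛.tmul v (𝓛.tstar v) c))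

/-- The space of unitary elements, with the topology of the total space. -/
def Unitaries : Type _ := {v : E // 𝓛.IsUnitary v}

instance : TopologicalSpace 𝓛.Unitaries :=
  TopologicalSpace.induced (fun σ : 𝓛.Unitaries => σ.1) inferInstance

end

end GroupoidFellBundle

/-! # Twists -/

/-- A twist over the groupoid `𝓖`: a central extension of topological groupoids
`𝕋 × X → T → G` with `T` locally compact, the first map a homeomorphism onto its image, the second
one a continuous open surjection, and both the identity on units. -/
structure GroupoidTwist {G X : Type*} [TopologicalSpace G] [TopologicalSpace X]
    (𝓖 : GroupoidStr G X) (T : Type*) [TopologicalSpace T] where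
  /-- the extension groupoid -/
  str : GroupoidStr T X
  isTopological : str.IsTopological
  locallyCompactSpace : LocallyCompactSpace T
  ι : Circle × X → T
  π : T → G
  src_ι : ∀ q, str.src (ι q) = q.2
  rng_ι : ∀ q, str.rng (ι q) = q.2
  ι_mul : ∀ (z w : Circle) (x : X) (c : str.src (ι (z, x)) = str.rng (ι (w, x))),
    ι (z * w, x) = str.mul (ι (z, x)) (ι (w, x)) c
  isEmbedding_ι : Topology.IsEmbedding ι
  src_π : ∀ σ, 𝓖.src (π σ) = str.src σ
  rng_π : ∀ σ, 𝓖.rng (π σ) = str.rng σ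
  π_mul : ∀ (σ τ : T) (c : str.src σ = str.rng τ) (d : 𝓖.src (π σ) = 𝓖.rng (π τ)),
    π (str.mul σ τ c) = 𝓖.mul (π σ) (π τ) d
  continuous_π : Continuous π
  isOpenMap_π : IsOpenMap π
  surjective_π : Function.Surjective π
  exact : ∀ (σ : T) (x : X), π σ = 𝓖.unit x ↔ ∃ z : Circle, σ = ι (z, x)
  central : ∀ (z : Circle) (σ : T) (c : str.src (ι (z, str.rng σ)) = str.rng σ)
    (d : str.src σ = str.rng (ι (z, str.src σ))),
    str.mul (ι (z, str.rng σ)) σ c = str.mul σ (ι (z, str.src σ)) d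

namespace GroupoidFellBundle

section

variable {G X E : Type*} [TopologicalSpace G] [TopologicalSpace X] [TopologicalSpace E]
  {𝓖 : GroupoidStr G X} {p : E → G} [BanachFibers p] (𝓛 : GroupoidFellBundle 𝓖 p)

/-- The twist on the space of unitary elements has the structure inherited from the Fell line
bundle, and the line bundle is recovered from it as `(ℂ × Σ)/𝕋`, through the map
`(c, σ) ↦ c • σ` and the action `z (c, σ) = (z⁻¹ c, z σ)`. -/
structure IsTwistOfUnitaries (T : GroupoidTwist 𝓖 𝓛.Unitaries) : Prop where
  π_eq : ∀ σ, T.π σ = p σ.1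
  mul_eq : ∀ (σ τ : 𝓛.Unitaries) (c : T.str.src σ = T.str.rng τ)
    (d : 𝓖.src (p σ.1) = 𝓖.rng (p τ.1)), (T.str.mul σ τ c).1 = 𝓛.tmul σ.1 τ.1 d
  inv_eq : ∀ σ, (T.str.inv σ).1 = 𝓛.tstar σ.1
  ι_eq : ∀ (z : Circle) (x : X),
    ∃ u : E, 𝓛.IsOne x u ∧ (T.ι (z, x)).1 = ((z : ℂ) • toFiber p u).1
  isOpenQuotientMap_smul :
    IsOpenQuotientMap fun q : ℂ × 𝓛.Unitaries => ((q.1 • toFiber p q.2.1).1 : E)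
  smul_eq_smul_iff : ∀ q r : ℂ × 𝓛.Unitaries,
    (q.1 • toFiber p q.2.1).1 = (r.1 • toFiber p r.2.1).1 ↔
      ∃ z : Circle, r.1 = (z⁻¹ : Circle) * q.1 ∧ r.2.1 = ((z : ℂ) • toFiber p q.2.1).1

end

end GroupoidFellBundle

/-! # The structure of the groupoid of germs and of the line bundle -/

namespace FellBundle

section

variable {S : Type*} [InverseSemigroup S] {A : S → Type*}
  [∀ s, NormedAddCommGroup (A s)] [∀ s, NormedSpace ℂ (A s)] [∀ s, CompleteSpace (A s)]
  (𝓐 : FellBundle S A)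

/-- `𝓖` is the groupoid of germs of the action `θ`. -/
structure IsGermGroupoid (θ : ∀ s : S, 𝓐.srcDom s ≃ₜ 𝓐.rngDom s)
    (𝓖 : GroupoidStr 𝓐.Germ 𝓐.Spectrum) : Prop where
  src_germ : ∀ s x hx, 𝓖.src (𝓐.germ s x hx) = x
  rng_germ : ∀ s x hx, 𝓖.rng (𝓐.germ s x hx) = (θ s ⟨x, hx⟩).1
  unit_eq : ∀ (e : S) (he : Idem e) (x : 𝓐.Spectrum), x ∈ 𝓐.dom he →
    ∃ hx, 𝓖.unit x = 𝓐.germ e x hx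
  mul_germ : ∀ s x hx t y hy (c : 𝓖.src (𝓐.germ s x hx) = 𝓖.rng (𝓐.germ t y hy)),
    ∃ hst, 𝓖.mul (𝓐.germ s x hx) (𝓐.germ t y hy) c = 𝓐.germ (s * t) y hst
  inv_germ : ∀ s x hx, ∃ h, 𝓖.inv (𝓐.germ s x hx) = 𝓐.germ s⁻¹ (θ s ⟨x, hx⟩).1 h

/-- The class `[a, s, x]` as an element of the fiber over `[s, x]`. -/
def fmk (s : S) (a : A s) (x : 𝓐.Spectrum) (hx : x ∈ 𝓐.srcDom s) :
    BundleFiber 𝓐.proj (𝓐.germ s x hx) := ⟨𝓐.cls s a x hx, rfl⟩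

/-- The linear structure and the norm of the fibers of `L`. -/
structure HasCanonicalFibers [BanachFibers 𝓐.proj] : Prop where
  /-- `[a, s, x] + [b, t, x] = [ac + bc, se, x]` if `se = te`, `c ∈ A_e` and `c(x) = 1` -/
  add_eq : ∀ (s t : S) (a : A s) (b : A t) (x : 𝓐.Spectrum) (hs : x ∈ 𝓐.srcDom s)
    (ht : x ∈ 𝓐.srcDom t) (hp : 𝓐.proj (𝓐.cls t b x ht) = 𝓐.germ s x hs)
    (e : S) (he : Idem e) (h : t * e = s * e) (c : A e), x.eval he c = 1 →
    ∃ hse : x ∈ 𝓐.srcDom (s * e),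
      (𝓐.fmk s a x hs + ⟨𝓐.cls t b x ht, hp⟩).1 =
        𝓐.cls (s * e) (𝓐.mul a c + (h ▸ 𝓐.mul b c : A (s * e))) x hse
  /-- the special case of two elements of the same fiber `A_s` -/
  fmk_add : ∀ (s : S) (a b : A s) x hx,
    𝓐.fmk s a x hx + 𝓐.fmk s b x hx = 𝓐.fmk s (a + b) x hx
  smul_fmk : ∀ (c : ℂ) (s : S) (a : A s) x hx, c • 𝓐.fmk s a x hx = 𝓐.fmk s (c • a) x hx
  /-- `‖[a, s, x]‖² = (a* a)(x)` -/
  norm_fmk : ∀ (s : S) (a : A s) x hx, ((‖𝓐.fmk s a x hx‖ : ℂ)) ^ 2 = 𝓐.innerAt x a a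

/-- The topology `τ` makes `L` an upper semicontinuous Banach bundle over the space of germs, and
all the local sections `â` continuous. -/
def IsBundleTopology [BanachFibers 𝓐.proj] (τ : TopologicalSpace 𝓐.L) : Prop :=
  IsUSCBanachBundle 𝓐.proj ∧ ∀ (s : S) (a : A s), Continuous (𝓐.hat a)

/-- The multiplication `[a, s, x] [b, t, y] = [ab, st, y]` and the involution
`[a, s, x]* = [a*, s*, θ_s(x)]` on `L`. -/
structure HasCanonicalOperations (θ : ∀ s : S, 𝓐.srcDom s ≃ₜ 𝓐.rngDom s)
    {𝓖 : GroupoidStr 𝓐.Germ 𝓐.Spectrum} [BanachFibers 𝓐.proj] [TopologicalSpace 𝓐.L]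
    (𝓛 : GroupoidFellBundle 𝓖 𝓐.proj) : Prop where
  mul_fmk : ∀ (s : S) (a : A s) x hx (t : S) (b : A t) y hy
    (c : 𝓖.src (𝓐.germ s x hx) = 𝓖.rng (𝓐.germ t y hy)),
    ∃ hst, (𝓛.mul c (𝓐.fmk s a x hx) (𝓐.fmk t b y hy)).1 = 𝓐.cls (s * t) (𝓐.mul a b) y hst
  star_fmk : ∀ (s : S) (a : A s) x hx,
    ∃ h, (𝓛.star (𝓐.fmk s a x hx)).1 = 𝓐.cls s⁻¹ (𝓐.star a) (θ s ⟨x, hx⟩).1 h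

end

end FellBundle

/-! Fix a point x of the spectrum and s with x in `srcDom s`, and consider the positive form ⟨a, b⟩
= (a* b)(x) on A_s. Products such as b c* of elements over s lie over the idempotent s s*, so they
commute with each other, and exchanging b c* with d c* inside a* b c* d c* c yields ⟨a, b⟩⟨c, d⟩ =
⟨a, d⟩⟨c, b⟩ (`val_rank_one`). The quotient of A_s by the null vectors therefore has dimension at
most one. Saturation makes it nonzero: there is a unit vector u with (u* u)(x) = 1
(`exists_star_mul_self_eq_one`). Everything is computed in the coordinate ⟨u, ·⟩.

Commutativity is assumed only inside each fiber A_e; the C*-identity extends it to elements of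
different idempotent fibers (`mul_comm_idem`). It also shows that (a* k b)(x) is ⟨a, b⟩ times a
scalar depending only on k and s; this scalar is k(θ_s(x)) (`val_theta`). If u and v are unit
vectors for t at y and for s at θ_t(y), then v u is one for st at y, and u* is one for t* at θ_t(y).
Hence θ_s θ_t = θ_{st}, and θ_{s*} is inverse to θ_s.

Elements p, q over semigroup elements with the same germ at x are compared after multiplication by
some c over an idempotent with c(x) = 1, which puts them in one fiber. This extends the form to
`pair`, again of rank one, continuous in x, and compatible with products and adjoints (`pair_mul`,
`pair_star`). Equivalence of triples is equality of the coordinates `pair x u _` (`pair_sub_sq`).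
These coordinates identify the fibers of L with ℂ and are charts with continuous transition
functions, so they give the topology, local triviality and the continuity of all operations. The
topology is unique because in any upper semicontinuous Banach bundle the neighborhoods of v are
determined by the base, the norm and one continuous section through v (`nhds_eq`).

For the twist, v* v = ‖v‖² · 1 and v v* = ‖v‖² · 1 show that unitary means norm one. Local sections
of norm one trivialize the unitaries locally, which gives the embedding of the circles, the openness
of the projection, and the recovery of L. -/

set_option autoImplicit false

/-! ### Elementary identities in inverse semigroups -/

namespace InverseSemigroup

section

variable {S : Type*} [InverseSemigroup S]

theorem Idem.mul_self {e : S} (he : Idem e) : e * e = e := he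

theorem Le.of_eq {s t : S} (h : s = t) : Le s t := by
  subst h
  unfold Le
  rw [← mul_assoc, mul_inv_mul]

theorem Idem.inv_mul_self {e : S} (he : Idem e) : e⁻¹ * e = e := by
  rw [he.inv_eq, he.mul_self]

theorem Idem.conj' {e : S} (he : Idem e) (s : S) : Idem (s * (e * s⁻¹)) := by
  have := he.conj s⁻¹
  rwa [inv_inv_eq] at this

end

end InverseSemigroup

namespace FellLine

section

variable {S : Type*} [InverseSemigroup S] {A : S → Type*}
  [∀ s, NormedAddCommGroup (A s)] [∀ s, NormedSpace ℂ (A s)] [∀ s, CompleteSpace (A s)]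

/-! ### The disjoint union of the fibers as a semigroup with involution -/

/-- The disjoint union of the fibers of a Fell bundle. -/
structure _root_.FellBundle.Tot (_𝓐 : FellBundle S A) where
  fst : S
  snd : A fst

variable (𝓐 : FellBundle S A)

/-- An element of a fiber as an element of the disjoint union of the fibers. -/
def _root_.FellBundle.el {s : S} (a : A s) : 𝓐.Tot := ⟨s, a⟩

theorem el_eq_of_sigma_eq {s t : S} {a : A s} {b : A t} (h : (⟨s, a⟩ : Σ s, A s) = ⟨t, b⟩) :
    𝓐.el a = 𝓐.el b := by
  cases h; rfl

instance : Semigroup 𝓐.Tot where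
  mul p q := ⟨p.1 * q.1, 𝓐.mul p.2 q.2⟩
  mul_assoc p q r := el_eq_of_sigma_eq 𝓐 (𝓐.mul_assoc p.2 q.2 r.2)

instance : StarMul 𝓐.Tot where
  star p := ⟨p.1⁻¹, 𝓐.star p.2⟩
  star_involutive p := el_eq_of_sigma_eq 𝓐 (𝓐.star_star p.2)
  star_mul p q := el_eq_of_sigma_eq 𝓐 (𝓐.star_mul p.2 q.2)

variable {𝓐}

@[simp] theorem mul_fst (p q : 𝓐.Tot) : (p * q).1 = p.1 * q.1 := rfl

@[simp] theorem star_fst (p : 𝓐.Tot) : (star p).1 = p.1⁻¹ := rfl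

@[simp] theorem el_fst {s : S} (a : A s) : (𝓐.el a).1 = s := rfl

theorem el_mul {s t : S} (a : A s) (b : A t) : 𝓐.el a * 𝓐.el b = 𝓐.el (𝓐.mul a b) := rfl

theorem star_el {s : S} (a : A s) : star (𝓐.el a) = 𝓐.el (𝓐.star a) := rfl

theorem el_cast {s t : S} (h : s = t) (a : A s) : 𝓐.el (h ▸ a : A t) = 𝓐.el a := by
  subst h; rfl

theorem exists_el (p : 𝓐.Tot) {s : S} (h : p.1 = s) : ∃ a : A s, p = 𝓐.el a := by
  subst h; exact ⟨p.2, rfl⟩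

theorem el_injective {s : S} : Function.Injective (𝓐.el : A s → 𝓐.Tot) :=
  fun _ _ h => eq_of_heq (FellBundle.Tot.mk.inj h).2

theorem idem_star_mul {p q : 𝓐.Tot} (h : p.1 = q.1) : Idem (star p * q).1 := by
  rw [mul_fst, star_fst, h]; exact idem_inv_mul _

theorem idem_mul_star {p q : 𝓐.Tot} (h : p.1 = q.1) : Idem (p * star q).1 := by
  rw [mul_fst, star_fst, h]; exact idem_mul_inv _

theorem idem_conj {p q k : 𝓐.Tot} (h : p.1 = q.1) (hk : Idem k.1) :
    Idem (star p * (k * q)).1 := by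
  simp only [mul_fst, star_fst, h]; exact hk.conj _

theorem idem_conj' {p q k : 𝓐.Tot} (h : p.1 = q.1) (hk : Idem k.1) :
    Idem (p * (k * star q)).1 := by
  simp only [mul_fst, star_fst, h]; exact hk.conj' _

theorem idem_mul {p q : 𝓐.Tot} (hp : Idem p.1) (hq : Idem q.1) : Idem (p * q).1 :=
  hp.mul hq

theorem idem_star {p : 𝓐.Tot} (hp : Idem p.1) : Idem (star p).1 := hp.inv

/-! ### Idempotent fibers commute -/

theorem norm_eq_of_el_eq {s t : S} {a : A s} {b : A t} (h : 𝓐.el a = 𝓐.el b) : ‖a‖ = ‖b‖ := by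
  cases h; rfl

/-- For `d = a - b`, the choice k = d*, l = d d* gives d d* d d* = 0, and the C*-identity used twice
turns this into ‖d‖⁴ = 0. The test is made on products k l because these are the elements that
`mul_comm_mul` can handle. -/
theorem eq_of_mul_mul_eq {g : S} (hg : Idem g) {p q : 𝓐.Tot} (hp : p.1 = g) (hq : q.1 = g)
    (h : ∀ k l : 𝓐.Tot, k.1 = g → l.1 = g → p * (k * l) = q * (k * l)) : p = q := by
  obtain ⟨a, rfl⟩ := exists_el p hp
  obtain ⟨b, rfl⟩ := exists_el q hq
  set d := a - b with hd
  have key : ∀ k l : 𝓐.Tot, k.1 = g → l.1 = g → 𝓐.mul d (k * l).2 = 0 := by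
    intro k l hk hl
    have := el_injective (show 𝓐.el (𝓐.mul a (k * l).2) = 𝓐.el (𝓐.mul b (k * l).2) from
      h k l hk hl)
    rw [hd, map_sub, LinearMap.sub_apply, this, sub_self]
  have h1 := key (star (𝓐.el d)) (𝓐.el d * star (𝓐.el d)) (by simp [hg.inv_eq])
    (by simp [hg.inv_eq, hg.mul_self])
  have h2 : ‖𝓐.mul (𝓐.star (𝓐.mul (𝓐.star (𝓐.star d)) (𝓐.star d)))
      (𝓐.mul (𝓐.star (𝓐.star d)) (𝓐.star d))‖ = 0 := by
    have e : 𝓐.el (𝓐.mul (𝓐.star (𝓐.mul (𝓐.star (𝓐.star d)) (𝓐.star d)))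
        (𝓐.mul (𝓐.star (𝓐.star d)) (𝓐.star d))) =
        𝓐.el (𝓐.mul d (star (𝓐.el d) * (𝓐.el d * star (𝓐.el d))).2) := by
      change star (star (star (𝓐.el d)) * star (𝓐.el d)) *
        (star (star (𝓐.el d)) * star (𝓐.el d)) =
        𝓐.el d * (star (𝓐.el d) * (𝓐.el d * star (𝓐.el d)))
      simp only [star_mul, star_star, mul_assoc]
    rw [norm_eq_of_el_eq e, h1, norm_zero]
  rw [𝓐.norm_star_mul_self, 𝓐.norm_star_mul_self, 𝓐.norm_star] at h2
  have : d = 0 := by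
    rw [← norm_eq_zero]
    simpa using h2
  rw [sub_eq_zero.mp (show a - b = 0 from this)]

variable (hab : 𝓐.IsSemiAbelian)
include hab

theorem mul_comm_of_eq {p q : 𝓐.Tot} (hp : Idem p.1) (h : p.1 = q.1) :
    p * q = q * p := by
  obtain ⟨s, a⟩ := p
  obtain ⟨b, rfl⟩ := exists_el q h.symm
  exact congrArg 𝓐.el (hab _ hp a b)

/-- Since the index of m acts trivially on that of k and l, both m k and l m stay in the fiber of k
and l, where elements commute: m k is exchanged with l, and k with l m. -/
theorem mul_comm_mul {m k l : 𝓐.Tot} (hk : Idem k.1) (hkl : k.1 = l.1)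
    (hm : Idem m.1) (h : m.1 * k.1 = k.1) : m * (k * l) = k * l * m := by
  have h' : k.1 * m.1 = k.1 := by rw [hk.comm hm, h]
  calc m * (k * l) = m * k * l := (mul_assoc _ _ _).symm
    _ = l * (m * k) := mul_comm_of_eq hab (hm.mul hk) (by simp [← hkl, h])
    _ = l * m * k := (mul_assoc _ _ _).symm
    _ = k * (l * m) := (mul_comm_of_eq hab hk (by simp [← hkl, h'])).symm
    _ = k * l * m := (mul_assoc _ _ _).symm

/-- Elements of the fibers over idempotents commute. -/
theorem mul_comm_idem {p q : 𝓐.Tot} (hp : Idem p.1) (hq : Idem q.1) :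
    p * q = q * p := by
  have hpp : p.1 * (p.1 * q.1) = p.1 * q.1 := by rw [← mul_assoc, hp.mul_self]
  have hqq : q.1 * (p.1 * q.1) = p.1 * q.1 := by
    rw [hp.comm hq, ← mul_assoc, hq.mul_self]
  refine eq_of_mul_mul_eq (hp.mul hq) rfl (hq.comm hp) fun k l hk hl => ?_
  have ik : Idem k.1 := hk ▸ hp.mul hq
  have hkl : k.1 = l.1 := hk.trans hl.symm
  -- Both (q k) l and k l are products of two elements of the fiber over the product of the two
  -- idempotents, so p can be moved across each of them.
  calc p * q * (k * l) = p * (q * k * l) := by simp only [mul_assoc]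
    _ = q * k * l * p := mul_comm_mul hab (hq.mul ik) (by simp [hk, hl, hqq]) hp
        (by simp [hk, hqq, hpp])
    _ = q * (k * l * p) := by simp only [mul_assoc]
    _ = q * (p * (k * l)) := by rw [mul_comm_mul hab ik hkl hp (by rw [hk, hpp])]
    _ = q * p * (k * l) := by simp only [mul_assoc]

omit hab

/-! ### Values of elements at points of the spectrum -/

open Classical in
/-- The value at `x` of an element of a fiber over an idempotent. -/
noncomputable def val (x : 𝓐.Spectrum) (p : 𝓐.Tot) : ℂ :=
  if h : Idem p.1 then x.eval h p.2 else 0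

theorem val_el (x : 𝓐.Spectrum) {e : S} (he : Idem e) (a : A e) :
    val x (𝓐.el a) = x.eval he a := by
  unfold val
  exact dif_pos he

theorem val_mul (x : 𝓐.Spectrum) {p q : 𝓐.Tot} (hp : Idem p.1) (hq : Idem q.1) :
    val x (p * q) = val x p * val x q := by
  unfold val
  rw [dif_pos hp, dif_pos hq, dif_pos (show Idem (p * q).1 from hp.mul hq)]
  exact x.eval_mul hp hq p.2 q.2

theorem val_star (x : 𝓐.Spectrum) {p : 𝓐.Tot} (hp : Idem p.1) :
    val x (star p) = (starRingEnd ℂ) (val x p) := by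
  unfold val
  rw [dif_pos hp, dif_pos (show Idem (star p).1 from hp.inv)]
  exact x.eval_star hp p.2

theorem val_el_add (x : 𝓐.Spectrum) {s : S} (a b : A s) :
    val x (𝓐.el (a + b)) = val x (𝓐.el a) + val x (𝓐.el b) := by
  by_cases h : Idem s
  · rw [val_el x h, val_el x h, val_el x h, map_add]
  · unfold val; simp [FellBundle.el, h]

theorem val_el_smul (x : 𝓐.Spectrum) {s : S} (c : ℂ) (a : A s) :
    val x (𝓐.el (c • a)) = c * val x (𝓐.el a) := by
  by_cases h : Idem s
  · rw [val_el x h, val_el x h, map_smul, smul_eq_mul]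
  · unfold val; simp [FellBundle.el, h]

theorem continuous_val (p : 𝓐.Tot) : Continuous fun x : 𝓐.Spectrum => val x p := by
  by_cases h : Idem p.1
  · have : (fun x : 𝓐.Spectrum => val x p) =
        (fun f : (Σ e : {e : S // Idem e}, A e.1) → ℂ => f ⟨⟨p.1, h⟩, p.2⟩) ∘
        (fun (x : 𝓐.Spectrum) (p : Σ e : {e : S // Idem e}, A e.1) => x.eval p.1.2 p.2) := by
      ext x; exact val_el x h p.2
    rw [this]
    exact (continuous_apply _).comp continuous_induced_dom
  · have : (fun x : 𝓐.Spectrum => val x p) = fun _ => 0 := by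
      ext x; unfold val; simp [h]
    rw [this]; exact continuous_const

theorem tendsto_spectrum {α : Type*} {l : Filter α} {f : α → 𝓐.Spectrum} {x : 𝓐.Spectrum}
    (h : ∀ p : 𝓐.Tot, Idem p.1 → Filter.Tendsto (fun i => val (f i) p) l (nhds (val x p))) :
    Filter.Tendsto f l (nhds x) := by
  have hi : Topology.IsInducing
    (fun (x : 𝓐.Spectrum) (p : Σ e : {e : S // Idem e}, A e.1) => x.eval p.1.2 p.2) := ⟨rfl⟩
  rw [hi.tendsto_nhds_iff, tendsto_pi_nhds]
  rintro ⟨⟨e, he⟩, a⟩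
  have := h (𝓐.el a) he
  rw [val_el x he] at this
  refine this.congr fun i => val_el (f i) he a

theorem spectrum_ext {x y : 𝓐.Spectrum} (h : ∀ p : 𝓐.Tot, Idem p.1 → val x p = val y p) :
    x = y := by
  ext e he a
  rw [← val_el x he, ← val_el y he, h _ he]

theorem mem_dom {e : S} (he : Idem e) {x : 𝓐.Spectrum} :
    x ∈ 𝓐.dom he ↔ ∃ p : 𝓐.Tot, p.1 = e ∧ val x p ≠ 0 := by
  constructor
  · rintro ⟨a, ha⟩
    exact ⟨𝓐.el a, rfl, by rwa [val_el x he]⟩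
  · rintro ⟨p, hp, h⟩
    obtain ⟨a, rfl⟩ := exists_el p hp
    exact ⟨a, by rwa [val_el x he] at h⟩

theorem mem_srcDom {s : S} {x : 𝓐.Spectrum} :
    x ∈ 𝓐.srcDom s ↔ ∃ p : 𝓐.Tot, p.1 = s⁻¹ * s ∧ val x p ≠ 0 := mem_dom _

theorem mem_rngDom {s : S} {x : 𝓐.Spectrum} :
    x ∈ 𝓐.rngDom s ↔ ∃ p : 𝓐.Tot, p.1 = s * s⁻¹ ∧ val x p ≠ 0 := mem_dom _

theorem isOpen_dom {e : S} (he : Idem e) : IsOpen (𝓐.dom he) := by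
  have : 𝓐.dom he = ⋃ a : A e, {x | val x (𝓐.el a) ≠ 0} := by
    ext x; simp [FellBundle.dom, val_el x he]
  rw [this]
  exact isOpen_iUnion fun a => isOpen_ne.preimage (continuous_val _)

theorem isOpen_srcDom (s : S) : IsOpen (𝓐.srcDom s) := isOpen_dom _

theorem val_ne_zero_smul {x : 𝓐.Spectrum} {p : 𝓐.Tot} (h : val x p ≠ 0) :
    ∃ q : 𝓐.Tot, q.1 = p.1 ∧ val x q = 1 :=
  ⟨𝓐.el ((val x p)⁻¹ • p.2), rfl, by
    rw [val_el_smul]; exact inv_mul_cancel₀ h⟩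

theorem innerAt_eq {s : S} (x : 𝓐.Spectrum) (a b : A s) :
    𝓐.innerAt x a b = val x (star (𝓐.el a) * 𝓐.el b) :=
  (val_el x (idem_inv_mul s) (𝓐.mul (𝓐.star a) b)).symm

/-- `(p* p)(x)` is a nonnegative real number. -/
theorem val_star_mul_self (x : 𝓐.Spectrum) (p : 𝓐.Tot) :
    ∃ r : ℝ, 0 ≤ r ∧ val x (star p * p) = r := by
  obtain ⟨c, hc⟩ := 𝓐.star_mul_self_pos p.2
  have h : star p * p = star (𝓐.el c) * 𝓐.el c := el_eq_of_sigma_eq 𝓐 hc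
  have ic : Idem (𝓐.el c).1 := idem_inv_mul _
  refine ⟨Complex.normSq (val x (𝓐.el c)), Complex.normSq_nonneg _, ?_⟩
  rw [h, val_mul x ic.inv ic, val_star x ic, Complex.normSq_eq_conj_mul_self]

theorem val_star_mul (x : 𝓐.Spectrum) {p q : 𝓐.Tot} (h : p.1 = q.1) :
    val x (star q * p) = (starRingEnd ℂ) (val x (star p * q)) := by
  rw [← val_star x (idem_star_mul h), star_mul, star_star]

/-! ### Cauchy–Schwarz and rank-one identities for the forms (a* b)(x) -/

include hab

/-- k commutes with b c*, which lies over an idempotent. The consequence is that the ratio of (a* k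
b)(x) to (a* b)(x) does not depend on a and b, which makes θ well defined. -/
theorem val_conj_exchange (x : 𝓐.Spectrum) {a b c d k : 𝓐.Tot} (h₁ : a.1 = b.1)
    (h₂ : b.1 = c.1) (h₃ : c.1 = d.1) (hk : Idem k.1) :
    val x (star a * (k * b)) * val x (star c * d) =
      val x (star a * b) * val x (star c * (k * d)) := by
  rw [← val_mul x (idem_conj h₁ hk) (idem_star_mul h₃),
    ← val_mul x (idem_star_mul h₁) (idem_conj h₃ hk)]
  congr 1
  calc star a * (k * b) * (star c * d) = star a * (k * (b * star c)) * d := by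
        simp only [mul_assoc]
    _ = star a * (b * star c * k) * d := by rw [mul_comm_idem hab hk (idem_mul_star h₂)]
    _ = star a * b * (star c * (k * d)) := by simp only [mul_assoc]

/-- Commuting k with b b* gives (b* k b)(x)² = (b* b)(x) · (b* k² b)(x). -/
theorem val_conj_ne_zero (x : 𝓐.Spectrum) {b k : 𝓐.Tot} (hk : Idem k.1)
    (h : val x (star b * (k * b)) ≠ 0) : val x (star b * b) ≠ 0 := by
  intro h0
  have hkk : Idem (k * k).1 := hk.mul hk
  have key : val x (star b * (k * b)) * val x (star b * (k * b)) =
      val x (star b * b) * val x (star b * (k * k * b)) := by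
    rw [← val_mul x (idem_conj rfl hk) (idem_conj rfl hk),
      ← val_mul x (idem_star_mul rfl) (idem_conj rfl hkk)]
    congr 1
    calc star b * (k * b) * (star b * (k * b)) = star b * (k * (b * star b)) * (k * b) := by
          simp only [mul_assoc]
      _ = star b * (b * star b * k) * (k * b) := by
          rw [mul_comm_idem hab hk (idem_mul_star rfl)]
      _ = star b * b * (star b * (k * k * b)) := by simp only [mul_assoc]
  rw [h0, zero_mul] at key
  exact h (mul_self_eq_zero.mp key)

/-- The degenerate case of Cauchy–Schwarz: |(a* b)(x)|² = (a* (b b*) a)(x), to which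
`val_conj_ne_zero` applies with k = b b*. -/
theorem val_star_mul_eq_zero (x : 𝓐.Spectrum) {a b : 𝓐.Tot} (h : a.1 = b.1)
    (ha : val x (star a * a) = 0) : val x (star a * b) = 0 := by
  by_contra h0
  refine val_conj_ne_zero hab x (b := a) (k := b * star b) (idem_mul_star rfl) ?_ ha
  have : star a * (b * star b * a) = star a * b * (star b * a) := by simp only [mul_assoc]
  rw [this, val_mul x (idem_star_mul h) (idem_star_mul h.symm), val_star_mul x h]
  exact mul_ne_zero h0 ((map_ne_zero _).mpr h0)

/-- The forms `(a* b)(x)` have rank one. -/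
theorem val_rank_one (x : 𝓐.Spectrum) {a b c d : 𝓐.Tot} (h₁ : a.1 = b.1)
    (h₂ : b.1 = c.1) (h₃ : c.1 = d.1) :
    val x (star a * b) * val x (star c * d) = val x (star a * d) * val x (star c * b) := by
  -- If (c* c)(x) = 0, both sides vanish by Cauchy–Schwarz. Otherwise multiplying by c* c creates
  -- the factors b c* and d c*, which commute.
  by_cases hc : val x (star c * c) = 0
  · rw [val_star_mul_eq_zero hab x h₃ hc, val_star_mul_eq_zero hab x h₂.symm hc, mul_zero,
      mul_zero]
  · refine mul_right_cancel₀ hc ?_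
    have i₁ := idem_star_mul h₁
    have i₂ := idem_star_mul h₃
    have i₃ : Idem (star c * c).1 := idem_star_mul rfl
    have i₄ := idem_star_mul (h₁.trans (h₂.trans h₃))
    have i₅ := idem_star_mul h₂.symm
    rw [← val_mul x i₁ i₂, ← val_mul x (idem_mul i₁ i₂) i₃, ← val_mul x i₄ i₅,
      ← val_mul x (idem_mul i₄ i₅) i₃]
    congr 1
    calc star a * b * (star c * d) * (star c * c)
        = star a * ((b * star c) * (d * star c)) * c := by simp only [mul_assoc]
      _ = star a * ((d * star c) * (b * star c)) * c := by
          rw [mul_comm_idem hab (idem_mul_star h₂) (idem_mul_star h₃.symm)]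
      _ = star a * d * (star c * b) * (star c * c) := by simp only [mul_assoc]

end

end FellLine

namespace FellLine

section

variable {S : Type*} [InverseSemigroup S] {A : S → Type*}
  [∀ s, NormedAddCommGroup (A s)] [∀ s, NormedSpace ℂ (A s)] [∀ s, CompleteSpace (A s)]
  {𝓐 : FellBundle S A}

/-! ### The spectrum is a locally compact Hausdorff space -/

/-- Multiplicativity gives |a(x)|² = |a²(x)| ≤ C ‖a‖² with C the operator norm. Hence C ≤ √C, so C ≤
1. -/
theorem norm_eval_le (x : 𝓐.Spectrum) {e : S} (he : Idem e) (a : A e) :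
    ‖x.eval he a‖ ≤ ‖a‖ := by
  set C := ‖x.eval he‖ with hC
  have h0 : 0 ≤ C := norm_nonneg _
  have h1 : ∀ a : A e, ‖x.eval he a‖ ^ 2 ≤ C * ‖a‖ ^ 2 := by
    intro a
    obtain ⟨b, hb⟩ := exists_el (𝓐.el a * 𝓐.el a) (s := e) he
    have h2 : x.eval he b = x.eval he a * x.eval he a := by
      rw [← val_el x he, ← hb, val_mul x he he, val_el x he]
    have h3 : ‖b‖ ≤ ‖a‖ ^ 2 := by
      rw [← norm_eq_of_el_eq hb, sq]
      exact 𝓐.norm_mul_le a a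
    calc ‖x.eval he a‖ ^ 2 = ‖x.eval he b‖ := by rw [h2, norm_mul, sq]
      _ ≤ C * ‖b‖ := (x.eval he).le_opNorm b
      _ ≤ C * ‖a‖ ^ 2 := by gcongr
  have h2 : C ≤ √C := by
    refine ContinuousLinearMap.opNorm_le_bound _ (Real.sqrt_nonneg _) fun a => ?_
    refine le_of_sq_le_sq ?_ (by positivity)
    rw [mul_pow, Real.sq_sqrt h0]
    exact h1 a
  have h3 : C ≤ 1 := by
    by_contra h
    push Not at h
    have : C * C ≤ C := by
      calc C * C ≤ √C * √C := by gcongr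
        _ = C := Real.mul_self_sqrt h0
    nlinarith
  calc ‖x.eval he a‖ ≤ C * ‖a‖ := (x.eval he).le_opNorm a
    _ ≤ 1 * ‖a‖ := by gcongr
    _ = ‖a‖ := one_mul _

/-- The evaluation map from the spectrum to the product of copies of `ℂ`. -/
noncomputable def evalAll (x : 𝓐.Spectrum) (p : Σ e : {e : S // Idem e}, A e.1) : ℂ := x.eval p.1.2 p.2

theorem isEmbedding_evalAll :
    Topology.IsEmbedding (evalAll : 𝓐.Spectrum → (Σ e : {e : S // Idem e}, A e.1) → ℂ) := by
  refine ⟨⟨rfl⟩, fun x y h => ?_⟩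
  ext e he a
  exact congrFun h ⟨⟨e, he⟩, a⟩

instance : T2Space 𝓐.Spectrum := isEmbedding_evalAll.t2Space

variable (𝓐) in
/-- The compact space of all one-dimensional representations, including zero. -/
def repSet : Set ((Σ e : {e : S // Idem e}, A e.1) → ℂ) :=
  {f | (∀ p, f p ∈ Metric.closedBall (0 : ℂ) ‖p.2‖) ∧
    (∀ (e : {e : S // Idem e}) (a b : A e.1), f ⟨e, a + b⟩ = f ⟨e, a⟩ + f ⟨e, b⟩) ∧
    (∀ (e : {e : S // Idem e}) (c : ℂ) (a : A e.1), f ⟨e, c • a⟩ = c * f ⟨e, a⟩) ∧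
    (∀ (e e' : {e : S // Idem e}) (a : A e.1) (b : A e'.1),
      f ⟨⟨e.1 * e'.1, e.2.mul e'.2⟩, 𝓐.mul a b⟩ = f ⟨e, a⟩ * f ⟨e', b⟩) ∧
    (∀ (e : {e : S // Idem e}) (a : A e.1),
      f ⟨⟨e.1⁻¹, e.2.inv⟩, 𝓐.star a⟩ = (starRingEnd ℂ) (f ⟨e, a⟩)) ∧
    (∀ (e e' : {e : S // Idem e}) (h : Le e.1 e'.1) (a : A e.1),
      f ⟨e', 𝓐.incl h a⟩ = f ⟨e, a⟩)}

theorem isClosed_forall {ι : Sort*} {F : Type*} [TopologicalSpace F] {P : ι → F → Prop}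
    (h : ∀ i, IsClosed {f | P i f}) : IsClosed {f | ∀ i, P i f} := by
  rw [Set.ofPred_forall]; exact isClosed_iInter h

/-- A product of closed discs is compact by Tychonoff, and the algebraic relations are closed
conditions on coordinates. -/
theorem isCompact_repSet : IsCompact (repSet 𝓐) := by
  have h : IsCompact {f : (Σ e : {e : S // Idem e}, A e.1) → ℂ |
      ∀ p, f p ∈ Metric.closedBall (0 : ℂ) ‖p.2‖} :=
    isCompact_pi_infinite fun p => isCompact_closedBall _ _
  refine h.inter_right (t := {f | _ ∧ _}) ?_
  have hc := fun p : (Σ e : {e : S // Idem e}, A e.1) =>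
    (continuous_apply p : Continuous fun f : (Σ e : {e : S // Idem e}, A e.1) → ℂ => f p)
  refine IsClosed.inter ?_ (IsClosed.inter ?_ (IsClosed.inter ?_ (IsClosed.inter ?_ ?_)))
  · exact isClosed_forall fun e => isClosed_forall fun a => isClosed_forall fun b =>
      isClosed_eq (hc _) ((hc _).add (hc _))
  · exact isClosed_forall fun e => isClosed_forall fun c => isClosed_forall fun a =>
      isClosed_eq (hc _) (continuous_const.mul (hc _))
  · exact isClosed_forall fun e => isClosed_forall fun e' => isClosed_forall fun a =>
      isClosed_forall fun b => isClosed_eq (hc _) ((hc _).mul (hc _))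
  · exact isClosed_forall fun e => isClosed_forall fun a =>
      isClosed_eq (hc _) (Complex.continuous_conj.comp (hc _))
  · exact isClosed_forall fun e => isClosed_forall fun e' => isClosed_forall fun h =>
      isClosed_forall fun a => isClosed_eq (hc _) (hc _)

theorem evalAll_mem (x : 𝓐.Spectrum) : evalAll x ∈ repSet 𝓐 := by
  refine ⟨fun p => ?_, fun e a b => map_add _ _ _, fun e c a => ?_,
    fun e e' a b => x.eval_mul _ _ _ _, fun e a => x.eval_star _ _,
    fun e e' h a => x.eval_incl _ _ _ _⟩
  · rw [mem_closedBall_zero_iff]; exact norm_eval_le x _ _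
  · simp [evalAll]

theorem exists_evalAll_eq {f : (Σ e : {e : S // Idem e}, A e.1) → ℂ} (hf : f ∈ repSet 𝓐)
    (h0 : ∃ p, f p ≠ 0) : ∃ x : 𝓐.Spectrum, evalAll x = f := by
  obtain ⟨hb, ha, hs, hm, hst, hi⟩ := hf
  refine ⟨{ eval := fun {e} he => LinearMap.mkContinuous
              { toFun := fun a => f ⟨⟨e, he⟩, a⟩
                map_add' := ha ⟨e, he⟩
                map_smul' := hs ⟨e, he⟩ } 1 fun a => ?_
            eval_mul := fun he hf a b => hm ⟨_, he⟩ ⟨_, hf⟩ a b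
            eval_star := fun he a => hst ⟨_, he⟩ a
            eval_incl := fun he hf h a => hi ⟨_, he⟩ ⟨_, hf⟩ h a
            nonzero := ?_ }, rfl⟩
  · rw [one_mul]
    exact mem_closedBall_zero_iff.mp (hb ⟨⟨e, he⟩, a⟩)
  · obtain ⟨p, hp⟩ := h0
    exact ⟨p.1.1, p.1.2, p.2, hp⟩

/-- Evaluation embeds the spectrum onto the compact space of representations with the zero
representation removed, an open subset. -/
instance : LocallyCompactSpace 𝓐.Spectrum := by
  have := isCompact_iff_compactSpace.mp (isCompact_repSet (𝓐 := 𝓐))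
  have he : Topology.IsOpenEmbedding
      (fun x : 𝓐.Spectrum => (⟨evalAll x, evalAll_mem x⟩ : repSet 𝓐)) := by
    refine ⟨isEmbedding_evalAll.codRestrict _ _, ?_⟩
    have : Set.range (fun x : 𝓐.Spectrum => (⟨evalAll x, evalAll_mem x⟩ : repSet 𝓐)) =
        ⋃ p, {f | f.1 p ≠ 0} := by
      ext f
      simp only [Set.mem_range, Set.mem_iUnion, Set.mem_ofPred_eq]
      constructor
      · rintro ⟨x, rfl⟩
        obtain ⟨e, he, a, ha⟩ := x.nonzero
        exact ⟨⟨⟨e, he⟩, a⟩, ha⟩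
      · intro h
        obtain ⟨x, hx⟩ := exists_evalAll_eq f.2 h
        exact ⟨x, Subtype.ext hx⟩
    rw [this]
    exact isOpen_iUnion fun p =>
      isOpen_ne.preimage ((continuous_apply p).comp continuous_subtype_val)
  exact he.locallyCompactSpace

/-! ### Domains -/

theorem dom_mul {x : 𝓐.Spectrum} {e f : S} {he : Idem e} {hf : Idem f} (h : x ∈ 𝓐.dom he)
    (h' : x ∈ 𝓐.dom hf) : x ∈ 𝓐.dom (he.mul hf) := by
  obtain ⟨a, ha⟩ := h
  obtain ⟨b, hb⟩ := h'
  exact ⟨𝓐.mul a b, by rw [x.eval_mul he hf]; exact mul_ne_zero ha hb⟩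

theorem srcDom_idem {x : 𝓐.Spectrum} {e : S} (he : Idem e) :
    x ∈ 𝓐.srcDom e ↔ x ∈ 𝓐.dom he := by
  rw [mem_srcDom, mem_dom, he.inv_mul_self]

theorem srcDom_inv {x : 𝓐.Spectrum} {s : S} : x ∈ 𝓐.srcDom s⁻¹ ↔ x ∈ 𝓐.rngDom s := by
  rw [mem_srcDom, mem_rngDom, inv_inv_eq]

theorem exists_val_eq_one {x : 𝓐.Spectrum} {e : S} {he : Idem e} (h : x ∈ 𝓐.dom he) :
    ∃ c : 𝓐.Tot, c.1 = e ∧ val x c = 1 := by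
  obtain ⟨p, rfl, h'⟩ := (mem_dom he).mp h
  exact val_ne_zero_smul h'

theorem mem_srcDom_of_val {x : 𝓐.Spectrum} {p : 𝓐.Tot} (h : val x (star p * p) ≠ 0) :
    x ∈ 𝓐.srcDom p.1 := mem_srcDom.mpr ⟨_, rfl, h⟩

/-- Left multiplication as a continuous map. -/
noncomputable def mulLeftL {s : S} (a : A s) (t : S) : A t →L[ℂ] A (s * t) :=
  (𝓐.mul a).mkContinuous ‖a‖ fun b => 𝓐.norm_mul_le a b

/-- Right multiplication as a continuous map. -/
noncomputable def mulRightL (s : S) {t : S} (b : A t) : A s →L[ℂ] A (s * t) :=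
  ((𝓐.mul).flip b).mkContinuous ‖b‖ fun a => (𝓐.norm_mul_le a b).trans_eq (mul_comm _ _)

/-- A continuous functional vanishing on all products vanishes on their dense span. Saturation
enters the proof only through this lemma. -/
theorem exists_mul_ne_zero (hsat : 𝓐.IsSaturated) {s t : S} (φ : A (s * t) →L[ℂ] ℂ)
    {c : A (s * t)} (hc : φ c ≠ 0) : ∃ (a : A s) (b : A t), φ (𝓐.mul a b) ≠ 0 := by
  by_contra! h
  refine hc ?_
  have : φ = 0 := by
    refine ContinuousLinearMap.ext_on (hsat s t) ?_
    rintro _ ⟨a, b, rfl⟩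
    rw [h a b]; rfl
  rw [this]; rfl

/-- Saturation gives a over s* and b over s with (a b)(x) ≠ 0, and Cauchy–Schwarz for the pair a*, b
excludes (b* b)(x) = 0. -/
theorem exists_star_mul_self_ne_zero (hsat : 𝓐.IsSaturated) (hab : 𝓐.IsSemiAbelian)
    {x : 𝓐.Spectrum} {s : S} (h : x ∈ 𝓐.srcDom s) :
    ∃ p : 𝓐.Tot, p.1 = s ∧ val x (star p * p) ≠ 0 := by
  obtain ⟨c, hc⟩ := h
  obtain ⟨a, b, hab'⟩ := exists_mul_ne_zero hsat (x.eval (idem_inv_mul s)) hc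
  refine ⟨𝓐.el b, rfl, ?_⟩
  rw [← val_el x (idem_inv_mul s)] at hab'
  intro h0
  have := val_star_mul_eq_zero hab x (a := 𝓐.el b) (b := star (𝓐.el a))
    (by simp [inv_inv_eq]) h0
  rw [← star_mul] at this
  have i : Idem (𝓐.el a * 𝓐.el b).1 := idem_inv_mul s
  rw [val_star x i, map_eq_zero] at this
  exact hab' this

/-- Since (p* p)(x) is a positive real r, dividing p by √r normalizes it. Such a u is the basis
vector used in all later computations at x. -/
theorem exists_star_mul_self_eq_one (hsat : 𝓐.IsSaturated) (hab : 𝓐.IsSemiAbelian)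
    {x : 𝓐.Spectrum} {s : S} (h : x ∈ 𝓐.srcDom s) :
    ∃ u : 𝓐.Tot, u.1 = s ∧ val x (star u * u) = 1 := by
  obtain ⟨p, rfl, hp⟩ := exists_star_mul_self_ne_zero hsat hab h
  obtain ⟨r, hr, h⟩ := val_star_mul_self x p
  have hr0 : r ≠ 0 := by rintro rfl; exact hp (by rw [h, Complex.ofReal_zero])
  refine ⟨𝓐.el ((((√r)⁻¹ : ℝ) : ℂ) • p.2), rfl, ?_⟩
  have : star (𝓐.el ((((√r)⁻¹ : ℝ) : ℂ) • p.2)) * 𝓐.el ((((√r)⁻¹ : ℝ) : ℂ) • p.2) =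
      𝓐.el (((r⁻¹ : ℝ) : ℂ) • (star p * p).2) := by
    rw [star_el, el_mul, map_smul, map_smulₛₗ, LinearMap.map_smul₂, smul_smul,
      Complex.conj_ofReal, ← Complex.ofReal_mul, ← mul_inv, Real.mul_self_sqrt hr]
    rfl
  rw [this, val_el_smul]
  change _ * val x (star p * p) = 1
  rw [h, ← Complex.ofReal_mul, inv_mul_cancel₀ hr0, Complex.ofReal_one]

/-! ### The canonical action -/

theorem incl_self {s : S} (h : Le s s) (a : A s) : 𝓐.incl h a = a :=
  (𝓐.incl h).injective (𝓐.incl_trans h h h a).symm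

/-- The outer factors are written as images under the identity inclusions, so that the compatibility
of inclusions with products moves the inclusion outside, where x ignores it. -/
theorem val_conj_incl (x : 𝓐.Spectrum) {e f : S} (he : Idem e) (hf : Idem f) (h : Le e f)
    (a : A e) {p q : 𝓐.Tot} (hpq : p.1 = q.1) :
    val x (star p * (𝓐.el (𝓐.incl h a) * q)) = val x (star p * (𝓐.el a * q)) := by
  have hs : ∀ s : S, Le s s := fun s => Le.of_eq rfl
  have h1 : star p * (𝓐.el (𝓐.incl h a) * q) =
      𝓐.el (𝓐.incl ((hs p.1⁻¹).mul (h.mul (hs q.1))) (star p * (𝓐.el a * q)).2) := by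
    conv_lhs => rw [show q = 𝓐.el (𝓐.incl (hs q.1) q.2) by rw [incl_self]; rfl,
      show star p = 𝓐.el (𝓐.incl (hs p.1⁻¹) (star p).2) by rw [incl_self]; rfl,
      el_mul, 𝓐.mul_incl, el_mul, 𝓐.mul_incl]
    rfl
  have i : Idem (p.1⁻¹ * (f * q.1)) := by rw [hpq]; exact hf.conj _
  have i' : Idem (p.1⁻¹ * (e * q.1)) := by rw [hpq]; exact he.conj _
  rw [h1]
  exact (val_el x i _).trans ((x.eval_incl i' i _ _).trans (val_el x i' _).symm)

section

variable (hab : 𝓐.IsSemiAbelian)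
include hab

/-- l commutes with a a*. This is the multiplicativity of the functional k ↦ (a* k a)(x) / (a*
a)(x), up to denominators. -/
theorem val_conj_mul_mul (x : 𝓐.Spectrum) {a k l : 𝓐.Tot} (hk : Idem k.1) (hl : Idem l.1) :
    val x (star a * (k * l * a)) * val x (star a * a) =
      val x (star a * (k * a)) * val x (star a * (l * a)) := by
  rw [← val_mul x (idem_conj rfl (idem_mul hk hl)) (idem_star_mul rfl),
    ← val_mul x (idem_conj rfl hk) (idem_conj rfl hl)]
  congr 1
  calc star a * (k * l * a) * (star a * a) = star a * (k * (l * (a * star a)) * a) := by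
        simp only [mul_assoc]
    _ = star a * (k * (a * star a * l) * a) := by
        rw [mul_comm_idem hab hl (idem_mul_star rfl)]
    _ = star a * (k * a) * (star a * (l * a)) := by simp only [mul_assoc]

omit hab in
/-- The functional `k ↦ (a* k a)(x) / (a* a)(x)`. -/
noncomputable def _root_.FellBundle.conjL (x : 𝓐.Spectrum) (a : 𝓐.Tot) {e : S} (he : Idem e) :
    A e →L[ℂ] ℂ :=
  (val x (star a * a))⁻¹ • (x.eval (he.conj a.1)).comp
    ((mulLeftL (𝓐 := 𝓐) (𝓐.star a.2) (e * a.1)).comp (mulRightL (𝓐 := 𝓐) e a.2))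

omit hab in
theorem conjL_apply (x : 𝓐.Spectrum) (a : 𝓐.Tot) {e : S} (he : Idem e) (k : A e) :
    𝓐.conjL x a he k = (val x (star a * a))⁻¹ * val x (star a * (𝓐.el k * a)) :=
  congrArg (fun z => (val x (star a * a))⁻¹ * z) (val_el x (he.conj a.1)
    (𝓐.mul (𝓐.star a.2) (𝓐.mul k a.2))).symm

/-- The point `θ_s(x)`, computed with `a ∈ A_s` such that `(a* a)(x) ≠ 0`. -/
noncomputable def conjPoint (x : 𝓐.Spectrum) (a : 𝓐.Tot) (ha : val x (star a * a) ≠ 0) :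
    𝓐.Spectrum where
  eval {e} he := 𝓐.conjL x a he
  eval_mul {e f} he hf k l := by
    rw [conjL_apply, conjL_apply, conjL_apply, ← el_mul]
    have := val_conj_mul_mul hab x (a := a) (k := 𝓐.el k) (l := 𝓐.el l) he hf
    field_simp
    linear_combination this
  eval_star {e} he k := by
    have hi : Idem (𝓐.el k).1 := he
    rw [conjL_apply, conjL_apply, map_mul, map_inv₀, ← val_star_mul x rfl,
      ← val_star x (idem_conj rfl hi), ← star_el]
    simp only [star_mul, star_star, mul_assoc]
  eval_incl {e f} he hf h k := by
    rw [conjL_apply, conjL_apply, val_conj_incl x he hf h k rfl]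
  nonzero := by
    -- The witness a a* has value (a* a)(x) at the new point.
    refine ⟨a.1 * a.1⁻¹, idem_mul_inv a.1, (a * star a).2, ?_⟩
    refine (conjL_apply x a (idem_mul_inv a.1) (𝓐.mul a.2 (𝓐.star a.2))).trans_ne ?_
    change (val x (star a * a))⁻¹ * val x (star a * ((a * star a) * a)) ≠ 0
    rw [show star a * ((a * star a) * a) = star a * a * (star a * a) by simp only [mul_assoc],
      val_mul x (idem_star_mul rfl) (idem_star_mul rfl)]
    exact mul_ne_zero (inv_ne_zero ha) (mul_ne_zero ha ha)

theorem val_conjPoint (x : 𝓐.Spectrum) (a : 𝓐.Tot) (ha : val x (star a * a) ≠ 0) {k : 𝓐.Tot}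
    (hk : Idem k.1) : val (conjPoint hab x a ha) k =
      (val x (star a * a))⁻¹ * val x (star a * (k * a)) := by
  exact (val_el (conjPoint hab x a ha) hk k.2).trans (conjL_apply x a hk k.2)

end

section

variable (hsat : 𝓐.IsSaturated) (hab : 𝓐.IsSemiAbelian)

open Classical in
/-- The canonical action: the point `θ_s(x)` for `x ∈ U_{s* s}`, and `x` otherwise. -/
noncomputable def theta (s : S) (x : 𝓐.Spectrum) : 𝓐.Spectrum :=
  if h : x ∈ 𝓐.srcDom s then
    conjPoint hab x _ (exists_star_mul_self_ne_zero hsat hab h).choose_spec.2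
  else x

/-- θ is built from one chosen a, but by `val_conj_exchange` the relation holds for all p and q over
s; from here on the choice is irrelevant. -/
theorem val_theta {s : S} {x : 𝓐.Spectrum} (hx : x ∈ 𝓐.srcDom s) {p q k : 𝓐.Tot}
    (hp : p.1 = s) (hq : q.1 = s) (hk : Idem k.1) :
    val x (star p * (k * q)) = val x (star p * q) * val (theta hsat hab s x) k := by
  obtain ⟨ha, ha'⟩ := (exists_star_mul_self_ne_zero hsat hab hx).choose_spec
  unfold theta
  rw [dif_pos hx, val_conjPoint hab x _ ha' hk]
  have := val_conj_exchange hab x (hp.trans hq.symm) (hq.trans ha.symm) rfl hk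
  field_simp
  linear_combination this

/-- The criterion used below to identify values of θ: a single vector of nonzero length at x, tested
against all k over idempotents, determines the point. -/
theorem eq_theta {x y : 𝓐.Spectrum} {p : 𝓐.Tot} (hp : val x (star p * p) ≠ 0)
    (h : ∀ k : 𝓐.Tot, Idem k.1 →
      val x (star p * (k * p)) = val x (star p * p) * val y k) :
    y = theta hsat hab p.1 x := by
  refine spectrum_ext fun k hk => mul_left_cancel₀ hp ?_
  rw [← h k hk, val_theta hsat hab (mem_srcDom_of_val hp) rfl rfl hk]

/-- With a unit vector u, the left side is (u* p q* u)(x) = (u* p)(x) (q* u)(x), and the rank-one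
identity replaces this by (u* u)(x) (q* p)(x). -/
theorem val_theta_mul_star {s : S} {x : 𝓐.Spectrum} (hx : x ∈ 𝓐.srcDom s) {p q : 𝓐.Tot}
    (hp : p.1 = s) (hq : q.1 = s) :
    val (theta hsat hab s x) (p * star q) = val x (star q * p) := by
  obtain ⟨u, hu, h1⟩ := exists_star_mul_self_eq_one hsat hab hx
  have i := idem_mul_star (hp.trans hq.symm)
  have h2 := val_theta hsat hab hx hu hu i
  rw [h1, one_mul] at h2
  rw [← h2, show star u * (p * star q * u) = star u * p * (star q * u) by
    simp only [mul_assoc], val_mul x (idem_star_mul (hu.trans hp.symm))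
    (idem_star_mul (hq.trans hu.symm)), val_rank_one hab x (hu.trans hp.symm)
    (hp.trans hq.symm) (hq.trans hu.symm), h1, one_mul]

theorem theta_mem {s : S} {x : 𝓐.Spectrum} (hx : x ∈ 𝓐.srcDom s) :
    theta hsat hab s x ∈ 𝓐.rngDom s := by
  obtain ⟨u, rfl, h1⟩ := exists_star_mul_self_eq_one hsat hab hx
  refine mem_rngDom.mpr ⟨u * star u, rfl, ?_⟩
  rw [val_theta_mul_star hsat hab hx rfl rfl, h1]
  exact one_ne_zero

/-- If u is a unit vector for s at x, then u* is one for s* at θ_s(x). Conjugating k by u* and then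
by u multiplies it on both sides by u* u, whose value at x is 1. -/
theorem theta_inv_theta {s : S} {x : 𝓐.Spectrum} (hx : x ∈ 𝓐.srcDom s) :
    theta hsat hab s⁻¹ (theta hsat hab s x) = x := by
  obtain ⟨u, rfl, h1⟩ := exists_star_mul_self_eq_one hsat hab hx
  have h2 : val (theta hsat hab u.1 x) (star (star u) * star u) = 1 := by
    rw [star_star, val_theta_mul_star hsat hab hx rfl rfl, h1]
  refine (eq_theta hsat hab (p := star u) (by rw [h2]; exact one_ne_zero) fun k hk => ?_).symm
  rw [h2, one_mul, star_star]
  have i : Idem (u * (k * star u)).1 := idem_conj' rfl hk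
  have := val_theta hsat hab hx (p := u) (q := u) rfl rfl i
  rw [h1, one_mul] at this
  rw [← this]
  have : star u * (u * (k * star u) * u) = star u * u * (k * (star u * u)) := by
    simp only [mul_assoc]
  rw [this, val_mul x (idem_star_mul rfl) (idem_mul hk (idem_star_mul rfl)),
    val_mul x hk (idem_star_mul rfl), h1, one_mul, mul_one]

theorem theta_theta_inv {s : S} {x : 𝓐.Spectrum} (hx : x ∈ 𝓐.rngDom s) :
    theta hsat hab s (theta hsat hab s⁻¹ x) = x := by
  have := theta_inv_theta hsat hab (srcDom_inv.mpr hx)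
  rwa [inv_inv_eq] at this

theorem theta_inv_mem {s : S} {x : 𝓐.Spectrum} (hx : x ∈ 𝓐.rngDom s) :
    theta hsat hab s⁻¹ x ∈ 𝓐.srcDom s := by
  have := theta_mem hsat hab (srcDom_inv.mpr hx)
  rwa [← srcDom_inv, inv_inv_eq] at this

/-- One u with (u* u)(x) ≠ 0 serves for all y near x, and k(θ_s(y)) is there a quotient of
continuous functions with nonzero denominator. -/
theorem continuousAt_theta {s : S} {x : 𝓐.Spectrum} (hx : x ∈ 𝓐.srcDom s) :
    ContinuousAt (theta hsat hab s) x := by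
  obtain ⟨u, rfl, h1⟩ := exists_star_mul_self_ne_zero hsat hab hx
  refine tendsto_spectrum fun k hk => ?_
  have h2 : ∀ y, val y (star u * u) ≠ 0 → val (theta hsat hab u.1 y) k =
      val y (star u * (k * u)) / val y (star u * u) := fun y hy => by
    rw [val_theta hsat hab (mem_srcDom_of_val hy) rfl rfl hk]
    field_simp
  rw [h2 x h1]
  have hev : ∀ᶠ y in nhds x, val y (star u * u) ≠ 0 :=
    (continuous_val (star u * u)).continuousAt.eventually_ne h1
  refine Filter.Tendsto.congr' (hev.mono fun y hy => (h2 y hy).symm) ?_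
  exact ((continuous_val _).continuousAt.tendsto.div (continuous_val _).continuousAt.tendsto h1)

/-- The canonical action by homeomorphisms. -/
noncomputable def thetaHomeo (s : S) : 𝓐.srcDom s ≃ₜ 𝓐.rngDom s where
  toFun x := ⟨theta hsat hab s x, theta_mem hsat hab x.2⟩
  invFun x := ⟨theta hsat hab s⁻¹ x, theta_inv_mem hsat hab x.2⟩
  left_inv x := Subtype.ext (theta_inv_theta hsat hab x.2)
  right_inv x := Subtype.ext (theta_theta_inv hsat hab x.2)
  continuous_toFun := by
    refine Continuous.subtype_mk (continuous_iff_continuousAt.mpr fun x => ?_) _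
    exact (continuousAt_theta hsat hab x.2).comp continuous_subtype_val.continuousAt
  continuous_invFun := by
    refine Continuous.subtype_mk (continuous_iff_continuousAt.mpr fun x => ?_) _
    exact (continuousAt_theta hsat hab (srcDom_inv.mpr x.2)).comp
      continuous_subtype_val.continuousAt

/-- If u is a unit vector for s at x and c(x) = 1, then u c is a unit vector for se which defines
the same functional. -/
theorem theta_mul_idem {s : S} {x : 𝓐.Spectrum} (hx : x ∈ 𝓐.srcDom s) {e : S} {he : Idem e}
    (h : x ∈ 𝓐.dom he) :
    x ∈ 𝓐.srcDom (s * e) ∧ theta hsat hab (s * e) x = theta hsat hab s x := by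
  obtain ⟨u, rfl, h1⟩ := exists_star_mul_self_eq_one hsat hab hx
  obtain ⟨c, rfl, h2⟩ := exists_val_eq_one h
  have hk : ∀ k : 𝓐.Tot, Idem (star u * k).1 →
      val x (star (u * c) * (k * c)) = val x (star u * k) := by
    intro k hk
    have : star (u * c) * (k * c) = star c * (star u * k * c) := by
      simp only [star_mul, mul_assoc]
    rw [this, val_mul x he.inv (idem_mul hk he), val_mul x hk he, val_star x he, h2]
    simp
  have h3 : val x (star (u * c) * (u * c)) = 1 := by rw [hk _ (idem_star_mul rfl), h1]
  refine ⟨mem_srcDom_of_val (p := u * c) (by rw [h3]; exact one_ne_zero), ?_⟩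
  refine (eq_theta hsat hab (p := u * c) (by rw [h3]; exact one_ne_zero) fun k hk' => ?_).symm
  rw [h3, ← mul_assoc k u c, hk (k * u) (idem_conj rfl hk'),
    val_theta hsat hab hx rfl rfl hk', h1]

theorem theta_congr {s t : S} {x : 𝓐.Spectrum} (hs : x ∈ 𝓐.srcDom s) (ht : x ∈ 𝓐.srcDom t)
    {e : S} {he : Idem e} (h : x ∈ 𝓐.dom he) (hst : s * e = t * e) :
    theta hsat hab s x = theta hsat hab t x := by
  rw [← (theta_mul_idem hsat hab hs h).2, hst, (theta_mul_idem hsat hab ht h).2]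

theorem theta_idem {e : S} (he : Idem e) {x : 𝓐.Spectrum} (h : x ∈ 𝓐.dom he) :
    theta hsat hab e x = x := by
  obtain ⟨c, rfl, h2⟩ := exists_val_eq_one h
  have h3 : val x (star c * c) = 1 := by rw [val_mul x he.inv he, val_star x he, h2]; simp
  refine (eq_theta hsat hab (p := c) (by rw [h3]; exact one_ne_zero) fun k hk => ?_).symm
  rw [val_mul x he.inv (idem_mul hk he), val_mul x hk he, h3, val_star x he, h2]
  simp

/-- The product (a b)* (a' b') equals b* (a* a') b', a conjugation of the element a* a' over an
idempotent, so `val_theta` evaluates it. This is how the forms multiply along composable pairs. -/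
theorem val_star_mul_conj {s : S} {y : 𝓐.Spectrum} {b b' k : 𝓐.Tot} (hb : b.1 = s)
    (hb' : b'.1 = s) (hy : y ∈ 𝓐.srcDom s) {a a' : 𝓐.Tot} (ha : a.1 = a'.1)
    (hk : k = star a * a') :
    val y (star (a * b) * (a' * b')) =
      val y (star b * b') * val (theta hsat hab s y) k := by
  rw [← val_theta hsat hab hy hb hb' (by rw [hk]; exact idem_star_mul ha), hk]
  simp only [star_mul, mul_assoc]

theorem mem_srcDom_mul_iff {s t : S} {y : 𝓐.Spectrum} :
    y ∈ 𝓐.srcDom (s * t) ↔ y ∈ 𝓐.srcDom t ∧ theta hsat hab t y ∈ 𝓐.srcDom s := by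
  constructor
  · intro h
    obtain ⟨⟨_, c⟩, rfl, hc⟩ := exists_star_mul_self_ne_zero hsat hab h
    change val y (𝓐.el (𝓐.mul (𝓐.star c) c)) ≠ 0 at hc
    rw [val_el y (idem_inv_mul (s * t))] at hc
    -- Saturation is applied to the functional z ↦ (c* z)(y), nonzero at c. Cauchy–Schwarz then
    -- turns (c* a b)(y) ≠ 0 into ((a b)* (a b))(y) ≠ 0, from which both membership statements are
    -- read off.
    obtain ⟨a, b, hab'⟩ := exists_mul_ne_zero hsat
      ((y.eval (idem_inv_mul (s * t))).comp (mulLeftL (𝓐 := 𝓐) (𝓐.star c) (s * t))) hc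
    change y.eval (idem_inv_mul (s * t)) (𝓐.mul (𝓐.star c) (𝓐.mul a b)) ≠ 0 at hab'
    rw [← val_el y (idem_inv_mul (s * t))] at hab'
    change val y (star (𝓐.el c) * (𝓐.el a * 𝓐.el b)) ≠ 0 at hab'
    have h1 : val y (star (𝓐.el a * 𝓐.el b) * (𝓐.el a * 𝓐.el b)) ≠ 0 := by
      intro h0
      have := val_star_mul_eq_zero hab y (b := 𝓐.el c) (by rfl) h0
      rw [val_star_mul y (by rfl), map_eq_zero] at this
      exact hab' this
    have h2 : val y (star (𝓐.el b) * 𝓐.el b) ≠ 0 := by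
      refine val_conj_ne_zero hab y (k := star (𝓐.el a) * 𝓐.el a) (idem_star_mul rfl) ?_
      simpa only [star_mul, mul_assoc] using h1
    have h3 : y ∈ 𝓐.srcDom t := mem_srcDom_of_val h2
    refine ⟨h3, mem_srcDom.mpr ⟨star (𝓐.el a) * 𝓐.el a, rfl, fun h0 => h1 ?_⟩⟩
    rw [val_star_mul_conj hsat hab (by rfl) (by rfl) h3 rfl rfl, h0, mul_zero]
  · rintro ⟨h1, h2⟩
    obtain ⟨u, rfl, hu⟩ := exists_star_mul_self_eq_one hsat hab h1
    obtain ⟨v, rfl, hv⟩ := exists_star_mul_self_eq_one hsat hab h2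
    refine mem_srcDom_of_val (p := v * u) ?_
    rw [val_star_mul_conj hsat hab rfl rfl h1 rfl rfl, hu, hv, one_mul]
    exact one_ne_zero

/-- The product of a unit vector for s at θ_t(y) and one for t at y is a unit vector for st at y,
and conjugation by it is the composite of the two conjugations. -/
theorem theta_mul {s t : S} {y : 𝓐.Spectrum} (h : y ∈ 𝓐.srcDom (s * t)) :
    theta hsat hab (s * t) y = theta hsat hab s (theta hsat hab t y) := by
  obtain ⟨h1, h2⟩ := (mem_srcDom_mul_iff hsat hab).mp h
  obtain ⟨u, rfl, hu⟩ := exists_star_mul_self_eq_one hsat hab h1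
  obtain ⟨v, rfl, hv⟩ := exists_star_mul_self_eq_one hsat hab h2
  have h3 : val y (star (v * u) * (v * u)) = 1 := by
    rw [val_star_mul_conj hsat hab rfl rfl h1 rfl rfl, hu, hv, one_mul]
  refine (eq_theta hsat hab (p := v * u) (by rw [h3]; exact one_ne_zero) fun k hk => ?_).symm
  have : star (v * u) * (k * (v * u)) = star u * (star v * (k * v) * u) := by
    simp only [star_mul, mul_assoc]
  rw [h3, one_mul, this, val_theta hsat hab h1 rfl rfl (idem_conj rfl hk), hu, one_mul,
    val_theta hsat hab h2 rfl rfl hk, hv, one_mul]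

theorem isCanonicalAction_thetaHomeo : 𝓐.IsCanonicalAction (thetaHomeo hsat hab) where
  formula s x a _ e he b := by
    rw [← val_el x.1, innerAt_eq]
    have := val_theta hsat hab x.2 (p := 𝓐.el a) (q := 𝓐.el a) (k := 𝓐.el b) rfl rfl he
    rw [val_el _ he] at this
    exact this
  mem_comp s t y := by
    rw [mem_srcDom_mul_iff hsat hab]
    exact ⟨fun h => ⟨h.1, h.2⟩, fun ⟨h, h'⟩ => ⟨h, h'⟩⟩
  comp s t y hst hy hx := theta_mul hsat hab hst

end

end

end FellLine

/-! ### Moving idempotents between source and range -/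

namespace InverseSemigroup

section

variable {S : Type*} [InverseSemigroup S]

/-- An idempotent e on the range side of t becomes the idempotent t* e t = (et)* (et) on the source
side. -/
theorem mul_conj_idem {e : S} (he : Idem e) (t : S) : t * ((e * t)⁻¹ * (e * t)) = e * t := by
  rw [mul_inv_rev_eq, he.inv_eq]
  calc t * (t⁻¹ * e * (e * t)) = t * t⁻¹ * (e * e) * t := by simp only [mul_assoc]
    _ = e * (t * t⁻¹) * t := by rw [he.mul_self, (idem_mul_inv t).comm he]
    _ = e * t := by rw [mul_assoc, mul_inv_mul]

theorem inv_mul_conj_idem {e : S} (he : Idem e) (s : S) :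
    s⁻¹ * ((s * e) * (s * e)⁻¹) = (s * e)⁻¹ := by
  rw [mul_inv_rev_eq, he.inv_eq]
  calc s⁻¹ * (s * e * (e * s⁻¹)) = s⁻¹ * s * (e * e) * s⁻¹ := by simp only [mul_assoc]
    _ = e * (s⁻¹ * s) * s⁻¹ := by rw [he.mul_self, (idem_inv_mul s).comm he]
    _ = e * s⁻¹ := by rw [mul_assoc, inv_mul_inv]

end

end InverseSemigroup

namespace FellLine

section

variable {S : Type*} [InverseSemigroup S] {A : S → Type*}
  [∀ s, NormedAddCommGroup (A s)] [∀ s, NormedSpace ℂ (A s)] [∀ s, CompleteSpace (A s)]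
  {𝓐 : FellBundle S A}

/-! ### Germs -/

/-- `s` and `t` have the same germ at `x`. -/
def SameGerm (x : 𝓐.Spectrum) (s t : S) : Prop :=
  ∃ (e : S) (he : Idem e), x ∈ 𝓐.dom he ∧ s * e = t * e

theorem exists_mem_dom (x : 𝓐.Spectrum) : ∃ (e : S) (he : Idem e), x ∈ 𝓐.dom he := by
  obtain ⟨e, he, a, ha⟩ := x.nonzero
  exact ⟨e, he, a, ha⟩

theorem SameGerm.refl (x : 𝓐.Spectrum) (s : S) : SameGerm x s s := by
  obtain ⟨e, he, h⟩ := exists_mem_dom x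
  exact ⟨e, he, h, rfl⟩

theorem SameGerm.symm {x : 𝓐.Spectrum} {s t : S} (h : SameGerm x s t) : SameGerm x t s := by
  obtain ⟨e, he, h, h'⟩ := h
  exact ⟨e, he, h, h'.symm⟩

theorem SameGerm.trans {x : 𝓐.Spectrum} {r s t : S} (h : SameGerm x r s)
    (h' : SameGerm x s t) : SameGerm x r t := by
  obtain ⟨e, he, h₁, h₂⟩ := h
  obtain ⟨f, hf, h₃, h₄⟩ := h'
  refine ⟨e * f, he.mul hf, dom_mul h₁ h₃, ?_⟩
  rw [← mul_assoc, h₂, mul_assoc, he.comm hf, ← mul_assoc, h₄, mul_assoc]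

theorem equivalence_germRel (𝓐 : FellBundle S A) : Equivalence 𝓐.GermRel where
  refl p := ⟨rfl, SameGerm.refl _ _⟩
  symm := by
    rintro ⟨s, x, hx⟩ ⟨t, y, hy⟩ ⟨rfl : x = y, h⟩
    exact ⟨rfl, SameGerm.symm h⟩
  trans := by
    rintro ⟨r, x, hx⟩ ⟨s, y, hy⟩ ⟨t, z, hz⟩ ⟨rfl : x = y, h⟩ ⟨rfl : x = z, h'⟩
    exact ⟨rfl, SameGerm.trans h h'⟩

theorem germ_eq_iff {s t : S} {x y : 𝓐.Spectrum} {hx : x ∈ 𝓐.srcDom s}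
    {hy : y ∈ 𝓐.srcDom t} :
    𝓐.germ s x hx = 𝓐.germ t y hy ↔ x = y ∧ SameGerm x s t :=
  ⟨fun h => ((equivalence_germRel 𝓐).quot_mk_eq_iff _ _).mp h, fun h => Quot.sound h⟩

theorem germ_eq {s t : S} {x y : 𝓐.Spectrum} {hx : x ∈ 𝓐.srcDom s}
    {hy : y ∈ 𝓐.srcDom t} (h : x = y) (h' : SameGerm x s t) :
    𝓐.germ s x hx = 𝓐.germ t y hy := germ_eq_iff.mpr ⟨h, h'⟩

theorem exists_germ (g : 𝓐.Germ) : ∃ s x hx, g = 𝓐.germ s x hx := by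
  induction g using Quot.ind with
  | mk p => exact ⟨p.s, p.x, p.mem, rfl⟩

theorem germSrc_germ (s : S) (x : 𝓐.Spectrum) (hx : x ∈ 𝓐.srcDom s) :
    𝓐.germSrc (𝓐.germ s x hx) = x := rfl

theorem SameGerm.of_idem {x : 𝓐.Spectrum} {e f : S} {he : Idem e} {hf : Idem f}
    (h : x ∈ 𝓐.dom he) (h' : x ∈ 𝓐.dom hf) : SameGerm x e f := by
  refine ⟨e * f, he.mul hf, dom_mul h h', ?_⟩
  rw [← mul_assoc, he.mul_self, he.comm hf, ← mul_assoc, hf.mul_self]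

section

variable (hsat : 𝓐.IsSaturated) (hab : 𝓐.IsSemiAbelian)
include hsat hab

/-- The idempotent e that identifies s and s' near θ_t(y) is pulled back to (et)* (et) near y, and
is combined with the idempotent f that identifies t and t'. -/
theorem SameGerm.mul {s s' t t' : S} {y : 𝓐.Spectrum} (ht : y ∈ 𝓐.srcDom t)
    (hs : SameGerm (theta hsat hab t y) s s') (htt : SameGerm y t t') :
    SameGerm y (s * t) (s' * t') := by
  obtain ⟨e, he, h₁, h₂⟩ := hs
  obtain ⟨f, hf, h₃, h₄⟩ := htt
  have hw : y ∈ 𝓐.srcDom (e * t) :=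
    (mem_srcDom_mul_iff hsat hab).mpr ⟨ht, (srcDom_idem he).mpr h₁⟩
  have iw := idem_inv_mul (e * t)
  refine ⟨f * ((e * t)⁻¹ * (e * t)), hf.mul iw, dom_mul h₃ hw, ?_⟩
  have key : t * (f * ((e * t)⁻¹ * (e * t))) = e * (t * f) := by
    rw [hf.comm iw, ← mul_assoc, mul_conj_idem he, mul_assoc]
  have key' : t' * (f * ((e * t)⁻¹ * (e * t))) = e * (t * f) := by
    rw [← mul_assoc, ← h₄, mul_assoc, key]
  rw [mul_assoc, key, mul_assoc, key', ← mul_assoc, h₂, mul_assoc]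

/-- If se = te, the idempotent for the inverses is the range projection (se)(se)*, whose domain
contains θ_{se}(x) = θ_s(x). -/
theorem SameGerm.inv {s t : S} {x : 𝓐.Spectrum} (hs : x ∈ 𝓐.srcDom s)
    (h : SameGerm x s t) : SameGerm (theta hsat hab s x) s⁻¹ t⁻¹ := by
  obtain ⟨e, he, h₁, h₂⟩ := h
  obtain ⟨h₃, h₄⟩ := theta_mul_idem hsat hab hs h₁
  refine ⟨(s * e) * (s * e)⁻¹, idem_mul_inv _, ?_, ?_⟩
  · rw [← h₄]; exact theta_mem hsat hab h₃
  · rw [inv_mul_conj_idem he, h₂, inv_mul_conj_idem he]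

theorem SameGerm.theta_eq {s t : S} {x : 𝓐.Spectrum} (hs : x ∈ 𝓐.srcDom s)
    (ht : x ∈ 𝓐.srcDom t) (h : SameGerm x s t) :
    theta hsat hab s x = theta hsat hab t x := by
  obtain ⟨e, he, h₁, h₂⟩ := h
  exact theta_congr hsat hab hs ht h₁ h₂

theorem SameGerm.idem_mul {s e : S} {x : 𝓐.Spectrum} (hs : x ∈ 𝓐.srcDom s) (he : Idem e)
    (h : theta hsat hab s x ∈ 𝓐.dom he) : SameGerm x (e * s) s := by
  refine ⟨_, idem_inv_mul (e * s),
    (mem_srcDom_mul_iff hsat hab).mpr ⟨hs, (srcDom_idem he).mpr h⟩, ?_⟩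
  rw [mul_assoc, mul_conj_idem he, ← mul_assoc, he.mul_self]

theorem mul_mem_srcDom {s t : S} {y : 𝓐.Spectrum} (ht : y ∈ 𝓐.srcDom t)
    (hs : theta hsat hab t y ∈ 𝓐.srcDom s) : y ∈ 𝓐.srcDom (s * t) :=
  (mem_srcDom_mul_iff hsat hab).mpr ⟨ht, hs⟩

theorem theta_mem_srcDom_inv {s : S} {x : 𝓐.Spectrum} (hx : x ∈ 𝓐.srcDom s) :
    theta hsat hab s x ∈ 𝓐.srcDom s⁻¹ := srcDom_inv.mpr (theta_mem hsat hab hx)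

end

theorem SameGerm.mul_idem {s e : S} {x : 𝓐.Spectrum} (he : Idem e)
    (h : x ∈ 𝓐.dom he) : SameGerm x (s * e) s :=
  ⟨e, he, h, by rw [mul_assoc, he.mul_self]⟩

/-! ### The topology of the space of germs -/

theorem germ_mem_germSet {s : S} {x : 𝓐.Spectrum} (hx : x ∈ 𝓐.srcDom s) :
    𝓐.germ s x hx ∈ 𝓐.germSet s (𝓐.srcDom s) := ⟨x, hx, hx, rfl⟩

theorem mem_germSet_iff {s : S} {g : 𝓐.Germ} :
    g ∈ 𝓐.germSet s (𝓐.srcDom s) ↔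
      ∃ h : 𝓐.germSrc g ∈ 𝓐.srcDom s, g = 𝓐.germ s (𝓐.germSrc g) h := by
  constructor
  · rintro ⟨x, hx, -, rfl⟩
    exact ⟨hx, rfl⟩
  · rintro ⟨h, h'⟩
    exact ⟨_, h, h, h'⟩

theorem isOpen_germSet (s : S) {U : Set 𝓐.Spectrum} (hU : IsOpen U) (h : U ⊆ 𝓐.srcDom s) :
    IsOpen (𝓐.germSet s U) :=
  TopologicalSpace.isOpen_generateFrom_of_mem ⟨s, U, hU, h, rfl⟩

theorem isOpen_germSet_srcDom (s : S) : IsOpen (𝓐.germSet s (𝓐.srcDom s)) :=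
  isOpen_germSet s (isOpen_srcDom s) subset_rfl

theorem continuous_germSrc : Continuous 𝓐.germSrc := by
  refine continuous_def.mpr fun V hV => ?_
  have : 𝓐.germSrc ⁻¹' V = ⋃ s, 𝓐.germSet s (V ∩ 𝓐.srcDom s) := by
    ext g
    simp only [Set.mem_preimage, Set.mem_iUnion]
    constructor
    · intro h
      obtain ⟨s, x, hx, rfl⟩ := exists_germ g
      exact ⟨s, x, hx, ⟨h, hx⟩, rfl⟩
    · rintro ⟨s, x, hx, h, rfl⟩
      exact h.1
  rw [this]
  exact isOpen_iUnion fun s =>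
    isOpen_germSet s (hV.inter (isOpen_srcDom s)) Set.inter_subset_right

/-- Near [s, x] a germ is determined by its source as long as it stays in O(s). The point is that
any other basic set O(t, U) containing [s, x] contains all [s, z] with z in U ∩ U_e, where se = te.
-/
theorem nhds_germ {s : S} {x : 𝓐.Spectrum} (hx : x ∈ 𝓐.srcDom s) :
    nhds (𝓐.germ s x hx) = Filter.comap 𝓐.germSrc (nhds x) ⊓
      Filter.principal (𝓐.germSet s (𝓐.srcDom s)) := by
  apply le_antisymm
  · refine le_inf ?_ ?_
    · exact Filter.tendsto_iff_comap.mp (continuous_germSrc.tendsto (𝓐.germ s x hx))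
    · rw [Filter.le_principal_iff]
      exact (isOpen_germSet_srcDom s).mem_nhds (germ_mem_germSet hx)
  · rw [TopologicalSpace.nhds_generateFrom]
    refine le_iInf₂ fun W hW => ?_
    obtain ⟨hg, t, U, hU, hUt, rfl⟩ := hW
    obtain ⟨y, hy, hyU, h⟩ := hg
    obtain ⟨rfl, e, he, hxe, hst⟩ := germ_eq_iff.mp h
    rw [Filter.le_principal_iff]
    have h1 : U ∩ 𝓐.dom he ∈ nhds x := (hU.inter (isOpen_dom he)).mem_nhds ⟨hyU, hxe⟩
    refine Filter.mem_inf_of_inter (Filter.preimage_mem_comap h1) (Filter.mem_principal_self _) ?_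
    rintro _ ⟨h2, z, hz, -, rfl⟩
    exact ⟨z, hUt h2.1, h2.1, germ_eq rfl ⟨e, he, h2.2, hst⟩⟩

theorem tendsto_germ_iff {α : Type*} {l : Filter α} {f : α → 𝓐.Germ} {s : S}
    {x : 𝓐.Spectrum} (hx : x ∈ 𝓐.srcDom s) :
    Filter.Tendsto f l (nhds (𝓐.germ s x hx)) ↔
      Filter.Tendsto (fun i => 𝓐.germSrc (f i)) l (nhds x) ∧
        ∀ᶠ i in l, f i ∈ 𝓐.germSet s (𝓐.srcDom s) := by
  rw [nhds_germ, Filter.tendsto_inf, Filter.tendsto_comap_iff, Filter.tendsto_principal]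
  rfl

theorem eventually_mem_germSet {s : S} {x : 𝓐.Spectrum} (hx : x ∈ 𝓐.srcDom s) :
    ∀ᶠ g in nhds (𝓐.germ s x hx), g ∈ 𝓐.germSet s (𝓐.srcDom s) :=
  (isOpen_germSet_srcDom s).mem_nhds (germ_mem_germSet hx)

theorem isOpenMap_germSrc : IsOpenMap 𝓐.germSrc := by
  refine IsOpenMap.of_nhds_le fun g => ?_
  obtain ⟨s, x, hx, rfl⟩ := exists_germ g
  rw [nhds_germ, germSrc_germ]
  intro N hN
  obtain ⟨V, hV, W, hW, hVW⟩ := Filter.mem_inf_iff_superset.mp (Filter.mem_map.mp hN)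
  obtain ⟨V', hV', hVV⟩ := Filter.mem_comap.mp hV
  filter_upwards [hV', (isOpen_srcDom s).mem_nhds hx] with y hy hy'
  exact hVW ⟨hVV (a := 𝓐.germ s y hy') hy, hW (germ_mem_germSet hy')⟩

/-- The source is continuous and open, and injective on each O(s). -/
theorem isLocalHomeomorph_germSrc : IsLocalHomeomorph 𝓐.germSrc := by
  rw [isLocalHomeomorph_iff_isOpenEmbedding_restrict]
  intro g
  obtain ⟨s, x, hx, rfl⟩ := exists_germ g
  refine ⟨_, (isOpen_germSet_srcDom s).mem_nhds (germ_mem_germSet hx), ?_⟩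
  refine Topology.IsOpenEmbedding.of_continuous_injective_isOpenMap
    (continuous_germSrc.comp continuous_subtype_val) ?_
    (isOpenMap_germSrc.domRestrict (isOpen_germSet_srcDom s))
  rintro ⟨_, y, hy, -, rfl⟩ ⟨_, z, hz, -, rfl⟩ (h : y = z)
  subst h; rfl

/-! ### The groupoid of germs -/

variable (𝓐) in
theorem germ_out (g : 𝓐.Germ) :
    𝓐.germ (Quot.out g).s (Quot.out g).x (Quot.out g).mem = g := Quot.out_eq g

/-- The germ at `x` of an idempotent. -/
noncomputable def gunit (x : 𝓐.Spectrum) : 𝓐.Germ :=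
  𝓐.germ (exists_mem_dom x).choose x
    ((srcDom_idem (exists_mem_dom x).choose_spec.choose).mpr
      (exists_mem_dom x).choose_spec.choose_spec)

theorem gunit_eq {e : S} (he : Idem e) {x : 𝓐.Spectrum} (h : x ∈ 𝓐.dom he)
    (h' : x ∈ 𝓐.srcDom e) : gunit x = 𝓐.germ e x h' :=
  germ_eq rfl (SameGerm.of_idem (exists_mem_dom x).choose_spec.choose_spec h)

section

variable (hsat : 𝓐.IsSaturated) (hab : 𝓐.IsSemiAbelian)

/-- The range of a germ. -/
noncomputable def grng : 𝓐.Germ → 𝓐.Spectrum :=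
  Quot.lift (fun p => theta hsat hab p.s p.x) (by
    rintro ⟨s, x, hx⟩ ⟨t, y, hy⟩ ⟨rfl : x = y, h⟩
    exact SameGerm.theta_eq hsat hab hx hy h)

theorem grng_germ {s : S} {x : 𝓐.Spectrum} (hx : x ∈ 𝓐.srcDom s) :
    grng hsat hab (𝓐.germ s x hx) = theta hsat hab s x := rfl

theorem mem_srcDom_of_composable {s t : S} {x y : 𝓐.Spectrum} (hx : x ∈ 𝓐.srcDom s)
    (hy : y ∈ 𝓐.srcDom t) (c : x = theta hsat hab t y) : y ∈ 𝓐.srcDom (s * t) :=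
  mul_mem_srcDom hsat hab hy (c ▸ hx)

/-- The product of two composable germs. -/
noncomputable def gmul (g h : 𝓐.Germ) (c : 𝓐.germSrc g = grng hsat hab h) : 𝓐.Germ :=
  𝓐.germ ((Quot.out g).s * (Quot.out h).s) (Quot.out h).x
    (mem_srcDom_of_composable hsat hab (Quot.out g).mem (Quot.out h).mem (by
      rw [← germ_out 𝓐 g, ← germ_out 𝓐 h] at c; exact c))

/-- The product is defined with chosen representatives; `SameGerm.mul` shows that any others give
the same germ. -/
theorem gmul_germ {s t : S} {x y : 𝓐.Spectrum} (hx : x ∈ 𝓐.srcDom s) (hy : y ∈ 𝓐.srcDom t)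
    (c : x = theta hsat hab t y) :
    gmul hsat hab (𝓐.germ s x hx) (𝓐.germ t y hy) c =
      𝓐.germ (s * t) y (mem_srcDom_of_composable hsat hab hx hy c) := by
  obtain ⟨h1, h2⟩ := germ_eq_iff.mp (germ_out 𝓐 (𝓐.germ s x hx))
  obtain ⟨h3, h4⟩ := germ_eq_iff.mp (germ_out 𝓐 (𝓐.germ t y hy))
  refine germ_eq h3 (SameGerm.mul hsat hab (Quot.out (𝓐.germ t y hy)).mem ?_ h4)
  have h5 : theta hsat hab (Quot.out (𝓐.germ t y hy)).s (Quot.out (𝓐.germ t y hy)).x =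
      (Quot.out (𝓐.germ s x hx)).x := by
    rw [h1, c]
    exact (SameGerm.theta_eq hsat hab (Quot.out (𝓐.germ t y hy)).mem (h3.symm ▸ hy) h4).trans
      (by rw [h3])
  rw [h5]
  exact h2

/-- The representatives enter through equations and the domain proof is existential, so that
iterated products can be computed without rewriting inside the composability proofs. -/
theorem gmul_eq {g h : 𝓐.Germ} {s t : S} {x y : 𝓐.Spectrum} {hx : x ∈ 𝓐.srcDom s}
    {hy : y ∈ 𝓐.srcDom t} (hg : g = 𝓐.germ s x hx) (hh : h = 𝓐.germ t y hy)
    (c : 𝓐.germSrc g = grng hsat hab h) :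
    ∃ hst, gmul hsat hab g h c = 𝓐.germ (s * t) y hst := by
  subst hg hh
  exact ⟨_, gmul_germ hsat hab hx hy c⟩

/-- The inverse of a germ. -/
noncomputable def ginv : 𝓐.Germ → 𝓐.Germ :=
  Quot.lift (fun p => 𝓐.germ p.s⁻¹ (theta hsat hab p.s p.x)
    (theta_mem_srcDom_inv hsat hab p.mem)) (by
    rintro ⟨s, x, hx⟩ ⟨t, y, hy⟩ ⟨rfl : x = y, h⟩
    exact germ_eq (SameGerm.theta_eq hsat hab hx hy h) (SameGerm.inv hsat hab hx h))

theorem ginv_germ {s : S} {x : 𝓐.Spectrum} (hx : x ∈ 𝓐.srcDom s) :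
    ginv hsat hab (𝓐.germ s x hx) =
      𝓐.germ s⁻¹ (theta hsat hab s x) (theta_mem_srcDom_inv hsat hab hx) := rfl

/-- The groupoid of germs. -/
noncomputable def germGroupoid : GroupoidStr 𝓐.Germ 𝓐.Spectrum where
  src := 𝓐.germSrc
  rng := grng hsat hab
  unit := gunit
  mul := gmul hsat hab
  inv := ginv hsat hab
  src_unit _ := rfl
  rng_unit x := theta_idem hsat hab (exists_mem_dom x).choose_spec.choose
    (exists_mem_dom x).choose_spec.choose_spec
  src_mul g h c := by
    obtain ⟨s, x, hx, rfl⟩ := exists_germ g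
    obtain ⟨t, y, hy, rfl⟩ := exists_germ h
    rw [gmul_germ hsat hab hx hy c]
    rfl
  rng_mul g h c := by
    obtain ⟨s, x, hx, rfl⟩ := exists_germ g
    obtain ⟨t, y, hy, rfl⟩ := exists_germ h
    have c' : x = theta hsat hab t y := c
    rw [gmul_germ hsat hab hx hy c, grng_germ, grng_germ, theta_mul, ← c']
    exact mem_srcDom_of_composable hsat hab hx hy c
  src_inv g := by
    obtain ⟨s, x, hx, rfl⟩ := exists_germ g
    rfl
  rng_inv g := by
    obtain ⟨s, x, hx, rfl⟩ := exists_germ g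
    exact theta_inv_theta hsat hab hx
  mul_assoc g h k c c' d d' := by
    obtain ⟨r, x, hx, hg⟩ := exists_germ g
    obtain ⟨s, y, hy, hh⟩ := exists_germ h
    obtain ⟨t, z, hz, hk⟩ := exists_germ k
    obtain ⟨_, e1⟩ := gmul_eq hsat hab hg hh c
    obtain ⟨_, e2⟩ := gmul_eq hsat hab hh hk c'
    obtain ⟨_, e3⟩ := gmul_eq hsat hab e1 hk d
    obtain ⟨_, e4⟩ := gmul_eq hsat hab hg e2 d'
    rw [e3, e4]
    exact germ_eq rfl (mul_assoc r s t ▸ SameGerm.refl _ _)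
  unit_mul g c := by
    obtain ⟨s, x, hx, rfl⟩ := exists_germ g
    obtain ⟨e, he, h⟩ := exists_mem_dom (theta hsat hab s x)
    obtain ⟨_, e1⟩ := gmul_eq hsat hab (gunit_eq he h ((srcDom_idem he).mpr h)) rfl c
    exact e1.trans (germ_eq rfl (SameGerm.idem_mul hsat hab hx he h))
  mul_unit g c := by
    obtain ⟨s, x, hx, rfl⟩ := exists_germ g
    obtain ⟨e, he, h⟩ := exists_mem_dom x
    obtain ⟨_, e1⟩ := gmul_eq hsat hab rfl (gunit_eq he h ((srcDom_idem he).mpr h)) c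
    exact e1.trans (germ_eq rfl (SameGerm.mul_idem he h))
  mul_inv g c := by
    obtain ⟨s, x, hx, rfl⟩ := exists_germ g
    obtain ⟨_, e1⟩ := gmul_eq hsat hab rfl (ginv_germ hsat hab hx) c
    exact e1.trans (gunit_eq (idem_mul_inv s) (theta_mem hsat hab hx) _).symm
  inv_mul g c := by
    obtain ⟨s, x, hx, rfl⟩ := exists_germ g
    obtain ⟨_, e1⟩ := gmul_eq hsat hab (ginv_germ hsat hab hx) rfl c
    exact e1.trans (gunit_eq (idem_inv_mul s) hx _).symm

theorem isGermGroupoid_germGroupoid :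
    𝓐.IsGermGroupoid (thetaHomeo hsat hab) (germGroupoid hsat hab) where
  src_germ _ _ _ := rfl
  rng_germ _ _ _ := rfl
  unit_eq _ he _ h := ⟨(srcDom_idem he).mpr h, gunit_eq he h _⟩
  mul_germ _ _ hx _ _ hy c := ⟨_, gmul_germ hsat hab hx hy c⟩
  inv_germ _ _ hx := ⟨_, ginv_germ hsat hab hx⟩

theorem continuous_grng : Continuous (grng hsat hab) := by
  refine continuous_iff_continuousAt.mpr fun g => ?_
  obtain ⟨s, x, hx, rfl⟩ := exists_germ g
  have h1 : ∀ g ∈ 𝓐.germSet s (𝓐.srcDom s),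
      theta hsat hab s (𝓐.germSrc g) = grng hsat hab g := by
    rintro _ ⟨y, hy, -, rfl⟩
    rfl
  refine Filter.Tendsto.congr' ((eventually_mem_germSet hx).mono h1) ?_
  exact ContinuousAt.comp (f := 𝓐.germSrc) (x := 𝓐.germ s x hx)
    (continuousAt_theta hsat hab hx) continuous_germSrc.continuousAt

theorem continuous_ginv : Continuous (ginv hsat hab) := by
  refine continuous_iff_continuousAt.mpr fun g => ?_
  obtain ⟨s, x, hx, rfl⟩ := exists_germ g
  refine (tendsto_germ_iff (theta_mem_srcDom_inv hsat hab hx)).mpr ⟨?_, ?_⟩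
  · refine Filter.Tendsto.congr (f₁ := grng hsat hab) (fun g => ?_)
      (continuous_grng hsat hab).continuousAt
    exact ((germGroupoid hsat hab).src_inv g).symm
  · filter_upwards [eventually_mem_germSet hx]
    rintro _ ⟨y, hy, -, rfl⟩
    exact germ_mem_germSet (theta_mem_srcDom_inv hsat hab hy)

theorem ginv_ginv (g : 𝓐.Germ) : ginv hsat hab (ginv hsat hab g) = g := by
  obtain ⟨s, x, hx, rfl⟩ := exists_germ g
  rw [ginv_germ, ginv_germ]
  exact germ_eq (theta_inv_theta hsat hab hx) (by rw [inv_inv_eq]; exact SameGerm.refl _ _)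

/-- Products of germs in O(s) and O(t) lie in O(st), and their source is that of the second factor;
`tendsto_germ_iff` needs no more. -/
theorem continuous_gmul : Continuous fun q : {q : 𝓐.Germ × 𝓐.Germ //
    𝓐.germSrc q.1 = grng hsat hab q.2} => gmul hsat hab q.1.1 q.1.2 q.2 := by
  refine continuous_iff_continuousAt.mpr ?_
  rintro ⟨⟨g, h⟩, c⟩
  obtain ⟨s, x, hx, rfl⟩ := exists_germ g
  obtain ⟨t, y, hy, rfl⟩ := exists_germ h
  refine (congrArg (Filter.Tendsto _ _ <| nhds ·) (gmul_germ hsat hab hx hy c)).mpr ?_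
  rw [tendsto_germ_iff]
  have h1 : Continuous fun q : {q : 𝓐.Germ × 𝓐.Germ //
      𝓐.germSrc q.1 = grng hsat hab q.2} => q.1.1 := continuous_fst.comp continuous_subtype_val
  have h2 : Continuous fun q : {q : 𝓐.Germ × 𝓐.Germ //
      𝓐.germSrc q.1 = grng hsat hab q.2} => q.1.2 := continuous_snd.comp continuous_subtype_val
  constructor
  · refine Filter.Tendsto.congr (fun q => ((germGroupoid hsat hab).src_mul _ _ q.2).symm) ?_
    exact (continuous_germSrc.comp h2).continuousAt (x := ⟨(𝓐.germ s x hx, 𝓐.germ t y hy), c⟩)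
  · filter_upwards [(h1.tendsto _).eventually (eventually_mem_germSet hx),
      (h2.tendsto _).eventually (eventually_mem_germSet hy)]
    rintro ⟨⟨g, h⟩, c'⟩ ⟨x', hx', -, rfl : g = _⟩ ⟨y', hy', -, rfl : h = _⟩
    rw [gmul_germ hsat hab hx' hy' c']
    exact germ_mem_germSet _

theorem continuous_gunit : Continuous (gunit : 𝓐.Spectrum → 𝓐.Germ) := by
  refine continuous_iff_continuousAt.mpr fun x => ?_
  obtain ⟨e, he, h⟩ := exists_mem_dom x
  unfold ContinuousAt
  rw [gunit_eq he h ((srcDom_idem he).mpr h), tendsto_germ_iff]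
  refine ⟨Filter.tendsto_id, ?_⟩
  filter_upwards [(isOpen_dom he).mem_nhds h] with y hy
  rw [gunit_eq he hy ((srcDom_idem he).mpr hy)]
  exact germ_mem_germSet _

theorem isEtale_germGroupoid : (germGroupoid hsat hab).IsEtale where
  isEmbedding_unit := Function.LeftInverse.isEmbedding (f := 𝓐.germSrc) (fun _ => rfl)
    continuous_germSrc continuous_gunit
  continuous_src := continuous_germSrc
  continuous_rng := continuous_grng hsat hab
  continuous_mul := continuous_gmul hsat hab
  continuous_inv := continuous_ginv hsat hab
  t2Space := inferInstance
  locallyCompactSpace := inferInstance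
  isLocalHomeomorph_rng := by
    let φ : 𝓐.Germ ≃ₜ 𝓐.Germ :=
      { toFun := ginv hsat hab
        invFun := ginv hsat hab
        left_inv := ginv_ginv hsat hab
        right_inv := ginv_ginv hsat hab
        continuous_toFun := continuous_ginv hsat hab
        continuous_invFun := continuous_ginv hsat hab }
    -- The range is the source composed with inversion, a homeomorphism.
    have h : (germGroupoid hsat hab).rng = 𝓐.germSrc ∘ φ := by
      funext g
      exact ((germGroupoid hsat hab).src_inv g).symm
    rw [h]
    exact isLocalHomeomorph_germSrc.comp φ.isLocalHomeomorph

end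

end

end FellLine

namespace FellLine

section

variable {S : Type*} [InverseSemigroup S] {A : S → Type*}
  [∀ s, NormedAddCommGroup (A s)] [∀ s, NormedSpace ℂ (A s)] [∀ s, CompleteSpace (A s)]
  {𝓐 : FellBundle S A}

/-! ### The pairing of elements with the same germ -/

theorem SameGerm.exists_val {x : 𝓐.Spectrum} {s t : S} (h : SameGerm x s t) :
    ∃ c : 𝓐.Tot, Idem c.1 ∧ val x c = 1 ∧ s * c.1 = t * c.1 := by
  obtain ⟨e, he, h, h'⟩ := h
  obtain ⟨c, rfl, hc⟩ := exists_val_eq_one h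
  exact ⟨c, he, hc, h'⟩

theorem SameGerm.of_val {x : 𝓐.Spectrum} {s t : S} {c : 𝓐.Tot} (hc : Idem c.1)
    (h : val x c ≠ 0) (hst : s * c.1 = t * c.1) : SameGerm x s t :=
  ⟨c.1, hc, (mem_dom hc).mpr ⟨c, rfl, h⟩, hst⟩

theorem exists_val_common {x : 𝓐.Spectrum} {r s t : S} (h : SameGerm x r s)
    (h' : SameGerm x r t) :
    ∃ c : 𝓐.Tot, Idem c.1 ∧ val x c = 1 ∧ r * c.1 = s * c.1 ∧ r * c.1 = t * c.1 := by
  obtain ⟨c, hc, hc1, hcs⟩ := h.exists_val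
  obtain ⟨d, hd, hd1, hdt⟩ := h'.exists_val
  refine ⟨c * d, hc.mul hd, by rw [val_mul x hc hd, hc1, hd1, one_mul], ?_, ?_⟩
  · rw [mul_fst, ← mul_assoc, hcs, mul_assoc]
  · rw [mul_fst, hc.comm hd, ← mul_assoc, hdt, mul_assoc]

open Classical in
/-- The value `(p* q)(x)` for elements `p` and `q` of fibers over elements of `S` with the same
germ at `x`; it is `0` if the germs are different. -/
noncomputable def pair (x : 𝓐.Spectrum) (p q : 𝓐.Tot) : ℂ :=
  if h : ∃ c : 𝓐.Tot, Idem c.1 ∧ val x c = 1 ∧ p.1 * c.1 = q.1 * c.1 then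
    val x (star (p * h.choose) * (q * h.choose)) else 0

theorem pair_eq_zero {x : 𝓐.Spectrum} {p q : 𝓐.Tot} (h : ¬ SameGerm x p.1 q.1) :
    pair x p q = 0 := by
  unfold pair
  rw [dif_neg]
  rintro ⟨c, hc, h1, h2⟩
  exact h (SameGerm.of_val hc (by rw [h1]; exact one_ne_zero) h2)

theorem val_conj_idem (x : 𝓐.Spectrum) {k d : 𝓐.Tot} (hk : Idem k.1) (hd : Idem d.1) :
    val x (star d * (k * d)) = (starRingEnd ℂ) (val x d) * val x d * val x k := by
  rw [val_mul x hd.inv (idem_mul hk hd), val_mul x hk hd, val_star x hd]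
  ring

section

variable (hab : 𝓐.IsSemiAbelian)
include hab

/-- Independence of the choice in `pair`: if d is the chosen element, then d c = c d, and evaluating
(p d c)* (q d c) in both groupings leaves the factors |c(x)|² and |d(x)|² = 1. -/
theorem val_star_mul_eq_pair {x : 𝓐.Spectrum} {p q c : 𝓐.Tot} (hc : Idem c.1)
    (h0 : val x c ≠ 0) (h : p.1 * c.1 = q.1 * c.1) :
    val x (star (p * c) * (q * c)) =
      (starRingEnd ℂ) (val x c) * val x c * pair x p q := by
  have hex := (SameGerm.of_val hc h0 h).exists_val
  unfold pair
  rw [dif_pos hex]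
  obtain ⟨hd, h1, h2⟩ := hex.choose_spec
  generalize hex.choose = d at hd h1 h2 ⊢
  have e1 : star (p * (d * c)) * (q * (d * c)) =
      star c * (star (p * d) * (q * d) * c) := by
    simp only [star_mul, mul_assoc]
  have e2 : star (p * (c * d)) * (q * (c * d)) =
      star d * (star (p * c) * (q * c) * d) := by
    simp only [star_mul, mul_assoc]
  rw [mul_comm_idem hab hc hd, e1] at e2
  have e3 := congrArg (val x) e2
  rw [val_conj_idem x (idem_star_mul (p := p * d) (q := q * d) h2) hc,
    val_conj_idem x (idem_star_mul (p := p * c) (q := q * c) h) hd, h1] at e3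
  simpa using e3.symm

theorem pair_eq {x : 𝓐.Spectrum} {p q c : 𝓐.Tot} (hc : Idem c.1)
    (h0 : val x c = 1) (h : p.1 * c.1 = q.1 * c.1) :
    pair x p q = val x (star (p * c) * (q * c)) := by
  rw [val_star_mul_eq_pair hab hc (by rw [h0]; exact one_ne_zero) h, h0]
  simp

theorem pair_of_eq (x : 𝓐.Spectrum) {p q : 𝓐.Tot} (h : p.1 = q.1) :
    pair x p q = val x (star p * q) := by
  obtain ⟨c, hc, h1, h2⟩ := (h ▸ SameGerm.refl x p.1 : SameGerm x p.1 q.1).exists_val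
  rw [pair_eq hab hc h1 h2]
  have : star (p * c) * (q * c) = star c * (star p * q * c) := by
    simp only [star_mul, mul_assoc]
  rw [this, val_conj_idem x (idem_star_mul h) hc, h1]
  simp

theorem pair_symm (x : 𝓐.Spectrum) (p q : 𝓐.Tot) :
    pair x q p = (starRingEnd ℂ) (pair x p q) := by
  by_cases h : SameGerm x p.1 q.1
  · obtain ⟨c, hc, h1, h2⟩ := h.exists_val
    rw [pair_eq hab hc h1 h2, pair_eq hab hc h1 h2.symm]
    exact val_star_mul x (p := p * c) (q := q * c) h2
  · rw [pair_eq_zero h, pair_eq_zero fun h' => h h'.symm, map_zero]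

/-- An auxiliary d with d(x) = 1 that puts p and q in one fiber is replaced by d c, which puts p and
q c in one fiber; the factors c in (p d c)* (q c d c) can then be collected. -/
theorem pair_mul_idem {x : 𝓐.Spectrum} {p q c : 𝓐.Tot} (h : SameGerm x p.1 q.1)
    (hc : Idem c.1) (h0 : val x c ≠ 0) : pair x p (q * c) = pair x p q * val x c := by
  obtain ⟨d, hd, h1, h2⟩ := h.exists_val
  have hdc : Idem (d * c).1 := hd.mul hc
  have h3 : val x (d * c) = val x c := by rw [val_mul x hd hc, h1, one_mul]
  have h4 : p.1 * (d * c).1 = (q * c).1 * (d * c).1 := by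
    simp only [mul_fst]
    rw [hd.comm hc, mul_assoc, ← mul_assoc c.1 c.1, hc.mul_self, hc.comm hd, ← mul_assoc, h2,
      mul_assoc]
  have h5 := val_star_mul_eq_pair hab hdc (by rwa [h3]) h4
  have h6 : star (p * (d * c)) * (q * c * (d * c)) =
      star c * (star (p * d) * (q * d) * c * c) := by
    rw [mul_assoc q c, ← mul_assoc c d c, mul_comm_idem hab hc hd]
    simp only [star_mul, mul_assoc]
  have i := idem_star_mul (p := p * d) (q := q * d) h2
  rw [h3, h6, val_mul x hc.inv (idem_mul (idem_mul i hc) hc), val_mul x (idem_mul i hc) hc,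
    val_mul x i hc, val_star x hc, ← pair_eq hab hd h1 h2] at h5
  have h7 : (starRingEnd ℂ) (val x c) ≠ 0 := (map_ne_zero _).mpr h0
  refine mul_left_cancel₀ (mul_ne_zero h7 h0) ?_
  linear_combination -h5

theorem pair_el_add (x : 𝓐.Spectrum) (p : 𝓐.Tot) {s : S} (a b : A s) :
    pair x p (𝓐.el (a + b)) = pair x p (𝓐.el a) + pair x p (𝓐.el b) := by
  by_cases h : SameGerm x p.1 s
  · obtain ⟨c, hc, h1, h2⟩ := h.exists_val
    rw [pair_eq hab hc h1 h2, pair_eq hab hc h1 h2, pair_eq hab hc h1 h2]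
    refine (congrArg (val x) ?_).trans (val_el_add x (𝓐.mul (star (p * c)).2 (𝓐.mul a c.2))
      (𝓐.mul (star (p * c)).2 (𝓐.mul b c.2)))
    change 𝓐.el (𝓐.mul _ (𝓐.mul (a + b) c.2)) = _
    rw [map_add, LinearMap.add_apply, map_add]
  · rw [pair_eq_zero h, pair_eq_zero h, pair_eq_zero h, add_zero]

theorem pair_el_smul (x : 𝓐.Spectrum) (p : 𝓐.Tot) {s : S} (z : ℂ) (a : A s) :
    pair x p (𝓐.el (z • a)) = z * pair x p (𝓐.el a) := by
  by_cases h : SameGerm x p.1 s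
  · obtain ⟨c, hc, h1, h2⟩ := h.exists_val
    rw [pair_eq hab hc h1 h2, pair_eq hab hc h1 h2]
    refine (congrArg (val x) ?_).trans
      (val_el_smul x z (𝓐.mul (star (p * c)).2 (𝓐.mul a c.2)))
    change 𝓐.el (𝓐.mul _ (𝓐.mul (z • a) c.2)) = _
    rw [map_smul, LinearMap.smul_apply, map_smul]
  · rw [pair_eq_zero h, pair_eq_zero h, mul_zero]

/-- The pairing has rank one. -/
theorem pair_mul_pair {x : 𝓐.Spectrum} {u p q : 𝓐.Tot} (h : SameGerm x u.1 p.1)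
    (h' : SameGerm x u.1 q.1) :
    pair x u u * pair x p q = pair x p u * pair x u q := by
  obtain ⟨c, hc, h1, h2, h3⟩ := exists_val_common h h'
  rw [pair_eq hab hc h1 rfl, pair_eq hab hc h1 (h2.symm.trans h3),
    pair_eq hab hc h1 h2.symm, pair_eq hab hc h1 h3]
  have := val_rank_one hab x (a := u * c) (b := u * c) (c := p * c) (d := q * c) rfl h2
    (h2.symm.trans h3)
  rw [this]
  ring

/-- One c serves for all y with c(y) ≠ 0, where the pairing is the continuous function ((p c)* (q
c))(y) divided by |c(y)|². -/
theorem continuousAt_pair {x : 𝓐.Spectrum} {p q : 𝓐.Tot} (h : SameGerm x p.1 q.1) :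
    ContinuousAt (fun y => pair y p q) x := by
  obtain ⟨c, hc, h1, h2⟩ := h.exists_val
  have h0 : val x c ≠ 0 := by rw [h1]; exact one_ne_zero
  have hev : ∀ᶠ y in nhds x, val y c ≠ 0 := (continuous_val c).continuousAt.eventually_ne h0
  have hcc : ∀ {y : 𝓐.Spectrum}, val y c ≠ 0 → (starRingEnd ℂ) (val y c) * val y c ≠ 0 :=
    fun hy => mul_ne_zero ((map_ne_zero _).mpr hy) hy
  have : ContinuousAt (fun y => val y (star (p * c) * (q * c)) /
      ((starRingEnd ℂ) (val y c) * val y c)) x :=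
    (continuous_val _).continuousAt.div ((Complex.continuous_conj.comp
      (continuous_val c)).mul (continuous_val c)).continuousAt (hcc h0)
  refine this.congr (hev.mono fun y hy => ?_)
  change val y (star (p * c) * (q * c)) / ((starRingEnd ℂ) (val y c) * val y c) = pair y p q
  rw [val_star_mul_eq_pair hab hc hy h2, mul_div_cancel_left₀ _ (hcc hy)]

/-- The rank-one identity in the form ⟨u, u⟩ ‖p - q‖² = |⟨u, p⟩ - ⟨u, q⟩|². The left side is written
out, since p and q may lie in different fibers. It reduces equivalence of triples to equality of one
coordinate. -/
theorem pair_sub_sq {x : 𝓐.Spectrum} {u p q : 𝓐.Tot} (h : SameGerm x u.1 p.1)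
    (h' : SameGerm x u.1 q.1) :
    pair x u u * (pair x p p - pair x p q - pair x q p + pair x q q) =
      (starRingEnd ℂ) (pair x u p - pair x u q) * (pair x u p - pair x u q) := by
  have h1 := pair_mul_pair hab h h
  have h2 := pair_mul_pair hab h h'
  have h3 := pair_mul_pair hab h' h
  have h4 := pair_mul_pair hab h' h'
  rw [map_sub, ← pair_symm hab, ← pair_symm hab]
  linear_combination h1 - h2 - h3 + h4

end

/-! ### Compatibility of the pairing with products and adjoints -/

section

variable (hsat : 𝓐.IsSaturated) (hab : 𝓐.IsSemiAbelian)

theorem val_theta_conj {x : 𝓐.Spectrum} {u k : 𝓐.Tot} (hu : val x (star u * u) = 1)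
    (hk : Idem k.1) : val (theta hsat hab u.1 x) (u * (k * star u)) = val x k := by
  have hx : x ∈ 𝓐.srcDom u.1 := mem_srcDom_of_val (by rw [hu]; exact one_ne_zero)
  have h1 := val_theta hsat hab hx (p := u) (q := u) rfl rfl
    (idem_conj' (p := u) (q := u) rfl hk)
  have h2 : star u * (u * (k * star u) * u) = star u * u * (k * (star u * u)) := by
    simp only [mul_assoc]
  have i : Idem (star u * u).1 := idem_star_mul rfl
  rw [h2, val_mul x i (idem_mul hk i), val_mul x hk i, hu, one_mul, one_mul, mul_one] at h1
  exact h1.symm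

/-- A single element d' over an idempotent has to put p q and p' q' in the same fiber; afterwards
the identity is `val_star_mul_conj`. -/
theorem pair_mul {y : 𝓐.Spectrum} {p p' q q' : 𝓐.Tot} (hy : y ∈ 𝓐.srcDom q.1)
    (hp : SameGerm (theta hsat hab q.1 y) p.1 p'.1) (hq : SameGerm y q.1 q'.1) :
    pair y (p * q) (p' * q') = pair (theta hsat hab q.1 y) p p' * pair y q q' := by
  obtain ⟨c, hc, hc1, hcp⟩ := hp.exists_val
  obtain ⟨d, hd, hd1, hdq⟩ := hq.exists_val
  obtain ⟨u, hu, hu1⟩ := exists_star_mul_self_eq_one hsat hab hy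
  -- Conjugation by u carries c from θ_q(y) to y: the value of d' at y is d(y) (u* u)(y) c(θ_q(y)) =
  -- 1.
  set d' := d * (star u * (c * u)) with hd'
  have iu : Idem (star u * (c * u)).1 := idem_conj rfl hc
  have id' : Idem d'.1 := idem_mul hd iu
  have hd1' : val y d' = 1 := by
    rw [hd', val_mul y hd iu, val_theta hsat hab hy hu hu hc, hd1, hu1, hc1]; ring
  -- Here r' d u* lies over an idempotent and so commutes with c; this moves c from the end of the
  -- word to its place next to r.
  have key : ∀ r r' : 𝓐.Tot, Idem (r' * d * star u).1 →
      r * r' * d' = (r * c) * (r' * d) * (star u * u) := by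
    intro r r' h
    calc r * r' * d' = r * (r' * d * star u * c) * u := by simp only [hd', mul_assoc]
      _ = r * (c * (r' * d * star u)) * u := by rw [mul_comm_idem hab h hc]
      _ = (r * c) * (r' * d) * (star u * u) := by simp only [mul_assoc]
  have i1 : Idem (q * d * star u).1 := by
    simp only [mul_fst, star_fst, hu, mul_assoc]
    exact hd.conj' _
  have i2 : Idem (q' * d * star u).1 := by
    have : (q' * d * star u).1 = (q * d * star u).1 := by
      simp only [mul_fst, star_fst, hdq]
    rw [this]; exact i1
  have k1 := key p q i1
  have k2 := key p' q' i2
  have hidx : (p * q).1 * d'.1 = (p' * q').1 * d'.1 := by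
    change (p * q * d').1 = (p' * q' * d').1
    rw [k1, k2]
    simp only [mul_fst, hcp, hdq]
  rw [pair_eq hab id' hd1' hidx, k1, k2]
  have hw : Idem (star u * u).1 := idem_star_mul rfl
  have h1 : star ((p * c) * (q * d) * (star u * u)) * ((p' * c) * (q' * d) * (star u * u)) =
      star (star u * u) * (star ((p * c) * (q * d)) * ((p' * c) * (q' * d)) * (star u * u)) := by
    simp only [star_mul, mul_assoc]
  have hm : ((p * c) * (q * d)).1 = ((p' * c) * (q' * d)).1 := by
    simp only [mul_fst, hcp, hdq]
  have hyd : y ∈ 𝓐.dom hd := (mem_dom hd).mpr ⟨d, rfl, by rw [hd1]; exact one_ne_zero⟩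
  obtain ⟨h2, h3⟩ := theta_mul_idem hsat hab hy hyd
  rw [h1, val_conj_idem y (idem_star_mul hm) hw, hu1,
    val_star_mul_conj hsat hab (s := q.1 * d.1) rfl hdq.symm h2
      (show (p * c).1 = (p' * c).1 from hcp) rfl, h3,
    ← pair_eq hab hc hc1 hcp, ← pair_eq hab hd hd1 hdq]
  simp [_root_.mul_comm]

/-- After c is carried to the range by conjugation with a unit vector u, this is
`val_theta_mul_star` for p c and q c. -/
theorem pair_star {x : 𝓐.Spectrum} {p q : 𝓐.Tot} (hx : x ∈ 𝓐.srcDom p.1)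
    (h : SameGerm x p.1 q.1) :
    pair (theta hsat hab p.1 x) (star p) (star q) = pair x q p := by
  obtain ⟨c, hc, hc1, hcp⟩ := h.exists_val
  obtain ⟨u, hu, hu1⟩ := exists_star_mul_self_eq_one hsat hab hx
  -- The extra factor c* is there for the identity r* d = (r c)* m: it commutes with r* u c, which
  -- lies over an idempotent, and joins r*. The value of d at θ_p(x) is |c(x)|² = 1.
  set d := u * (c * star c * star u) with hd
  set m := u * (c * star u) with hm
  have hcc : Idem (c * star c).1 := idem_mul hc hc.inv
  have id : Idem d.1 := idem_conj' rfl hcc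
  have im : Idem m.1 := idem_conj' rfl hc
  have hd1 : val (theta hsat hab p.1 x) d = 1 := by
    rw [hd, ← hu, val_theta_conj hsat hab hu1 hcc, val_mul x hc hc.inv, val_star x hc, hc1]
    simp
  have hm1 : val (theta hsat hab p.1 x) m = 1 := by
    rw [hm, ← hu, val_theta_conj hsat hab hu1 hc, hc1]
  have key : ∀ r : 𝓐.Tot, Idem (star r * u * c).1 → star r * d = star (r * c) * m := by
    intro r hr
    calc star r * d = star r * u * c * star c * star u := by simp only [hd, mul_assoc]
      _ = star c * (star r * u * c) * star u := by
          rw [mul_comm_idem hab hr (idem_star hc)]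
      _ = star (r * c) * m := by simp only [hm, star_mul, mul_assoc]
  have i1 : Idem (star p * u * c).1 := by
    simp only [mul_fst, star_fst, hu]
    exact (idem_inv_mul _).mul hc
  have i2 : Idem (star q * u * c).1 := by
    simp only [mul_fst, star_fst, hu]
    rw [mul_assoc, hcp, ← mul_assoc]
    exact (idem_inv_mul _).mul hc
  have k1 := key p i1
  have k2 := key q i2
  have hidx : (star p).1 * d.1 = (star q).1 * d.1 := by
    change (star p * d).1 = (star q * d).1
    rw [k1, k2]
    simp only [mul_fst, star_fst, hcp]
  have hpc : (p * c).1 = (q * c).1 := hcp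
  rw [pair_eq hab id hd1 hidx, k1, k2]
  have h1 : star (star (p * c) * m) * (star (q * c) * m) =
      star m * (p * c * star (q * c) * m) := by
    simp only [star_mul, star_star, mul_assoc]
  have hxc : x ∈ 𝓐.dom hc := (mem_dom hc).mpr ⟨c, rfl, by rw [hc1]; exact one_ne_zero⟩
  obtain ⟨h2, h3⟩ := theta_mul_idem hsat hab hx hxc
  rw [h1, val_conj_idem _ (idem_mul_star hpc) im, hm1, ← h3,
    val_theta_mul_star hsat hab (s := p.1 * c.1) h2 rfl hcp.symm, pair_eq hab hc hc1 hcp.symm]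
  simp

end

/-! ### The total space of the line bundle -/

theorem innerAt_sub_sub {s : S} (x : 𝓐.Spectrum) (a b : A s) :
    𝓐.innerAt x (a - b) (a - b) =
      𝓐.innerAt x a a - 𝓐.innerAt x a b - 𝓐.innerAt x b a + 𝓐.innerAt x b b := by
  unfold FellBundle.innerAt
  simp only [map_sub, LinearMap.sub_apply]
  ring

/-- The square is expanded in the disjoint union of the fibers, where the transport along s = t
disappears. -/
theorem eqAt_iff {s t : S} (h : s = t) (x : 𝓐.Spectrum) (a : A s) (b : A t) :
    𝓐.EqAt h x a b ↔ val x (star (𝓐.el a) * 𝓐.el a) - val x (star (𝓐.el a) * 𝓐.el b) -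
      val x (star (𝓐.el b) * 𝓐.el a) + val x (star (𝓐.el b) * 𝓐.el b) = 0 := by
  subst h
  unfold FellBundle.EqAt
  rw [innerAt_sub_sub, innerAt_eq, innerAt_eq, innerAt_eq, innerAt_eq]

/-- The element of the disjoint union of the fibers underlying a triple. -/
def tripEl (t : 𝓐.Trip) : 𝓐.Tot := ⟨t.s, t.a⟩

/-- Multiplying both elements by b only multiplies the expanded square by |b(x)|² ≠ 0. So the
auxiliary element matters only through equality of germs. -/
theorem tripRel_iff (hab : 𝓐.IsSemiAbelian) {p q : 𝓐.Trip} :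
    𝓐.TripRel p q ↔ p.x = q.x ∧ SameGerm p.x p.s q.s ∧
      pair p.x (tripEl p) (tripEl p) - pair p.x (tripEl p) (tripEl q) -
        pair p.x (tripEl q) (tripEl p) + pair p.x (tripEl q) (tripEl q) = 0 := by
  have key : ∀ (c : 𝓐.Tot) (hc : Idem c.1) (h0 : val p.x c ≠ 0) (h : p.s * c.1 = q.s * c.1),
      𝓐.EqAt h p.x (𝓐.mul p.a c.2) (𝓐.mul q.a c.2) ↔
      pair p.x (tripEl p) (tripEl p) - pair p.x (tripEl p) (tripEl q) -
        pair p.x (tripEl q) (tripEl p) + pair p.x (tripEl q) (tripEl q) = 0 := by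
    intro c hc h0 h
    rw [eqAt_iff]
    change val p.x (star (tripEl p * c) * (tripEl p * c)) -
      val p.x (star (tripEl p * c) * (tripEl q * c)) -
      val p.x (star (tripEl q * c) * (tripEl p * c)) +
      val p.x (star (tripEl q * c) * (tripEl q * c)) = 0 ↔ _
    rw [val_star_mul_eq_pair hab hc h0 rfl, val_star_mul_eq_pair hab hc h0 h,
      val_star_mul_eq_pair hab hc h0 h.symm, val_star_mul_eq_pair hab hc h0 rfl, ← mul_sub,
      ← mul_sub, ← mul_add, mul_eq_zero, or_iff_right]
    exact mul_ne_zero ((map_ne_zero _).mpr h0) h0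
  constructor
  · rintro ⟨hx, e, he, b, hb, h, hE⟩
    have hb' : val p.x (𝓐.el b) ≠ 0 := by rwa [val_el _ he]
    exact ⟨hx, SameGerm.of_val (c := 𝓐.el b) he hb' h, (key (𝓐.el b) he hb' h).mp hE⟩
  · rintro ⟨hx, hg, hE⟩
    obtain ⟨c, hc, h1, h2⟩ := hg.exists_val
    have h0 : val p.x c ≠ 0 := by rw [h1]; exact one_ne_zero
    refine ⟨hx, c.1, hc, c.2, ?_, h2, (key c hc h0 h2).mpr hE⟩
    rw [← val_el _ hc]
    exact h0

section

variable (hsat : 𝓐.IsSaturated) (hab : 𝓐.IsSemiAbelian)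
include hab

/-- By `pair_sub_sq` every coordinate is an invariant of the class; if u has another germ, both
sides are zero by convention. -/
theorem tripRel_pair {p q : 𝓐.Trip} (h : 𝓐.TripRel p q) (u : 𝓐.Tot) :
    pair p.x u (tripEl p) = pair p.x u (tripEl q) := by
  obtain ⟨-, h1, h2⟩ := (tripRel_iff hab).mp h
  by_cases hu : SameGerm p.x u.1 p.s
  · have := pair_sub_sq hab (p := tripEl p) (q := tripEl q) hu (hu.trans h1)
    rw [h2, mul_zero] at this
    have := this.symm
    rw [mul_eq_zero, map_eq_zero, or_self, sub_eq_zero] at this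
    exact this
  · rw [pair_eq_zero hu, pair_eq_zero fun h' => hu (h'.trans h1.symm)]

/-- Conversely, by the same identity, one coordinate with respect to a vector of nonzero length
determines the class. -/
theorem tripRel_of_pair {p q : 𝓐.Trip} (hx : p.x = q.x) (h : SameGerm p.x p.s q.s)
    {u : 𝓐.Tot} (hu : SameGerm p.x u.1 p.s) (hu1 : pair p.x u u ≠ 0)
    (h' : pair p.x u (tripEl p) = pair p.x u (tripEl q)) : 𝓐.TripRel p q := by
  refine (tripRel_iff hab).mpr ⟨hx, h, ?_⟩
  have := pair_sub_sq hab (p := tripEl p) (q := tripEl q) hu (hu.trans h)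
  rw [h', sub_self, mul_zero, mul_eq_zero, or_iff_right hu1] at this
  exact this

include hsat

theorem exists_pair_self_eq_one {x : 𝓐.Spectrum} {s : S} (h : x ∈ 𝓐.srcDom s) :
    ∃ u : 𝓐.Tot, u.1 = s ∧ pair x u u = 1 := by
  obtain ⟨u, hu, h1⟩ := exists_star_mul_self_eq_one hsat hab h
  exact ⟨u, hu, by rw [pair_of_eq hab x rfl, h1]⟩

/-- Only transitivity has content: with a unit vector u, available by saturation, the relation
becomes equality of germs and of coordinates. -/
theorem equivalence_tripRel : Equivalence 𝓐.TripRel where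
  refl p := (tripRel_iff hab).mpr ⟨rfl, SameGerm.refl _ _, by ring⟩
  symm := by
    rintro ⟨s, a, x, hx⟩ ⟨t, b, y, hy⟩ h
    obtain ⟨rfl : x = y, h1, h2⟩ := (tripRel_iff hab).mp h
    exact (tripRel_iff hab).mpr ⟨rfl, h1.symm, by linear_combination h2⟩
  trans := by
    rintro ⟨r, a, x, hx⟩ ⟨s, b, y, hy⟩ ⟨t, c, z, hz⟩ h h'
    obtain ⟨rfl : x = y, h1, -⟩ := (tripRel_iff hab).mp h
    obtain ⟨rfl : x = z, h2, -⟩ := (tripRel_iff hab).mp h'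
    obtain ⟨u, hu, hu1⟩ := exists_pair_self_eq_one hsat hab hx
    exact tripRel_of_pair hab rfl (h1.trans h2) (by rw [hu]; exact SameGerm.refl _ _)
      (by rw [hu1]; exact one_ne_zero) ((tripRel_pair hab h u).trans (tripRel_pair hab h' u))

end

section

variable (hsat : 𝓐.IsSaturated) (hab : 𝓐.IsSemiAbelian)

/-- The class `[p, x]` in the total space of the line bundle. -/
def mkL (p : 𝓐.Tot) (x : 𝓐.Spectrum) (hx : x ∈ 𝓐.srcDom p.1) : 𝓐.L :=
  𝓐.cls p.1 p.2 x hx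

theorem exists_mkL (v : 𝓐.L) : ∃ p x hx, v = mkL p x hx := by
  induction v using Quot.ind with
  | mk t => exact ⟨tripEl t, t.x, t.mem, rfl⟩

@[simp] theorem proj_mkL (p : 𝓐.Tot) (x : 𝓐.Spectrum) (hx : x ∈ 𝓐.srcDom p.1) :
    𝓐.proj (mkL p x hx) = 𝓐.germ p.1 x hx := rfl

/-- The coordinate of an element of the line bundle with respect to `u`. -/
noncomputable def coordL (u : 𝓐.Tot) : 𝓐.L → ℂ :=
  Quot.lift (fun t => pair t.x u (tripEl t)) fun p q h => by
    rw [tripRel_pair hab h u, h.1]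

theorem coordL_mkL (u p : 𝓐.Tot) (x : 𝓐.Spectrum) (hx : x ∈ 𝓐.srcDom p.1) :
    coordL hab u (mkL p x hx) = pair x u p :=
  rfl

include hab in
theorem mkL_eq {p q : 𝓐.Tot} {x y : 𝓐.Spectrum} {hx : x ∈ 𝓐.srcDom p.1}
    {hy : y ∈ 𝓐.srcDom q.1} (hxy : x = y) (h : SameGerm x p.1 q.1)
    {u : 𝓐.Tot} (hu : SameGerm x u.1 p.1) (hu1 : pair x u u ≠ 0)
    (h' : pair x u p = pair x u q) : mkL p x hx = mkL q y hy :=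
  Quot.sound (tripRel_of_pair hab (p := ⟨p.1, p.2, x, hx⟩) (q := ⟨q.1, q.2, y, hy⟩)
    hxy h hu hu1 h')

end

end

end FellLine

namespace FellLine

section

variable {S : Type*} [InverseSemigroup S] {A : S → Type*}
  [∀ s, NormedAddCommGroup (A s)] [∀ s, NormedSpace ℂ (A s)] [∀ s, CompleteSpace (A s)]
  {𝓐 : FellBundle S A}

/-! ### The fibers of the line bundle -/

section

variable (hab : 𝓐.IsSemiAbelian)
include hab

theorem eq_of_coordL {v w : 𝓐.L} {u : 𝓐.Tot} {x : 𝓐.Spectrum} {hx : x ∈ 𝓐.srcDom u.1}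
    (hu : pair x u u ≠ 0) (hv : 𝓐.proj v = 𝓐.germ u.1 x hx)
    (hw : 𝓐.proj w = 𝓐.germ u.1 x hx) (h : coordL hab u v = coordL hab u w) : v = w := by
  obtain ⟨p, y, hy, rfl⟩ := exists_mkL v
  obtain ⟨q, z, hz, rfl⟩ := exists_mkL w
  obtain ⟨rfl, h1⟩ := germ_eq_iff.mp hv
  obtain ⟨rfl, h2⟩ := germ_eq_iff.mp hw
  exact mkL_eq hab rfl (h1.trans h2.symm) h1.symm hu h

/-- The fiber is spanned by u: the multiple with the right coordinate must be v. In particular every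
class over [s, x] has a representative in A_s itself. -/
theorem exists_smul_unit {v : 𝓐.L} {u : 𝓐.Tot} {x : 𝓐.Spectrum} {hx : x ∈ 𝓐.srcDom u.1}
    (hu : pair x u u ≠ 0) (hv : 𝓐.proj v = 𝓐.germ u.1 x hx) :
    v = mkL (𝓐.el ((coordL hab u v / pair x u u) • u.2)) x hx := by
  refine eq_of_coordL hab (hx := hx) hu hv rfl ?_
  exact ((pair_el_smul hab x u _ u.2).trans (div_mul_cancel₀ _ hu)).symm

end

section

variable (hsat : 𝓐.IsSaturated) (hab : 𝓐.IsSemiAbelian)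
include hsat hab

theorem exists_rep {v : 𝓐.L} {s : S} {x : 𝓐.Spectrum} {hx : x ∈ 𝓐.srcDom s}
    (h : 𝓐.proj v = 𝓐.germ s x hx) : ∃ a : A s, v = 𝓐.cls s a x hx := by
  obtain ⟨⟨s, u⟩, rfl, hu⟩ := exists_pair_self_eq_one hsat hab hx
  exact ⟨_, exists_smul_unit hab (by rw [hu]; exact one_ne_zero) h⟩

theorem exists_unit (g : 𝓐.Germ) :
    ∃ (u : 𝓐.Tot) (hx : 𝓐.germSrc g ∈ 𝓐.srcDom u.1),
      g = 𝓐.germ u.1 (𝓐.germSrc g) hx ∧ pair (𝓐.germSrc g) u u = 1 := by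
  obtain ⟨s, x, hx, rfl⟩ := exists_germ g
  obtain ⟨u, rfl, hu⟩ := exists_pair_self_eq_one hsat hab hx
  exact ⟨u, hx, rfl, hu⟩

/-- The coordinate of the fiber over `g` with respect to a unit vector. -/
noncomputable def coordEquiv (g : 𝓐.Germ) : BundleFiber 𝓐.proj g ≃ ℂ where
  toFun v := coordL hab (exists_unit hsat hab g).choose v.1
  invFun z := ⟨mkL (𝓐.el (z • (exists_unit hsat hab g).choose.2)) (𝓐.germSrc g)
      (exists_unit hsat hab g).choose_spec.choose,
    (exists_unit hsat hab g).choose_spec.choose_spec.1.symm⟩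
  left_inv v := by
    obtain ⟨hx, h1, h2⟩ := (exists_unit hsat hab g).choose_spec
    refine Subtype.ext ?_
    have := exists_smul_unit hab (hx := hx) (by rw [h2]; exact one_ne_zero) (v.2.trans h1)
    rw [h2, div_one] at this
    exact this.symm
  right_inv z := by
    obtain ⟨hx, h1, h2⟩ := (exists_unit hsat hab g).choose_spec
    refine (pair_el_smul hab _ _ _ _).trans ?_
    exact (congrArg (z * ·) h2).trans (mul_one z)

/-- The fibers of the line bundle as Banach spaces. -/
@[reducible] noncomputable def banachFibers : BanachFibers 𝓐.proj where
  normedAddCommGroup g := (coordEquiv hsat hab g).normedAddCommGroup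
  normedSpace g := (coordEquiv hsat hab g).normedSpace ℂ
  completeSpace g := by
    let _ := (coordEquiv hsat hab g).normedAddCommGroup
    have : Isometry (coordEquiv hsat hab g) := fun _ _ => rfl
    exact (IsometryEquiv.mk (coordEquiv hsat hab g) this).completeSpace

/-- The structure is transported from ℂ through the coordinate `pair x u _` of a chosen unit vector,
so each formula is checked in that coordinate. For sums, multiplication by c is invisible because
c(x) = 1; for the norm, rank one and ⟨u, u⟩ = 1 give |⟨u, a⟩|² = ⟨a, a⟩. -/
theorem hasCanonicalFibers_banachFibers :
    letI := banachFibers hsat hab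
    𝓐.HasCanonicalFibers := by
  let _ := banachFibers hsat hab
  have hadd : ∀ (g : 𝓐.Germ) (v w : BundleFiber 𝓐.proj g),
      coordEquiv hsat hab g (v + w) = coordEquiv hsat hab g v + coordEquiv hsat hab g w :=
    fun g v w => (coordEquiv hsat hab g).apply_symm_apply _
  have hsmul : ∀ (g : 𝓐.Germ) (z : ℂ) (v : BundleFiber 𝓐.proj g),
      coordEquiv hsat hab g (z • v) = z * coordEquiv hsat hab g v :=
    fun g z v => (coordEquiv hsat hab g).apply_symm_apply _
  have hnorm : ∀ (g : 𝓐.Germ) (v : BundleFiber 𝓐.proj g),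
      ‖v‖ = ‖coordEquiv hsat hab g v‖ := fun g v => rfl
  refine ⟨?_, ?_, ?_, ?_⟩
  · intro s t a b x hs ht hp e he h c hc
    have hxe : x ∈ 𝓐.dom he := ⟨c, by rw [hc]; exact one_ne_zero⟩
    obtain ⟨hse, -⟩ := theta_mul_idem hsat hab hs hxe
    have hw : 𝓐.proj (𝓐.cls (s * e) (𝓐.mul a c + (h ▸ 𝓐.mul b c : A (s * e))) x hse) =
      𝓐.germ s x hs := germ_eq rfl (SameGerm.mul_idem he hxe)
    refine ⟨hse, congrArg Subtype.val (a₂ := (⟨_, hw⟩ : BundleFiber 𝓐.proj _))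
      ((coordEquiv hsat hab _).injective ?_)⟩
    refine (hadd _ _ _).trans ?_
    obtain ⟨hx, h1, h2⟩ := (exists_unit hsat hab (𝓐.germ s x hs)).choose_spec
    change pair x _ (𝓐.el a) + pair x _ (𝓐.el b) =
      pair x _ (𝓐.el (𝓐.mul a c + (h ▸ 𝓐.mul b c : A (s * e))))
    have hg := (germ_eq_iff.mp h1).2.symm
    have hg' := hg.trans (germ_eq_iff.mp hp).2.symm
    have hv : val x (𝓐.el c) = 1 := by rw [val_el x he, hc]
    have hv0 : val x (𝓐.el c) ≠ 0 := by rw [hv]; exact one_ne_zero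
    rw [pair_el_add hab, el_cast, ← el_mul, ← el_mul, pair_mul_idem hab hg he hv0,
      pair_mul_idem hab hg' he hv0, hv, mul_one, mul_one]
  · intro s a b x hx
    refine (coordEquiv hsat hab _).injective ?_
    rw [hadd]
    exact (pair_el_add hab x _ a b).symm
  · intro c s a x hx
    refine (coordEquiv hsat hab _).injective ?_
    rw [hsmul]
    exact (pair_el_smul hab x _ c a).symm
  · intro s a x hx
    rw [hnorm, ← Complex.conj_mul', innerAt_eq, ← pair_of_eq hab x rfl]
    obtain ⟨hx', h1, h2⟩ := (exists_unit hsat hab (𝓐.germ s x hx)).choose_spec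
    have hg := (germ_eq_iff.mp h1).2.symm
    change (starRingEnd ℂ) (pair x _ (𝓐.el a)) * pair x _ (𝓐.el a) = _
    rw [← pair_symm hab, ← pair_mul_pair hab hg hg]
    exact (congrArg (· * _) h2).trans (one_mul _)

end

/-! ### Consequences of the description of the fibers -/

section

variable [BanachFibers 𝓐.proj] (H : 𝓐.HasCanonicalFibers)
  (hsat : 𝓐.IsSaturated) (hab : 𝓐.IsSemiAbelian)
include H

theorem norm_mkL_sq {g : 𝓐.Germ} (v : BundleFiber 𝓐.proj g) {p : 𝓐.Tot} {x : 𝓐.Spectrum}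
    {hx : x ∈ 𝓐.srcDom p.1} (hv : v.1 = mkL p x hx) :
    (‖v‖ : ℂ) ^ 2 = val x (star p * p) := by
  obtain ⟨v, rfl⟩ := v
  obtain rfl : v = mkL p x hx := hv
  exact (H.norm_fmk p.1 p.2 x hx).trans (innerAt_eq x p.2 p.2)

include hsat

/-- Both vectors are represented in one A_s, where the sum is the sum in A_s. Only the canonical
formulas for the fibers are used, not the unit vectors that built them. -/
theorem coordL_add {g : 𝓐.Germ} (v w : BundleFiber 𝓐.proj g) (u : 𝓐.Tot) :
    coordL hab u (v + w).1 = coordL hab u v.1 + coordL hab u w.1 := by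
  obtain ⟨s, x, hx, rfl⟩ := exists_germ g
  obtain ⟨v, hv⟩ := v
  obtain ⟨w, hw⟩ := w
  obtain ⟨a, rfl⟩ := exists_rep hsat hab hv
  obtain ⟨b, rfl⟩ := exists_rep hsat hab hw
  refine (congrArg (fun v : BundleFiber 𝓐.proj _ => coordL hab u v.1)
    (H.fmk_add s a b x hx)).trans ?_
  exact pair_el_add hab x u a b

theorem coordL_smul {g : 𝓐.Germ} (z : ℂ) (v : BundleFiber 𝓐.proj g) (u : 𝓐.Tot) :
    coordL hab u (z • v).1 = z * coordL hab u v.1 := by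
  obtain ⟨s, x, hx, rfl⟩ := exists_germ g
  obtain ⟨v, hv⟩ := v
  obtain ⟨a, rfl⟩ := exists_rep hsat hab hv
  refine (congrArg (fun v : BundleFiber 𝓐.proj _ => coordL hab u v.1)
    (H.smul_fmk z s a x hx)).trans ?_
  exact pair_el_smul hab x u z a

omit hsat in
-- The rank-one identity ⟨u, u⟩⟨p, p⟩ = ⟨p, u⟩⟨u, p⟩, read with ‖v‖² = ⟨p, p⟩.
theorem norm_sq_mul {u : 𝓐.Tot} {x : 𝓐.Spectrum} {hx : x ∈ 𝓐.srcDom u.1}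
    {g : 𝓐.Germ} (hg : g = 𝓐.germ u.1 x hx) (v : BundleFiber 𝓐.proj g) :
    pair x u u * (‖v‖ : ℂ) ^ 2 = (‖coordL hab u v.1‖ : ℂ) ^ 2 := by
  obtain ⟨p, y, hy, h⟩ := exists_mkL v.1
  have h1 : 𝓐.germ p.1 y hy = 𝓐.germ u.1 x hx := by
    rw [← proj_mkL, ← h, v.2, hg]
  obtain ⟨rfl, h2⟩ := germ_eq_iff.mp h1
  rw [norm_mkL_sq H v h, h, coordL_mkL, ← Complex.conj_mul', ← pair_symm hab,
    ← pair_mul_pair hab h2.symm h2.symm, pair_of_eq hab _ (p := p) rfl]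

end

end

end FellLine

/-! ### Banach bundles of lines -/

namespace LineBundle

open Filter Topology

section

variable {B E : Type*} {p : E → B} [BanachFibers p]

theorem norm_toFiber {b : B} (v : BundleFiber p b) : ‖toFiber p v.1‖ = ‖v‖ := by
  obtain ⟨v, rfl⟩ := v
  rfl

theorem smul_toFiber {b : B} (c : ℂ) (v : BundleFiber p b) :
    (c • toFiber p v.1).1 = (c • v).1 := by
  obtain ⟨v, rfl⟩ := v
  rfl

theorem add_toFiber {b : B} (v w : BundleFiber p b) (h : p v.1 = p w.1) :
    (⟨v.1, h⟩ + toFiber p w.1 : BundleFiber p (p w.1)).1 = (v + w).1 := by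
  obtain ⟨w, rfl⟩ := w
  rfl

variable [TopologicalSpace B]

theorem tendsto_add [TopologicalSpace E] (hE : IsUSCBanachBundle p) {α : Type*} {l : Filter α}
    {b : α → B} {b₀ : B} {f g : ∀ i, BundleFiber p (b i)} {v w : BundleFiber p b₀}
    (hf : Tendsto (fun i => (f i).1) l (𝓝 v.1)) (hg : Tendsto (fun i => (g i).1) l (𝓝 w.1)) :
    Tendsto (fun i => (f i + g i).1) l (𝓝 (v + w).1) := by
  have h := hE.continuous_add.tendsto ⟨(v.1, w.1), v.2.trans w.2.symm⟩
  have h2 : Tendsto (fun i => (⟨((f i).1, (g i).1), (f i).2.trans (g i).2.symm⟩ :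
      {q : E × E // p q.1 = p q.2})) l (𝓝 ⟨(v.1, w.1), v.2.trans w.2.symm⟩) :=
    tendsto_subtype_rng.mpr (hf.prodMk_nhds hg)
  have h3 := h.comp h2
  simp only [add_toFiber] at h3
  exact h3.congr fun i => add_toFiber (f i) (g i) _

theorem tendsto_smul_const [TopologicalSpace E] (hE : IsUSCBanachBundle p) {α : Type*}
    {l : Filter α} {b : α → B} {b₀ : B} (c : ℂ) {f : ∀ i, BundleFiber p (b i)}
    {v : BundleFiber p b₀} (hf : Tendsto (fun i => (f i).1) l (𝓝 v.1)) :
    Tendsto (fun i => (c • f i).1) l (𝓝 (c • v).1) := by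
  have h := ((hE.continuous_smul c).tendsto v.1).comp hf
  rw [smul_toFiber] at h
  exact h.congr fun i => smul_toFiber c (f i)

/-- In one direction w - σ(p w) tends to a zero vector, and upper semicontinuity makes its norm tend
to 0. In the other, the last bundle axiom makes the difference tend to the zero vector, and σ(p w)
is added back. -/
theorem tendsto_iff_norm_sub [TopologicalSpace E] (hE : IsUSCBanachBundle p) {U : Set B}
    {σ : ∀ b : U, BundleFiber p b.1} (hσ : Continuous fun b => (σ b).1) {v : E} (hv : p v ∈ U)
    (hσv : (σ ⟨p v, hv⟩).1 = v) {l : Filter {w : E // p w ∈ U}}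
    (hl : Tendsto (fun w => p w.1) l (𝓝 (p v))) :
    Tendsto (fun w => w.1) l (𝓝 v) ↔
      Tendsto (fun w => ‖toFiber p w.1 - σ ⟨p w.1, w.2⟩‖) l (𝓝 0) := by
  have h1 : Tendsto (fun w : {w : E // p w ∈ U} => (σ ⟨p w.1, w.2⟩).1) l
      (𝓝 (σ ⟨p v, hv⟩).1) :=
    (hσ.tendsto ⟨p v, hv⟩).comp (tendsto_subtype_rng.mpr hl)
  constructor
  · intro h
    have h2 := tendsto_smul_const hE (-1) h1
    have h3 : Tendsto (fun w : {w : E // p w ∈ U} => (toFiber p w.1).1) l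
      (𝓝 (σ ⟨p v, hv⟩).1) := by rw [hσv]; exact h
    have h4 := tendsto_add hE h3 h2
    simp only [neg_smul, one_smul, ← sub_eq_add_neg, sub_self] at h4
    rw [tendsto_order]
    refine ⟨fun a ha => Eventually.of_forall fun w => ha.trans_le (norm_nonneg _), fun a ha => ?_⟩
    have h5 := hE.upperSemicontinuous_norm (0 : BundleFiber p (p v)).1 a
      (lt_of_eq_of_lt ((norm_toFiber _).trans norm_zero) ha)
    refine (h4.eventually h5).mono fun w hw => ?_
    exact lt_of_eq_of_lt (norm_toFiber _).symm hw
  · intro h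
    have h2 : Tendsto (fun w : {w : E // p w ∈ U} => (toFiber p w.1 - σ ⟨p w.1, w.2⟩).1) l
        (𝓝 (0 : BundleFiber p (p v)).1) := by
      refine hE.le_nhds_zero (p v) (l.map _) ?_ ?_
      · exact tendsto_map'_iff.mpr (hl.congr fun w => (toFiber p w.1 - σ ⟨p w.1, w.2⟩).2.symm)
      · exact tendsto_map'_iff.mpr (h.congr fun w => (norm_toFiber _).symm)
    have h3 := tendsto_add hE h2 h1
    rw [zero_add, hσv] at h3
    exact h3.congr fun w => by rw [sub_add_cancel]; rfl

/-- The right side mentions only the base, the norm and σ, not the topology of the total space. This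
is the source of uniqueness. -/
theorem nhds_eq [TopologicalSpace E] (hE : IsUSCBanachBundle p) {U : Set B} (hU : IsOpen U)
    {σ : ∀ b : U, BundleFiber p b.1} (hσ : Continuous fun b => (σ b).1) {v : E} (hv : p v ∈ U)
    (hσv : (σ ⟨p v, hv⟩).1 = v) :
    𝓝 v = map Subtype.val (comap (fun w : {w : E // p w ∈ U} => p w.1) (𝓝 (p v)) ⊓
      comap (fun w : {w : E // p w ∈ U} => ‖toFiber p w.1 - σ ⟨p w.1, w.2⟩‖) (𝓝 0)) := by
  apply le_antisymm
  · have hp : Tendsto p (𝓝 v) (𝓝 (p v)) := hE.continuous_proj.tendsto v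
    have hW : Set.range (Subtype.val : {w : E // p w ∈ U} → E) ∈ 𝓝 v := by
      filter_upwards [hp (hU.mem_nhds hv)] with w hw using ⟨⟨w, hw⟩, rfl⟩
    rw [← map_comap_of_mem hW]
    have hl := hp.comp (tendsto_comap (f := (Subtype.val : {w : E // p w ∈ U} → E)))
    exact map_mono (le_inf (tendsto_iff_comap.mp hl) (tendsto_iff_comap.mp
      ((tendsto_iff_norm_sub hE hσ hv hσv hl).mp tendsto_comap)))
  · exact (tendsto_iff_norm_sub hE hσ hv hσv (tendsto_iff_comap.mpr inf_le_left)).mpr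
      (tendsto_iff_comap.mpr inf_le_right)

/-- The topology of an upper semicontinuous Banach bundle is determined by enough continuous
sections. -/
theorem topology_eq {τ₁ τ₂ : TopologicalSpace E} (h₁ : @IsUSCBanachBundle B E p _ τ₁ _)
    (h₂ : @IsUSCBanachBundle B E p _ τ₂ _)
    (hs : ∀ v : E, ∃ (U : Set B) (σ : ∀ b : U, BundleFiber p b.1) (hv : p v ∈ U),
      IsOpen U ∧ (σ ⟨p v, hv⟩).1 = v ∧ @Continuous U E _ τ₁ (fun b => (σ b).1) ∧
        @Continuous U E _ τ₂ (fun b => (σ b).1)) : τ₁ = τ₂ := by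
  refine TopologicalSpace.ext_nhds fun v => ?_
  obtain ⟨U, σ, hv, hU, hσv, hσ₁, hσ₂⟩ := hs v
  exact (@nhds_eq B E p _ _ τ₁ h₁ U hU σ hσ₁ v hv hσv).trans
    (@nhds_eq B E p _ _ τ₂ h₂ U hU σ hσ₂ v hv hσv).symm

variable (p) in
/-- Compatible fiberwise linear coordinates on a bundle of lines. -/
structure LineCharts (ι : Type*) where
  base : ι → Set B
  isOpen_base : ∀ i, IsOpen (base i)
  exists_mem_base : ∀ b, ∃ i, b ∈ base i
  coord : ι → E → ℂ
  coord_add : ∀ i b (v w : BundleFiber p b), coord i (v + w).1 = coord i v.1 + coord i w.1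
  coord_smul : ∀ i b (c : ℂ) (v : BundleFiber p b), coord i (c • v).1 = c * coord i v.1
  sec : ι → ∀ b : B, BundleFiber p b
  coord_sec : ∀ i b, b ∈ base i → coord i (sec i b).1 = 1
  weight : ι → B → ℝ
  weight_pos : ∀ i b, b ∈ base i → 0 < weight i b
  continuousOn_weight : ∀ i, ContinuousOn (weight i) (base i)
  norm_eq : ∀ i b (v : BundleFiber p b), b ∈ base i → ‖v‖ = weight i b * ‖coord i v.1‖
  trans : ι → ι → B → ℂ
  continuousOn_trans : ∀ i j, ContinuousOn (trans i j) (base i ∩ base j)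
  coord_eq : ∀ i j b (v : BundleFiber p b), b ∈ base i → b ∈ base j →
    coord j v.1 = trans i j b * coord i v.1

/-! ### The bundle topology defined by linear charts -/

namespace LineCharts

variable {ι : Type*} (C : LineCharts p ι)

/-- The topology of the total space defined by the charts. -/
@[reducible] noncomputable def topology : TopologicalSpace E :=
  ⨆ i, TopologicalSpace.coinduced
    (fun q : C.base i × ℂ => (q.2 • C.sec i q.1.1).1) inferInstance

theorem ext_coord {i : ι} {b : B} (hb : b ∈ C.base i) {v w : BundleFiber p b}
    (h : C.coord i v.1 = C.coord i w.1) : v = w := by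
  rw [← sub_eq_zero, ← norm_eq_zero, C.norm_eq i b _ hb]
  have : C.coord i (v - w).1 = 0 := by
    have := C.coord_add i b v ((-1 : ℂ) • w)
    rw [C.coord_smul, neg_one_smul, ← sub_eq_add_neg] at this
    rw [this, h]
    ring
  rw [this, norm_zero, mul_zero]

theorem coord_smul_sec {i : ι} {b : B} (hb : b ∈ C.base i) (z : ℂ) :
    C.coord i (z • C.sec i b).1 = z := by
  rw [C.coord_smul, C.coord_sec i b hb, mul_one]

theorem coord_smul_sec_self {i : ι} {v : E} (hv : p v ∈ C.base i) :
    (C.coord i v • C.sec i (p v)).1 = v :=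
  congrArg Subtype.val (C.ext_coord hv (v := C.coord i v • C.sec i (p v)) (w := toFiber p v)
    (C.coord_smul_sec hv _))

theorem coord_zero (i : ι) (b : B) : C.coord i (0 : BundleFiber p b).1 = 0 := by
  have := C.coord_smul i b 0 0
  rwa [zero_smul, zero_mul] at this

theorem isOpen_iff {O : Set E} : IsOpen[C.topology] O ↔
    ∀ i, IsOpen {q : C.base i × ℂ | (q.2 • C.sec i q.1.1).1 ∈ O} := by
  unfold topology
  rw [isOpen_iSup_iff]
  exact forall_congr' fun i => isOpen_coinduced

theorem continuous_proj : @Continuous E B C.topology _ p := by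
  refine (@continuous_def E B C.topology _ p).mpr fun V hV => C.isOpen_iff.mpr fun i => ?_
  have : {q : C.base i × ℂ | (q.2 • C.sec i q.1.1).1 ∈ p ⁻¹' V} =
      (fun q : C.base i × ℂ => q.1.1) ⁻¹' V := by
    ext q
    have := (q.2 • C.sec i q.1.1).2
    simp only [Set.mem_ofPred_eq, Set.mem_preimage, this]
  rw [this]
  exact hV.preimage (continuous_subtype_val.comp continuous_fst)

/-- Seen in another chart j, the coordinate i is multiplication by the continuous transition
function, so the set is open there. -/
theorem isOpen_coord_preimage (i : ι) {V : Set ℂ} (hV : IsOpen V) :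
    IsOpen[C.topology] (p ⁻¹' C.base i ∩ C.coord i ⁻¹' V) := by
  refine C.isOpen_iff.mpr fun j => ?_
  have : {q : C.base j × ℂ | (q.2 • C.sec j q.1.1).1 ∈ p ⁻¹' C.base i ∩ C.coord i ⁻¹' V} =
      {q | q.1.1 ∈ C.base i} ∩ (fun q : C.base j × ℂ => C.trans j i q.1.1 * q.2) ⁻¹' V := by
    ext q
    have h1 := (q.2 • C.sec j q.1.1).2
    simp only [Set.mem_ofPred_eq, Set.mem_preimage, Set.mem_inter_iff, h1]
    refine and_congr_right fun h => ?_
    rw [C.coord_eq j i q.1.1 _ q.1.2 h, C.coord_smul_sec q.1.2]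
  rw [this]
  have hf : Continuous fun q : C.base j × ℂ => q.1.1 :=
    continuous_subtype_val.comp continuous_fst
  refine ContinuousOn.isOpen_inter_preimage ?_ ((C.isOpen_base i).preimage hf) hV
  refine ContinuousOn.mul ?_ continuous_snd.continuousOn
  exact (C.continuousOn_trans j i).comp hf.continuousOn fun q hq => ⟨q.1.2, hq⟩

/-- The local trivializations defined by the charts. -/
noncomputable def triv (i : ι) : @Bundle.Trivialization B ℂ E _ _ C.topology p :=
  letI := C.topology
  { toFun := fun v => (p v, C.coord i v)
    invFun := fun q => (q.2 • C.sec i q.1).1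
    source := p ⁻¹' C.base i
    target := C.base i ×ˢ Set.univ
    map_source' := fun v hv => ⟨hv, Set.mem_univ _⟩
    map_target' := fun q hq => by
      have := (q.2 • C.sec i q.1).2
      rw [Set.mem_preimage, this]
      exact hq.1
    left_inv' := fun v hv => C.coord_smul_sec_self hv
    right_inv' := fun q hq => Prod.ext (q.2 • C.sec i q.1).2 (C.coord_smul_sec hq.1 _)
    open_source := (C.isOpen_base i).preimage C.continuous_proj
    open_target := (C.isOpen_base i).prod isOpen_univ
    continuousOn_toFun := by
      refine C.continuous_proj.continuousOn.prodMk ?_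
      rw [continuousOn_open_iff ((C.isOpen_base i).preimage C.continuous_proj)]
      exact fun V hV => C.isOpen_coord_preimage i hV
    continuousOn_invFun := by
      rw [continuousOn_iff_continuous_domRestrict]
      have h1 : Continuous fun q : C.base i × ℂ => (q.2 • C.sec i q.1.1).1 :=
        continuous_iSup_rng (i := i) continuous_coinduced_rng
      have h2 : Continuous fun q : (C.base i ×ˢ (Set.univ : Set ℂ) : Set (B × ℂ)) =>
          ((⟨q.1.1, q.2.1⟩, q.1.2) : C.base i × ℂ) := by fun_prop
      exact h1.comp h2
    baseSet := C.base i
    open_baseSet := C.isOpen_base i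
    source_eq := rfl
    target_eq := rfl
    proj_toFun := fun _ _ => rfl }

/-- The chart around v is an open partial homeomorphism onto a product. All continuity statements
for the line bundle reduce to this criterion. -/
theorem tendsto_iff {α : Type*} {l : Filter α} {f : α → E} {i : ι} {v : E}
    (hv : p v ∈ C.base i) : Tendsto f l (@nhds E C.topology v) ↔
      Tendsto (fun a => p (f a)) l (𝓝 (p v)) ∧
        Tendsto (fun a => C.coord i (f a)) l (𝓝 (C.coord i v)) := by
  let _ := C.topology
  constructor
  · intro h
    refine ⟨(C.continuous_proj.tendsto v).comp h, ?_⟩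
    have h1 : ContinuousAt (C.triv i).toFun' v :=
      (C.triv i).toOpenPartialHomeomorph.continuousAt hv
    exact (Tendsto.comp (continuous_snd.tendsto _) h1).comp h
  · rintro ⟨h1, h2⟩
    have h3 : 𝓝 v = comap (C.triv i).toFun' (𝓝 (p v, C.coord i v)) ⊓ 𝓟 (p ⁻¹' C.base i) :=
      (C.triv i).toOpenPartialHomeomorph.nhds_eq_comap_inf_principal hv
    rw [h3, tendsto_inf, tendsto_comap_iff, tendsto_principal]
    exact ⟨h1.prodMk_nhds h2, h1 ((C.isOpen_base i).mem_nhds hv)⟩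

theorem continuous_norm :
    @Continuous E ℝ C.topology _ fun v => ‖toFiber p v‖ := by
  let _ := C.topology
  refine continuous_iff_continuousAt.mpr fun v => ?_
  obtain ⟨i, hi⟩ := C.exists_mem_base (p v)
  obtain ⟨h1, h2⟩ := (C.tendsto_iff hi).mp (tendsto_id (x := 𝓝 v))
  have h3 : Tendsto (C.weight i) (𝓝 (p v)) (𝓝 (C.weight i (p v))) :=
    (C.continuousOn_weight i).continuousAt ((C.isOpen_base i).mem_nhds hi)
  have h4 := (h3.comp h1).mul h2.norm
  have h5 : Tendsto (fun w => C.weight i (p w) * ‖C.coord i w‖) (𝓝 v) (𝓝 ‖toFiber p v‖) := by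
    rw [C.norm_eq i (p v) (toFiber p v) hi]
    exact h4
  refine h5.congr' ?_
  filter_upwards [h1 ((C.isOpen_base i).mem_nhds hi)] with w hw
  exact (C.norm_eq i _ (toFiber p w) hw).symm

theorem continuous_smul :
    let _ := C.topology
    Continuous fun q : ℂ × E => ((q.1 • toFiber p q.2).1 : E) := by
  let _ := C.topology
  refine continuous_iff_continuousAt.mpr fun q => ?_
  obtain ⟨i, hi⟩ := C.exists_mem_base (p q.2)
  obtain ⟨h1, h2⟩ := (C.tendsto_iff hi).mp (continuous_snd.tendsto q)
  have hp : ∀ q : ℂ × E, p (q.1 • toFiber p q.2).1 = p q.2 := fun q => (q.1 • toFiber p q.2).2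
  refine (C.tendsto_iff (i := i) (by rwa [hp])).mpr ⟨?_, ?_⟩
  · rw [hp]
    exact h1.congr fun q => (hp q).symm
  · rw [C.coord_smul]
    exact ((continuous_fst.tendsto q).mul h2).congr fun q => (C.coord_smul i _ _ _).symm

theorem isUSCBanachBundle : @IsUSCBanachBundle B E p _ C.topology _ := by
  let _ := C.topology
  refine ⟨C.continuous_proj, ?_, ?_, C.continuous_norm.upperSemicontinuous, ?_, ?_, ?_⟩
  · refine IsOpenMap.of_nhds_le fun v => ?_
    obtain ⟨i, hi⟩ := C.exists_mem_base (p v)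
    exact ((C.triv i).map_proj_nhds hi).ge
  · exact fun b => ⟨(0 : BundleFiber p b).1, (0 : BundleFiber p b).2⟩
  · refine continuous_iff_continuousAt.mpr ?_
    rintro ⟨⟨v, w⟩, hvw⟩
    obtain ⟨i, hi⟩ := C.exists_mem_base (p w)
    have hv := (continuous_fst.comp continuous_subtype_val).tendsto
      (⟨(v, w), hvw⟩ : {q : E × E // p q.1 = p q.2})
    have hw := (continuous_snd.comp continuous_subtype_val).tendsto
      (⟨(v, w), hvw⟩ : {q : E × E // p q.1 = p q.2})
    have hi' : p v ∈ C.base i := by rw [show p v = p w from hvw]; exact hi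
    obtain ⟨-, h2⟩ := (C.tendsto_iff hi').mp hv
    obtain ⟨h1, h3⟩ := (C.tendsto_iff hi).mp hw
    have hp : ∀ q : {q : E × E // p q.1 = p q.2},
      p (⟨q.1.1, q.2⟩ + toFiber p q.1.2 : BundleFiber p (p q.1.2)).1 = p q.1.2 :=
      fun q => (⟨q.1.1, q.2⟩ + toFiber p q.1.2 : BundleFiber p (p q.1.2)).2
    refine (C.tendsto_iff (i := i) (by rw [hp]; exact hi)).mpr ⟨?_, ?_⟩
    · rw [hp]
      exact h1.congr fun q => (hp q).symm
    · refine (congrArg (Tendsto _ _ <| 𝓝 ·)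
        (C.coord_add i _ (⟨v, hvw⟩ : BundleFiber p (p w)) (toFiber p w))).mpr ?_
      exact (h2.add h3).congr fun q => (C.coord_add i _ _ _).symm
  · exact fun c => C.continuous_smul.comp (Continuous.prodMk_right c)
  · intro b l h1 h2
    obtain ⟨i, hi⟩ := C.exists_mem_base b
    have hb : p (0 : BundleFiber p b).1 = b := (0 : BundleFiber p b).2
    refine (C.tendsto_iff (f := id) (i := i) (by rwa [hb])).mpr ⟨by rw [hb]; exact h1, ?_⟩
    rw [C.coord_zero]
    have h3 : Tendsto (C.weight i) (𝓝 b) (𝓝 (C.weight i b)) :=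
      (C.continuousOn_weight i).continuousAt ((C.isOpen_base i).mem_nhds hi)
    -- The modulus of the coordinate is the norm divided by the weight, and the weight has a
    -- positive limit.
    have h4 := h2.div (h3.comp h1) (C.weight_pos i b hi).ne'
    rw [zero_div] at h4
    refine tendsto_zero_iff_norm_tendsto_zero.mpr (h4.congr' ?_)
    filter_upwards [h1 ((C.isOpen_base i).mem_nhds hi)] with w hw
    simp only [Function.comp, Pi.div_apply]
    rw [C.norm_eq i _ (toFiber p w) hw, mul_div_cancel_left₀ _ (C.weight_pos i _ hw).ne']
    rfl

theorem isLocallyTrivialLine : @IsLocallyTrivialLine B E p _ C.topology _ := by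
  let _ := C.topology
  intro b
  obtain ⟨i, hi⟩ := C.exists_mem_base b
  exact ⟨C.triv i, hi, fun b' _ => ⟨fun v w => C.coord_add i b' v w,
    fun c v => C.coord_smul i b' c v⟩⟩

/-- The trivializations make the total space locally homeomorphic to B × ℂ. -/
theorem locallyCompactSpace [LocallyCompactSpace B] :
    @LocallyCompactSpace E C.topology := by
  let _ := C.topology
  let _ : ChartedSpace (B × ℂ) E :=
    { atlas := Set.univ
      chartAt := fun v => (C.triv (C.exists_mem_base (p v)).choose).toOpenPartialHomeomorph
      mem_chart_source := fun v => (C.exists_mem_base (p v)).choose_spec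
      chart_mem_atlas := fun _ => Set.mem_univ _ }
  exact ChartedSpace.locallyCompactSpace (B × ℂ) E

include C in
theorem finrank_fiber (b : B) : Module.finrank ℂ (BundleFiber p b) = 1 := by
  obtain ⟨i, hi⟩ := C.exists_mem_base b
  refine finrank_eq_one (C.sec i b) ?_ fun w => ⟨C.coord i w.1, ?_⟩
  · intro h
    have := C.coord_sec i b hi
    rw [h, C.coord_zero] at this
    exact zero_ne_one this
  · exact C.ext_coord hi (C.coord_smul_sec hi _)

end LineCharts

end

end LineBundle

namespace FellLine

open Filter Topology LineBundle

section

variable {S : Type*} [InverseSemigroup S] {A : S → Type*}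
  [∀ s, NormedAddCommGroup (A s)] [∀ s, NormedSpace ℂ (A s)] [∀ s, CompleteSpace (A s)]
  {𝓐 : FellBundle S A}

/-! ### The topology of the line bundle -/

/-- The set of germs over which `u` defines a nonzero section. -/
def chartBase (u : 𝓐.Tot) : Set 𝓐.Germ :=
  {g | ∃ hx : 𝓐.germSrc g ∈ 𝓐.srcDom u.1,
    g = 𝓐.germ u.1 (𝓐.germSrc g) hx ∧ pair (𝓐.germSrc g) u u ≠ 0}

theorem germ_mem_chartBase {u : 𝓐.Tot} {x : 𝓐.Spectrum} {hx : x ∈ 𝓐.srcDom u.1}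
    (h : pair x u u ≠ 0) : 𝓐.germ u.1 x hx ∈ chartBase u := ⟨hx, rfl, h⟩

theorem sameGerm_of_mem {u w : 𝓐.Tot} {g : 𝓐.Germ} (h : g ∈ chartBase u)
    (h' : g ∈ chartBase w) : SameGerm (𝓐.germSrc g) u.1 w.1 := by
  obtain ⟨hx, h1, h2⟩ := h
  obtain ⟨hy, h3, h4⟩ := h'
  exact (germ_eq_iff.mp (h1.symm.trans h3)).2

theorem isOpen_chartBase (hab : 𝓐.IsSemiAbelian) (u : 𝓐.Tot) : IsOpen (chartBase u) := by
  have : chartBase u = 𝓐.germSet u.1 (𝓐.srcDom u.1) ∩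
      𝓐.germSrc ⁻¹' {x | val x (star u * u) ≠ 0} := by
    ext g
    constructor
    · rintro ⟨hx, h1, h2⟩
      refine ⟨mem_germSet_iff.mpr ⟨hx, h1⟩, ?_⟩
      rwa [pair_of_eq hab _ rfl] at h2
    · rintro ⟨h, h2⟩
      obtain ⟨hx, h1⟩ := mem_germSet_iff.mp h
      refine ⟨hx, h1, ?_⟩
      rwa [pair_of_eq hab _ rfl]
  rw [this]
  exact (isOpen_germSet_srcDom _).inter
    ((isOpen_ne_fun (continuous_val _) continuous_const).preimage continuous_germSrc)

theorem continuousAt_pair_germSrc (hab : 𝓐.IsSemiAbelian) {g : 𝓐.Germ} {p q : 𝓐.Tot}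
    (h : SameGerm (𝓐.germSrc g) p.1 q.1) :
    ContinuousAt (fun g => pair (𝓐.germSrc g) p q) g :=
  ContinuousAt.comp (f := 𝓐.germSrc) (g := fun x => pair x p q) (continuousAt_pair hab h)
    continuous_germSrc.continuousAt

theorem proj_hat {s : S} (a : A s) (g : 𝓐.germSet s (𝓐.srcDom s)) :
    𝓐.proj (𝓐.hat a g) = g.1 := by
  obtain ⟨g, x, hx, _, rfl⟩ := g
  rfl

theorem locallyCompactSpace_germ (𝓐 : FellBundle S A) : LocallyCompactSpace 𝓐.Germ := by
  let _ : ChartedSpace 𝓐.Spectrum 𝓐.Germ :=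
    { atlas := Set.univ
      chartAt := fun g => (isLocalHomeomorph_germSrc g).choose
      mem_chart_source := fun g => (isLocalHomeomorph_germSrc g).choose_spec.1
      chart_mem_atlas := fun _ => Set.mem_univ _ }
  exact ChartedSpace.locallyCompactSpace 𝓐.Spectrum 𝓐.Germ

section

variable [BanachFibers 𝓐.proj] (H : 𝓐.HasCanonicalFibers)
  (hsat : 𝓐.IsSaturated) (hab : 𝓐.IsSemiAbelian)

open Classical in
/-- The section over `chartBase u` with coordinate `1` with respect to `u`. -/
noncomputable def secL (u : 𝓐.Tot) (g : 𝓐.Germ) : BundleFiber 𝓐.proj g :=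
  if h : g ∈ chartBase u then
    (pair (𝓐.germSrc g) u u)⁻¹ • ⟨mkL u (𝓐.germSrc g) h.choose, h.choose_spec.1.symm⟩
  else 0

include H in
theorem norm_eq_coordL {u : 𝓐.Tot} {g : 𝓐.Germ} (hg : g ∈ chartBase u)
    (v : BundleFiber 𝓐.proj g) :
    ‖v‖ = (√‖pair (𝓐.germSrc g) u u‖)⁻¹ * ‖coordL hab u v.1‖ := by
  obtain ⟨hx, h1, h2⟩ := hg
  have h3 := congrArg norm (norm_sq_mul H hab h1 v)
  rw [norm_mul, norm_pow, norm_pow, Complex.norm_real, Complex.norm_real, norm_norm,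
    norm_norm] at h3
  have h4 := congrArg Real.sqrt h3
  rw [Real.sqrt_mul (norm_nonneg _), Real.sqrt_sq (norm_nonneg _),
    Real.sqrt_sq (norm_nonneg _)] at h4
  rw [← h4, inv_mul_cancel_left₀]
  exact (Real.sqrt_pos.mpr (norm_pos_iff.mpr h2)).ne'

/-- The coordinates `coordL u` as charts of the line bundle. -/
noncomputable def lineCharts : LineCharts 𝓐.proj 𝓐.Tot where
  base := chartBase
  isOpen_base := isOpen_chartBase hab
  exists_mem_base g := by
    obtain ⟨u, hx, h1, h2⟩ := exists_unit hsat hab g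
    exact ⟨u, hx, h1, by rw [h2]; exact one_ne_zero⟩
  coord u := coordL hab u
  coord_add u _ v w := coordL_add H hsat hab v w u
  coord_smul u _ z v := coordL_smul H hsat hab z v u
  sec := secL
  coord_sec u g hg := by
    unfold secL
    rw [dif_pos hg]
    exact (coordL_smul H hsat hab _ _ u).trans (inv_mul_cancel₀ hg.choose_spec.2)
  weight u g := (√‖pair (𝓐.germSrc g) u u‖)⁻¹
  weight_pos u g hg := inv_pos.mpr (Real.sqrt_pos.mpr (norm_pos_iff.mpr hg.choose_spec.2))
  continuousOn_weight u g hg := by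
    refine ContinuousAt.continuousWithinAt (ContinuousAt.inv₀ ?_ ?_)
    · exact (continuousAt_pair_germSrc hab (SameGerm.refl _ _)).norm.sqrt
    · exact (Real.sqrt_pos.mpr (norm_pos_iff.mpr hg.choose_spec.2)).ne'
  norm_eq u g v hg := norm_eq_coordL H hab hg v
  -- This quotient comes from the rank-one identity ⟨u, u⟩⟨w, p⟩ = ⟨w, u⟩⟨u, p⟩.
  trans u w g := pair (𝓐.germSrc g) w u / pair (𝓐.germSrc g) u u
  continuousOn_trans u w g hg := by
    refine ContinuousAt.continuousWithinAt (ContinuousAt.div ?_ ?_ hg.1.choose_spec.2)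
    · exact continuousAt_pair_germSrc hab (sameGerm_of_mem hg.2 hg.1)
    · exact continuousAt_pair_germSrc hab (SameGerm.refl _ _)
  coord_eq u w g v hu hw := by
    have h1 := sameGerm_of_mem hu hw
    obtain ⟨hx, h2, h3⟩ := hu
    obtain ⟨p, y, hy, hp⟩ := exists_mkL v.1
    have h4 : 𝓐.germ p.1 y hy = 𝓐.germ u.1 (𝓐.germSrc g) hx := by
      rw [← proj_mkL, ← hp, v.2, ← h2]
    obtain ⟨rfl, h5⟩ := germ_eq_iff.mp h4
    rw [hp, coordL_mkL, coordL_mkL, div_mul_eq_mul_div, eq_div_iff h3,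
      ← pair_mul_pair hab h1 h5.symm, mul_comm]

/-- The topology of the line bundle. -/
@[reducible] noncomputable def topologyL : TopologicalSpace 𝓐.L :=
  (lineCharts H hsat hab).topology

theorem tendsto_L_iff {α : Type*} {l : Filter α} {f : α → 𝓐.L} {u : 𝓐.Tot} {v : 𝓐.L}
    (hv : 𝓐.proj v ∈ chartBase u) :
    Tendsto f l (@nhds 𝓐.L (topologyL H hsat hab) v) ↔
      Tendsto (fun a => 𝓐.proj (f a)) l (𝓝 (𝓐.proj v)) ∧
        Tendsto (fun a => coordL hab u (f a)) l (𝓝 (coordL hab u v)) :=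
  (lineCharts H hsat hab).tendsto_iff hv

theorem continuous_hat {s : S} (a : A s) :
    @Continuous _ _ _ (topologyL H hsat hab) (𝓐.hat a) := by
  let _ := topologyL H hsat hab
  refine continuous_iff_continuousAt.mpr ?_
  rintro ⟨_, x, hx, hx', rfl⟩
  obtain ⟨u, rfl, hu⟩ := exists_pair_self_eq_one hsat hab hx
  refine (tendsto_L_iff H hsat hab (u := u) ?_).mpr ⟨?_, ?_⟩
  · exact germ_mem_chartBase (x := x) (hx := hx) (by rw [hu]; exact one_ne_zero)
  · simp only [proj_hat]
    exact continuous_subtype_val.continuousAt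
  · exact ContinuousAt.comp (g := fun g => pair (𝓐.germSrc g) u (𝓐.el a))
      (continuousAt_pair_germSrc hab (SameGerm.refl _ _)) continuous_subtype_val.continuousAt

theorem isBundleTopology_topologyL : 𝓐.IsBundleTopology (topologyL H hsat hab) :=
  ⟨(lineCharts H hsat hab).isUSCBanachBundle, fun _ a => continuous_hat H hsat hab a⟩

/-- Through every point of L passes a section â, continuous for both topologies, so `topology_eq`
applies. -/
theorem eq_topologyL {τ : TopologicalSpace 𝓐.L} (hτ : 𝓐.IsBundleTopology τ) :
    τ = topologyL H hsat hab := by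
  refine topology_eq hτ.1 (isBundleTopology_topologyL H hsat hab).1 fun v => ?_
  obtain ⟨p, x, hx, rfl⟩ := exists_mkL v
  exact ⟨𝓐.germSet p.1 (𝓐.srcDom p.1), fun g => ⟨𝓐.hat p.2 g, proj_hat p.2 g⟩,
    germ_mem_germSet hx, isOpen_germSet_srcDom _, rfl, hτ.2 _ _, continuous_hat H hsat hab _⟩

end

end

end FellLine

namespace FellLine

open Filter Topology LineBundle

section

variable {S : Type*} [InverseSemigroup S] {A : S → Type*}
  [∀ s, NormedAddCommGroup (A s)] [∀ s, NormedSpace ℂ (A s)] [∀ s, CompleteSpace (A s)]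
  {𝓐 : FellBundle S A}

/-! ### Multiplication and involution on the line bundle -/

theorem mkL_congr {p q : 𝓐.Tot} {x y : 𝓐.Spectrum} {hx : x ∈ 𝓐.srcDom p.1}
    {hy : y ∈ 𝓐.srcDom q.1} (h : p = q) (h' : x = y) : mkL p x hx = mkL q y hy := by
  subst h h'
  rfl

theorem mkL_out (v : 𝓐.L) :
    mkL (tripEl (Quot.out v)) (Quot.out v).x (Quot.out v).mem = v := Quot.out_eq v

section

variable (hsat : 𝓐.IsSaturated) (hab : 𝓐.IsSemiAbelian)

/-- For unit vectors u and w at the two factors, u w is a unit vector for the product, and by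
`pair_mul` the coordinate of a product with respect to u w is the product of the coordinates. -/
theorem mkL_mul_eq {p p' q q' : 𝓐.Tot} {x x' y y' : 𝓐.Spectrum} {hx : x ∈ 𝓐.srcDom p.1}
    {hx' : x' ∈ 𝓐.srcDom p'.1} {hy : y ∈ 𝓐.srcDom q.1} {hy' : y' ∈ 𝓐.srcDom q'.1}
    (h : mkL p x hx = mkL p' x' hx') (h' : mkL q y hy = mkL q' y' hy')
    (c : x = theta hsat hab q.1 y) {hpq : y ∈ 𝓐.srcDom (p * q).1}
    {hpq' : y' ∈ 𝓐.srcDom (p' * q').1} :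
    mkL (p * q) y hpq = mkL (p' * q') y' hpq' := by
  obtain ⟨h1, h2⟩ : x = x' ∧ SameGerm x p.1 p'.1 := germ_eq_iff.mp (congrArg 𝓐.proj h)
  obtain ⟨h3, h4⟩ : y = y' ∧ SameGerm y q.1 q'.1 := germ_eq_iff.mp (congrArg 𝓐.proj h')
  obtain ⟨u, hu, hu1⟩ := exists_pair_self_eq_one hsat hab hx
  obtain ⟨w, hw, hw1⟩ := exists_pair_self_eq_one hsat hab hy
  have h5 : pair x u p = pair x u p' := by
    have := congrArg (coordL hab u) h
    rwa [coordL_mkL, coordL_mkL, ← h1] at this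
  have h6 : pair y w q = pair y w q' := by
    have := congrArg (coordL hab w) h'
    rwa [coordL_mkL, coordL_mkL, ← h3] at this
  have hwq : theta hsat hab w.1 y = x := by rw [hw, c]
  have hyw : y ∈ 𝓐.srcDom w.1 := by rw [hw]; exact hy
  have hup : SameGerm (theta hsat hab w.1 y) u.1 p.1 := by rw [hu]; exact SameGerm.refl _ _
  have hwq' : SameGerm y w.1 q.1 := by rw [hw]; exact SameGerm.refl _ _
  have h2' : SameGerm (theta hsat hab w.1 y) p.1 p'.1 := by rw [hwq]; exact h2
  refine mkL_eq hab (u := u * w) h3 (SameGerm.mul hsat hab hy (c ▸ h2) h4)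
    (SameGerm.mul hsat hab hyw hup hwq') ?_ ?_
  · rw [pair_mul hsat hab hyw (SameGerm.refl _ _) (SameGerm.refl _ _), hwq, hu1, hw1, one_mul]
    exact one_ne_zero
  · rw [pair_mul hsat hab hyw hup hwq', pair_mul hsat hab hyw (hup.trans h2') (hwq'.trans h4),
      hwq, h5, h6]

/-- The product of two elements of the line bundle over composable germs. -/
noncomputable def mulL (v w : 𝓐.L) (c : 𝓐.germSrc (𝓐.proj v) = grng hsat hab (𝓐.proj w)) :
    𝓐.L :=
  mkL (tripEl (Quot.out v) * tripEl (Quot.out w)) (Quot.out w).x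
    (mem_srcDom_of_composable hsat hab (Quot.out v).mem (Quot.out w).mem (by
      rw [← mkL_out v, ← mkL_out w] at c; exact c))

theorem mulL_mkL {p q : 𝓐.Tot} {x y : 𝓐.Spectrum} {hx : x ∈ 𝓐.srcDom p.1}
    {hy : y ∈ 𝓐.srcDom q.1} (c : x = theta hsat hab q.1 y) :
    mulL hsat hab (mkL p x hx) (mkL q y hy) c =
      mkL (p * q) y (mem_srcDom_of_composable hsat hab hx hy c) :=
  (mkL_mul_eq hsat hab (mkL_out (mkL p x hx)).symm (mkL_out (mkL q y hy)).symm c).symm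

theorem mulL_eq {v w : 𝓐.L} {p q : 𝓐.Tot} {x y : 𝓐.Spectrum} {hx : x ∈ 𝓐.srcDom p.1}
    {hy : y ∈ 𝓐.srcDom q.1} (hv : v = mkL p x hx) (hw : w = mkL q y hy)
    (c : 𝓐.germSrc (𝓐.proj v) = grng hsat hab (𝓐.proj w)) :
    ∃ h, mulL hsat hab v w c = mkL (p * q) y h := by
  subst hv hw
  exact ⟨_, mulL_mkL hsat hab (x := x) (y := y) c⟩

theorem proj_mulL (v w : 𝓐.L) (c : 𝓐.germSrc (𝓐.proj v) = grng hsat hab (𝓐.proj w)) :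
    𝓐.proj (mulL hsat hab v w c) = gmul hsat hab (𝓐.proj v) (𝓐.proj w) c := by
  obtain ⟨p, x, hx, rfl⟩ := exists_mkL v
  obtain ⟨q, y, hy, rfl⟩ := exists_mkL w
  obtain ⟨h, e⟩ := mulL_eq hsat hab rfl rfl c
  rw [e]
  exact (gmul_germ hsat hab hx hy c).symm

/-- Bilinearity and continuity of the multiplication are deduced from this multiplicativity of
coordinates. -/
theorem coordL_mulL {v w : 𝓐.L} (c : 𝓐.germSrc (𝓐.proj v) = grng hsat hab (𝓐.proj w))
    {p q : 𝓐.Tot} {x y : 𝓐.Spectrum} {hx : x ∈ 𝓐.srcDom p.1} {hy : y ∈ 𝓐.srcDom q.1}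
    (hv : 𝓐.proj v = 𝓐.germ p.1 x hx) (hw : 𝓐.proj w = 𝓐.germ q.1 y hy) :
    coordL hab (p * q) (mulL hsat hab v w c) = coordL hab p v * coordL hab q w := by
  obtain ⟨p', x', hx', rfl⟩ := exists_mkL v
  obtain ⟨q', y', hy', rfl⟩ := exists_mkL w
  obtain ⟨rfl, h1⟩ := germ_eq_iff.mp hv
  obtain ⟨rfl, h2⟩ := germ_eq_iff.mp hw
  have hθ : theta hsat hab q.1 y' = x' := (SameGerm.theta_eq hsat hab hy hy' h2.symm).trans c.symm
  have h1' : SameGerm (theta hsat hab q.1 y') p.1 p'.1 := by rw [hθ]; exact h1.symm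
  obtain ⟨h, e⟩ := mulL_eq hsat hab rfl rfl c
  rw [e, coordL_mkL, coordL_mkL, coordL_mkL,
    pair_mul hsat hab hy h1' h2.symm, hθ]

theorem mkL_star_eq {p q : 𝓐.Tot} {x y : 𝓐.Spectrum} {hx : x ∈ 𝓐.srcDom p.1}
    {hy : y ∈ 𝓐.srcDom q.1} (h : mkL p x hx = mkL q y hy)
    {hp : theta hsat hab p.1 x ∈ 𝓐.srcDom (star p).1}
    {hq : theta hsat hab q.1 y ∈ 𝓐.srcDom (star q).1} :
    mkL (star p) _ hp = mkL (star q) _ hq := by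
  obtain ⟨rfl, h2⟩ := germ_eq_iff.mp (congrArg 𝓐.proj h)
  obtain ⟨u, hu, hu1⟩ := exists_pair_self_eq_one hsat hab hx
  have h5 : pair x u p = pair x u q := congrArg (coordL hab u) h
  have hxu : x ∈ 𝓐.srcDom u.1 := by rw [hu]; exact hx
  have hup : SameGerm x u.1 p.1 := by rw [hu]; exact SameGerm.refl _ _
  have hθ : theta hsat hab p.1 x = theta hsat hab u.1 x := by rw [hu]
  refine mkL_eq hab (u := star u) (SameGerm.theta_eq hsat hab hx hy h2)
    (SameGerm.inv hsat hab hx h2) (hθ ▸ SameGerm.inv hsat hab hxu hup) ?_ ?_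
  · rw [hθ, pair_star hsat hab hxu (SameGerm.refl _ _), hu1]
    exact one_ne_zero
  · rw [hθ, pair_star hsat hab hxu hup, pair_star hsat hab hxu (hup.trans h2),
      pair_symm hab x u p, pair_symm hab x u q, h5]

/-- The involution of the line bundle. -/
noncomputable def starL (v : 𝓐.L) : 𝓐.L :=
  mkL (star (tripEl (Quot.out v))) (theta hsat hab (tripEl (Quot.out v)).1 (Quot.out v).x)
    (theta_mem_srcDom_inv hsat hab (Quot.out v).mem)

theorem starL_mkL {p : 𝓐.Tot} {x : 𝓐.Spectrum} (hx : x ∈ 𝓐.srcDom p.1) :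
    starL hsat hab (mkL p x hx) =
      mkL (star p) (theta hsat hab p.1 x) (theta_mem_srcDom_inv hsat hab hx) :=
  mkL_star_eq hsat hab (mkL_out (mkL p x hx))

theorem proj_starL (v : 𝓐.L) :
    𝓐.proj (starL hsat hab v) = ginv hsat hab (𝓐.proj v) := by
  obtain ⟨p, x, hx, rfl⟩ := exists_mkL v
  rw [starL_mkL hsat hab hx]
  exact (ginv_germ hsat hab hx).symm

theorem coordL_starL {v : 𝓐.L} {p : 𝓐.Tot} {x : 𝓐.Spectrum} {hx : x ∈ 𝓐.srcDom p.1}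
    (hv : 𝓐.proj v = 𝓐.germ p.1 x hx) :
    coordL hab (star p) (starL hsat hab v) = (starRingEnd ℂ) (coordL hab p v) := by
  obtain ⟨q, y, hy, rfl⟩ := exists_mkL v
  obtain ⟨rfl, h1⟩ := germ_eq_iff.mp hv
  rw [starL_mkL hsat hab hy, coordL_mkL, coordL_mkL, ← SameGerm.theta_eq hsat hab hx hy h1.symm,
    pair_star hsat hab hx h1.symm, pair_symm hab]

theorem pair_mul_self {p q : 𝓐.Tot} {y : 𝓐.Spectrum} (hy : y ∈ 𝓐.srcDom q.1) :
    pair y (p * q) (p * q) = pair (theta hsat hab q.1 y) p p * pair y q q :=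
  pair_mul hsat hab hy (SameGerm.refl _ _) (SameGerm.refl _ _)

theorem pair_star_self {p : 𝓐.Tot} {x : 𝓐.Spectrum} (hx : x ∈ 𝓐.srcDom p.1) :
    pair (theta hsat hab p.1 x) (star p) (star p) = pair x p p :=
  pair_star hsat hab hx (SameGerm.refl _ _)

include hab in
theorem fiber_ext {u : 𝓐.Tot} {x : 𝓐.Spectrum} {hx : x ∈ 𝓐.srcDom u.1} {g : 𝓐.Germ}
    (hg : g = 𝓐.germ u.1 x hx) (hu : pair x u u ≠ 0) {v w : BundleFiber 𝓐.proj g}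
    (h : coordL hab u v.1 = coordL hab u w.1) : v = w :=
  Subtype.ext (eq_of_coordL hab hu (v.2.trans hg) (w.2.trans hg) h)

/-- The product on fibers. -/
noncomputable def fiberMul {g h : 𝓐.Germ} (c : 𝓐.germSrc g = grng hsat hab h)
    (v : BundleFiber 𝓐.proj g) (w : BundleFiber 𝓐.proj h) :
    BundleFiber 𝓐.proj (gmul hsat hab g h c) :=
  ⟨mulL hsat hab v.1 w.1 (by rw [v.2, w.2]; exact c), by
    obtain ⟨v, rfl⟩ := v
    obtain ⟨w, rfl⟩ := w
    exact proj_mulL hsat hab v w c⟩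

/-- The involution on fibers. -/
noncomputable def fiberStar {g : 𝓐.Germ} (v : BundleFiber 𝓐.proj g) :
    BundleFiber 𝓐.proj (ginv hsat hab g) :=
  ⟨starL hsat hab v.1, (proj_starL hsat hab v.1).trans (congrArg _ v.2)⟩

/-- Among the products p q of representatives there is one made of two unit vectors. It is again a
unit vector, so its coordinate separates the points of the fiber. -/
theorem fiberMul_ext {g h : 𝓐.Germ} (c : 𝓐.germSrc g = grng hsat hab h)
    {v w : BundleFiber 𝓐.proj (gmul hsat hab g h c)}
    (H : ∀ p q : 𝓐.Tot, (∃ x hx, g = 𝓐.germ p.1 x hx) → (∃ y hy, h = 𝓐.germ q.1 y hy) →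
      coordL hab (p * q) v.1 = coordL hab (p * q) w.1) : v = w := by
  obtain ⟨p, hx, hg, hp⟩ := exists_unit hsat hab g
  obtain ⟨q, hy, hh, hq⟩ := exists_unit hsat hab h
  obtain ⟨hpq, hgh⟩ := gmul_eq hsat hab hg hh c
  refine fiber_ext hab hgh ?_ (H p q ⟨_, hx, hg⟩ ⟨_, hy, hh⟩)
  have hθ : theta hsat hab q.1 (𝓐.germSrc h) = 𝓐.germSrc g := by
    rw [c]; conv_rhs => rw [hh]
    exact (grng_germ hsat hab hy).symm
  rw [pair_mul_self hsat hab hy, hθ, hp, hq, one_mul]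
  exact one_ne_zero

theorem coordL_fiberMul {g h : 𝓐.Germ} (c : 𝓐.germSrc g = grng hsat hab h)
    (v : BundleFiber 𝓐.proj g) (w : BundleFiber 𝓐.proj h) {p q : 𝓐.Tot}
    (hp : ∃ x hx, g = 𝓐.germ p.1 x hx) (hq : ∃ y hy, h = 𝓐.germ q.1 y hy) :
    coordL hab (p * q) (fiberMul hsat hab c v w).1 = coordL hab p v.1 * coordL hab q w.1 := by
  obtain ⟨x, hx, hg⟩ := hp
  obtain ⟨y, hy, hh⟩ := hq
  exact coordL_mulL hsat hab (by rw [v.2, w.2]; exact c) (v.2.trans hg) (w.2.trans hh)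

theorem fiberStar_ext {g : 𝓐.Germ} {v w : BundleFiber 𝓐.proj (ginv hsat hab g)}
    (H : ∀ p : 𝓐.Tot, (∃ x hx, g = 𝓐.germ p.1 x hx) →
      coordL hab (star p) v.1 = coordL hab (star p) w.1) : v = w := by
  obtain ⟨p, hx, hg, hp⟩ := exists_unit hsat hab g
  refine fiber_ext hab ((congrArg _ hg).trans (ginv_germ hsat hab hx)) (u := star p) ?_
    (H p ⟨_, hx, hg⟩)
  rw [pair_star_self hsat hab hx, hp]
  exact one_ne_zero

theorem coordL_fiberStar {g : 𝓐.Germ} (v : BundleFiber 𝓐.proj g) {p : 𝓐.Tot}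
    (hp : ∃ x hx, g = 𝓐.germ p.1 x hx) :
    coordL hab (star p) (fiberStar hsat hab v).1 = (starRingEnd ℂ) (coordL hab p v.1) := by
  obtain ⟨x, hx, hg⟩ := hp
  exact coordL_starL hsat hab (v.2.trans hg)

/-! ### Linearity, norms and continuity of the operations -/

section

variable [BanachFibers 𝓐.proj] (H : 𝓐.HasCanonicalFibers)

/-- The product on fibers as a bilinear map. -/
noncomputable def fiberMulLin {g h : 𝓐.Germ} (c : 𝓐.germSrc g = grng hsat hab h) :
    BundleFiber 𝓐.proj g →ₗ[ℂ] BundleFiber 𝓐.proj h →ₗ[ℂ]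
      BundleFiber 𝓐.proj (gmul hsat hab g h c) :=
  LinearMap.mk₂ ℂ (fiberMul hsat hab c)
    (fun v v' w => fiberMul_ext hsat hab c fun p q hp hq => by
      rw [coordL_fiberMul hsat hab c _ _ hp hq, coordL_add H hsat hab, coordL_add H hsat hab,
        coordL_fiberMul hsat hab c _ _ hp hq, coordL_fiberMul hsat hab c _ _ hp hq, add_mul])
    (fun z v w => fiberMul_ext hsat hab c fun p q hp hq => by
      rw [coordL_fiberMul hsat hab c _ _ hp hq, coordL_smul H hsat hab, coordL_smul H hsat hab,
        coordL_fiberMul hsat hab c _ _ hp hq, mul_assoc])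
    (fun v w w' => fiberMul_ext hsat hab c fun p q hp hq => by
      rw [coordL_fiberMul hsat hab c _ _ hp hq, coordL_add H hsat hab, coordL_add H hsat hab,
        coordL_fiberMul hsat hab c _ _ hp hq, coordL_fiberMul hsat hab c _ _ hp hq, mul_add])
    (fun z v w => fiberMul_ext hsat hab c fun p q hp hq => by
      rw [coordL_fiberMul hsat hab c _ _ hp hq, coordL_smul H hsat hab, coordL_smul H hsat hab,
        coordL_fiberMul hsat hab c _ _ hp hq, mul_left_comm])

/-- The involution on fibers as a conjugate linear map. -/
noncomputable def fiberStarLin (g : 𝓐.Germ) :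
    BundleFiber 𝓐.proj g →ₗ⋆[ℂ] BundleFiber 𝓐.proj (ginv hsat hab g) where
  toFun := fiberStar hsat hab
  map_add' v w := fiberStar_ext hsat hab fun p hp => by
    rw [coordL_fiberStar hsat hab _ hp, coordL_add H hsat hab, coordL_add H hsat hab,
      coordL_fiberStar hsat hab _ hp, coordL_fiberStar hsat hab _ hp, map_add]
  map_smul' z v := fiberStar_ext hsat hab fun p hp => by
    rw [coordL_fiberStar hsat hab _ hp, coordL_smul H hsat hab, coordL_smul H hsat hab,
      coordL_fiberStar hsat hab _ hp, map_mul]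

include hab H in
theorem norm_sq_mkL {g : 𝓐.Germ} (v : BundleFiber 𝓐.proj g) {p : 𝓐.Tot} {x : 𝓐.Spectrum}
    {hx : x ∈ 𝓐.srcDom p.1} (hv : v.1 = mkL p x hx) : (‖v‖ : ℂ) ^ 2 = pair x p p := by
  rw [norm_mkL_sq H v hv, pair_of_eq hab x rfl]

include H in
-- The squared norms are the self-pairings, which multiply exactly. The norm is thus multiplicative,
-- not only submultiplicative.
theorem norm_fiberMul {g h : 𝓐.Germ} (c : 𝓐.germSrc g = grng hsat hab h)
    (v : BundleFiber 𝓐.proj g) (w : BundleFiber 𝓐.proj h) :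
    ‖fiberMul hsat hab c v w‖ = ‖v‖ * ‖w‖ := by
  obtain ⟨v, rfl⟩ := v
  obtain ⟨w, rfl⟩ := w
  obtain ⟨p, x, hx, rfl⟩ := exists_mkL v
  obtain ⟨q, y, hy, rfl⟩ := exists_mkL w
  refine (sq_eq_sq₀ (norm_nonneg _) (mul_nonneg (norm_nonneg _) (norm_nonneg _))).mp ?_
  have c' : x = theta hsat hab q.1 y := c
  have h1 := norm_sq_mkL hab H (fiberMul hsat hab c ⟨mkL p x hx, rfl⟩ ⟨mkL q y hy, rfl⟩)
    (mulL_mkL hsat hab c)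
  rw [pair_mul_self hsat hab hy, ← c',
    ← norm_sq_mkL hab H (⟨mkL p x hx, rfl⟩ : BundleFiber 𝓐.proj _) rfl,
    ← norm_sq_mkL hab H (⟨mkL q y hy, rfl⟩ : BundleFiber 𝓐.proj _) rfl] at h1
  rw [mul_pow]
  exact_mod_cast h1

include H in
theorem norm_fiberStar {g : 𝓐.Germ} (v : BundleFiber 𝓐.proj g) :
    ‖fiberStar hsat hab v‖ = ‖v‖ := by
  obtain ⟨v, rfl⟩ := v
  obtain ⟨p, x, hx, rfl⟩ := exists_mkL v
  refine (sq_eq_sq₀ (norm_nonneg _) (norm_nonneg _)).mp ?_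
  have h1 := norm_sq_mkL hab H (fiberStar hsat hab ⟨mkL p x hx, rfl⟩) (starL_mkL hsat hab hx)
  rw [pair_star_self hsat hab hx,
    ← norm_sq_mkL hab H (⟨mkL p x hx, rfl⟩ : BundleFiber 𝓐.proj _) rfl] at h1
  exact_mod_cast h1

/-- In the chart of p q the product has as coordinate the product of the coordinates in the charts
of p and q, and its base point moves by the continuous product of germs. -/
theorem continuous_mulL :
    let _ := topologyL H hsat hab
    Continuous fun q : {q : 𝓐.L × 𝓐.L //
      𝓐.germSrc (𝓐.proj q.1) = grng hsat hab (𝓐.proj q.2)} =>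
        mulL hsat hab q.1.1 q.1.2 q.2 := by
  let _ := topologyL H hsat hab
  have hproj : Continuous 𝓐.proj := (isBundleTopology_topologyL H hsat hab).1.continuous_proj
  refine continuous_iff_continuousAt.mpr ?_
  rintro ⟨⟨v, w⟩, c⟩
  have hv := (continuous_fst.comp continuous_subtype_val).tendsto (⟨(v, w), c⟩ :
    {q : 𝓐.L × 𝓐.L // 𝓐.germSrc (𝓐.proj q.1) = grng hsat hab (𝓐.proj q.2)})
  have hw := (continuous_snd.comp continuous_subtype_val).tendsto (⟨(v, w), c⟩ :
    {q : 𝓐.L × 𝓐.L // 𝓐.germSrc (𝓐.proj q.1) = grng hsat hab (𝓐.proj q.2)})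
  obtain ⟨p, hx, hg, hp⟩ := exists_unit hsat hab (𝓐.proj v)
  obtain ⟨q, hy, hh, hq⟩ := exists_unit hsat hab (𝓐.proj w)
  have hvp : 𝓐.proj v ∈ chartBase p := ⟨hx, hg, by rw [hp]; exact one_ne_zero⟩
  have hwq : 𝓐.proj w ∈ chartBase q := ⟨hy, hh, by rw [hq]; exact one_ne_zero⟩
  obtain ⟨h1, h2⟩ := (tendsto_L_iff H hsat hab hvp).mp hv
  obtain ⟨h3, h4⟩ := (tendsto_L_iff H hsat hab hwq).mp hw
  have hθ : theta hsat hab q.1 (𝓐.germSrc (𝓐.proj w)) = 𝓐.germSrc (𝓐.proj v) := by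
    rw [c]; conv_rhs => rw [hh]
    exact (grng_germ hsat hab hy).symm
  refine (tendsto_L_iff H hsat hab (u := p * q) ?_).mpr ⟨?_, ?_⟩
  · rw [proj_mulL]
    obtain ⟨hpq, hgh⟩ := gmul_eq hsat hab hg hh c
    rw [hgh]
    refine germ_mem_chartBase (u := p * q) ?_
    rw [pair_mul_self hsat hab hy, hθ, hp, hq, one_mul]
    exact one_ne_zero
  · simp only [proj_mulL]
    have h5 : Continuous fun r : {q : 𝓐.L × 𝓐.L //
        𝓐.germSrc (𝓐.proj q.1) = grng hsat hab (𝓐.proj q.2)} =>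
          (⟨(𝓐.proj r.1.1, 𝓐.proj r.1.2), r.2⟩ :
            {q : 𝓐.Germ × 𝓐.Germ // 𝓐.germSrc q.1 = grng hsat hab q.2}) := by fun_prop
    exact ((continuous_gmul hsat hab).comp h5).tendsto _
  · rw [coordL_mulL hsat hab c hg hh]
    refine (h2.mul h4).congr' ?_
    filter_upwards [h1 ((isOpen_chartBase hab p).mem_nhds hvp),
      h3 ((isOpen_chartBase hab q).mem_nhds hwq)] with r hr hr'
    exact (coordL_mulL hsat hab r.2 hr.choose_spec.1 hr'.choose_spec.1).symm

theorem continuous_starL :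
    let _ := topologyL H hsat hab
    Continuous (starL hsat hab) := by
  let _ := topologyL H hsat hab
  have hproj : Continuous 𝓐.proj := (isBundleTopology_topologyL H hsat hab).1.continuous_proj
  refine continuous_iff_continuousAt.mpr fun v => ?_
  obtain ⟨p, hx, hg, hp⟩ := exists_unit hsat hab (𝓐.proj v)
  have hvp : 𝓐.proj v ∈ chartBase p := ⟨hx, hg, by rw [hp]; exact one_ne_zero⟩
  obtain ⟨h1, h2⟩ := (tendsto_L_iff H hsat hab hvp).mp (tendsto_id (x := 𝓝 v))
  refine (tendsto_L_iff H hsat hab (u := star p) ?_).mpr ⟨?_, ?_⟩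
  · rw [proj_starL, hg, ginv_germ]
    refine germ_mem_chartBase (u := star p) ?_
    rw [pair_star_self hsat hab hx, hp]
    exact one_ne_zero
  · simp only [proj_starL]
    exact ((continuous_ginv hsat hab).comp hproj).tendsto _
  · rw [coordL_starL hsat hab hg]
    refine ((Complex.continuous_conj.tendsto _).comp h2).congr' ?_
    filter_upwards [h1 ((isOpen_chartBase hab p).mem_nhds hvp)] with r hr
    exact (coordL_starL hsat hab hr.choose_spec.1).symm

/-- The line bundle as a Fell bundle over the groupoid of germs. -/
noncomputable def fellLineBundle :
    let _ := topologyL H hsat hab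
    GroupoidFellBundle (germGroupoid hsat hab) 𝓐.proj :=
  let _ := topologyL H hsat hab
  { isUSCBanachBundle := (isBundleTopology_topologyL H hsat hab).1
    mul := fun c => fiberMulLin hsat hab H c
    star := fun {g} => fiberStarLin hsat hab H g
    mul_assoc := by
      rintro g h k c c' d d' ⟨u, rfl⟩ ⟨v, rfl⟩ ⟨w, rfl⟩
      obtain ⟨p, x, hx, rfl⟩ := exists_mkL u
      obtain ⟨q, y, hy, rfl⟩ := exists_mkL v
      obtain ⟨r, z, hz, rfl⟩ := exists_mkL w
      obtain ⟨h1, e1⟩ := mulL_eq hsat hab (v := mkL p x hx) (w := mkL q y hy) rfl rfl c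
      obtain ⟨h2, e2⟩ := mulL_eq hsat hab (w := mkL r z hz) e1 rfl
        ((congrArg 𝓐.germSrc (proj_mulL hsat hab (mkL p x hx) (mkL q y hy) c)).trans d)
      obtain ⟨h3, e3⟩ := mulL_eq hsat hab (v := mkL q y hy) (w := mkL r z hz) rfl rfl c'
      obtain ⟨h4, e4⟩ := mulL_eq hsat hab (v := mkL p x hx) rfl e3
        (Eq.trans d' (congrArg (grng hsat hab) (proj_mulL hsat hab (mkL q y hy) (mkL r z hz) c').symm))
      -- Once both products are classes of triple products over the same point, associativity is
      -- that of `𝓐.Tot`.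
      exact e2.trans ((mkL_congr (mul_assoc p q r) rfl).trans e4.symm)
    continuous_mul := continuous_mulL hsat hab H
    norm_mul_le := fun c u v => (norm_fiberMul hsat hab H c u v).le
    star_star := by
      rintro g ⟨u, rfl⟩
      obtain ⟨p, x, hx, rfl⟩ := exists_mkL u
      change starL hsat hab (starL hsat hab (mkL p x hx)) = _
      rw [starL_mkL, starL_mkL]
      exact mkL_congr (star_star p) (theta_inv_theta hsat hab hx)
    norm_star := fun u => norm_fiberStar hsat hab H u
    star_mul := by
      rintro g h c c' ⟨u, rfl⟩ ⟨v, rfl⟩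
      obtain ⟨p, x, hx, rfl⟩ := exists_mkL u
      obtain ⟨q, y, hy, rfl⟩ := exists_mkL v
      obtain ⟨h1, e1⟩ := mulL_eq hsat hab (v := mkL p x hx) (w := mkL q y hy) rfl rfl c
      obtain ⟨h2, e2⟩ := mulL_eq hsat hab (starL_mkL hsat hab hy) (starL_mkL hsat hab hx)
        (by rw [proj_starL, proj_starL]; exact c')
      refine (congrArg (starL hsat hab) e1).trans
        ((starL_mkL hsat hab h1).trans (Eq.trans (mkL_congr (star_mul p q) ?_) e2.symm))
      exact (theta_mul hsat hab h1).trans (congrArg _ (Eq.symm c))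
    continuous_star := continuous_starL hsat hab H
    norm_star_mul_self := fun c u => by
      rw [sq]
      exact (norm_fiberMul hsat hab H c _ u).trans
        (congrArg (· * ‖u‖) (norm_fiberStar hsat hab H u))
    star_mul_self_pos := by
      rintro g c ⟨u, rfl⟩
      obtain ⟨p, x, hx, rfl⟩ := exists_mkL u
      -- Positivity comes from A_{s* s}: if p* p = k* k with k over s* s, the class of k over the
      -- unit x is the required w.
      obtain ⟨k, hk⟩ := 𝓐.star_mul_self_pos p.2
      have hk' : star p * p = star (𝓐.el k) * 𝓐.el k := el_eq_of_sigma_eq 𝓐 hk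
      have hi : Idem (𝓐.el k).1 := idem_inv_mul p.1
      have hxk : x ∈ 𝓐.srcDom (𝓐.el k).1 := (srcDom_idem hi).mpr hx
      refine ⟨⟨mkL (𝓐.el k) x hxk, (gunit_eq hi hx hxk).symm⟩,
        ((germGroupoid hsat hab).src_inv _), ?_⟩
      obtain ⟨h1, e1⟩ := mulL_eq hsat hab (starL_mkL hsat hab hx) rfl
        (by rw [proj_starL]; exact c)
      obtain ⟨h2, e2⟩ := mulL_eq hsat hab (w := mkL (𝓐.el k) x hxk) (starL_mkL hsat hab hxk) rfl
        (by rw [proj_starL]; exact (germGroupoid hsat hab).src_inv (𝓐.proj (mkL (𝓐.el k) x hxk)))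
      exact e1.trans ((mkL_congr hk' rfl).trans e2.symm) }

theorem hasCanonicalOperations_fellLineBundle :
    let _ := topologyL H hsat hab
    𝓐.HasCanonicalOperations (thetaHomeo hsat hab) (fellLineBundle hsat hab H) :=
  let _ := topologyL H hsat hab
  { mul_fmk := fun _ a x hx _ b y hy c =>
      mulL_eq hsat hab (v := mkL (𝓐.el a) x hx) (w := mkL (𝓐.el b) y hy) rfl rfl c
    star_fmk := fun _ a _ hx => ⟨_, starL_mkL hsat hab (p := 𝓐.el a) hx⟩ }

theorem isFellLineBundle_fellLineBundle :
    let _ := topologyL H hsat hab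
    (fellLineBundle hsat hab H).IsFellLineBundle :=
  let _ := topologyL H hsat hab
  { finrank_fiber := (lineCharts H hsat hab).finrank_fiber
    isLocallyTrivialLine := (lineCharts H hsat hab).isLocallyTrivialLine
    continuous_norm := (lineCharts H hsat hab).continuous_norm }

end

end

end

end FellLine

/-! ### Unit sections -/

namespace LineBundle

open Filter Topology

section

variable {B E : Type*} {p : E → B} [BanachFibers p]

theorem smul_val_congr {v w : E} (h : v = w) (c : ℂ) :
    (c • toFiber p v).1 = (c • toFiber p w).1 := by rw [h]

theorem smul_smul_toFiber (c d : ℂ) (v : E) :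
    (c • toFiber p (d • toFiber p v).1).1 = ((c * d) • toFiber p v).1 := by
  rw [smul_toFiber, mul_smul]

theorem proj_smul (c : ℂ) (v : E) : p (c • toFiber p v).1 = p v := (c • toFiber p v).2

theorem norm_smul_toFiber (c : ℂ) (v : E) :
    ‖toFiber p (c • toFiber p v).1‖ = ‖c‖ * ‖toFiber p v‖ := by
  rw [norm_toFiber, norm_smul]

omit [BanachFibers p] in
theorem proj_val {b : B} (v : BundleFiber p b) : p v.1 = b := v.2

variable [TopologicalSpace B]

/-- A section of norm one of a line bundle which is continuous on the open set `U`, and the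
corresponding coordinate. -/
structure UnitSection [TopologicalSpace E] (p : E → B) [BanachFibers p] (U : Set B) where
  sec : ∀ b : B, BundleFiber p b
  coord : E → ℂ
  norm_sec : ∀ b, ‖sec b‖ = 1
  coord_smul_sec : ∀ v, (coord v • sec (p v)).1 = v
  continuousOn_sec : ContinuousOn (fun b => (sec b).1) U
  continuousOn_coord : ContinuousOn coord (p ⁻¹' U)

namespace UnitSection

variable [TopologicalSpace E] {U : Set B} (σ : UnitSection p U)

theorem coord_eq {b : B} {c : ℂ} {v : E} (hv : v = (c • σ.sec b).1) : σ.coord v = c := by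
  have hb : p v = b := by rw [hv]; exact (c • σ.sec b).2
  subst hb
  have h : σ.coord v • σ.sec (p v) = c • σ.sec (p v) :=
    Subtype.ext ((σ.coord_smul_sec v).trans hv)
  have h0 : σ.sec (p v) ≠ 0 := by
    rw [← norm_ne_zero_iff, σ.norm_sec]
    exact one_ne_zero
  exact smul_left_injective ℂ h0 h

theorem coord_smul (c : ℂ) (v : E) : σ.coord (c • toFiber p v).1 = c * σ.coord v := by
  refine σ.coord_eq (b := p v) ?_
  rw [mul_smul]
  exact congrArg (fun w : BundleFiber p (p v) => (c • w).1)
    (Subtype.ext (σ.coord_smul_sec v).symm)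

theorem norm_coord (v : E) : ‖σ.coord v‖ = ‖toFiber p v‖ := by
  have h : toFiber p v = σ.coord v • σ.sec (p v) := Subtype.ext (σ.coord_smul_sec v).symm
  rw [h, norm_smul, σ.norm_sec, mul_one]

theorem eq_smul_of_proj_eq {v w : E} (h : p v = p w) (hw : ‖toFiber p w‖ ≠ 0) :
    v = ((σ.coord v / σ.coord w) • toFiber p w).1 := by
  have h0 : σ.coord w ≠ 0 := by rwa [← norm_ne_zero_iff, norm_coord]
  have h1 : (σ.coord w • σ.sec (p v)).1 = w := by
    rw [h]; exact σ.coord_smul_sec w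
  have h2 : (σ.coord v / σ.coord w * σ.coord w) • σ.sec (p v) = σ.coord v • σ.sec (p v) := by
    rw [div_mul_cancel₀ _ h0]
  rw [mul_smul] at h2
  refine (σ.coord_smul_sec v).symm.trans ((congrArg Subtype.val h2).symm.trans ?_)
  rw [← smul_toFiber]
  exact smul_val_congr h1 _

end UnitSection

namespace LineCharts

variable {ι : Type*} (C : LineCharts p ι)

theorem norm_normalized_sec {i : ι} {b : B} (hb : b ∈ C.base i) :
    ‖((C.weight i b)⁻¹ : ℂ) • C.sec i b‖ = 1 := by
  have h := C.weight_pos i b hb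
  rw [norm_smul, C.norm_eq i b _ hb, C.coord_sec i b hb, norm_one, mul_one, norm_inv,
    Complex.norm_real, Real.norm_of_nonneg h.le, inv_mul_cancel₀ h.ne']

open Classical in
/-- A chart whose domain contains `b`, equal to `i` if possible. -/
noncomputable def index (i : ι) (b : B) : ι :=
  if b ∈ C.base i then i else (C.exists_mem_base b).choose

theorem index_of_mem {i : ι} {b : B} (h : b ∈ C.base i) : C.index i b = i := if_pos h

theorem mem_base_index (i : ι) (b : B) : b ∈ C.base (C.index i b) := by
  unfold index
  split_ifs with h
  exacts [h, (C.exists_mem_base b).choose_spec]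

/-- The unit section defined by a chart. -/
noncomputable def unitSection (i : ι) : @UnitSection B E _ C.topology p _ (C.base i) :=
  letI := C.topology
  -- The section of a chart has norm equal to the weight on the base set, hence the normalization.
  -- Away from the base of i another chart is used, because norm one is required everywhere but
  -- continuity only there.
  { sec := fun b => ((C.weight (C.index i b) b)⁻¹ : ℂ) • C.sec (C.index i b) b
    coord := fun v => C.weight (C.index i (p v)) (p v) * C.coord (C.index i (p v)) v
    norm_sec := fun b => C.norm_normalized_sec (C.mem_base_index i b)
    coord_smul_sec := fun v => by
      have h := C.weight_pos _ _ (C.mem_base_index i (p v))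
      rw [smul_smul, mul_comm (C.weight _ _ : ℂ), mul_inv_cancel_right₀ (by exact_mod_cast h.ne')]
      exact C.coord_smul_sec_self (C.mem_base_index i (p v))
    continuousOn_sec := by
      intro b hb
      refine ContinuousAt.continuousWithinAt ((C.tendsto_iff (i := i) ?_).mpr ⟨?_, ?_⟩)
      · rwa [proj_val (p := p)]
      · simp only [proj_val (p := p)]
        exact tendsto_id
      · have h1 : ∀ b ∈ C.base i, C.coord i
            (((C.weight (C.index i b) b)⁻¹ : ℂ) • C.sec (C.index i b) b).1 =
              ((C.weight i b)⁻¹ : ℂ) := by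
          intro b hb
          rw [C.index_of_mem hb, C.coord_smul, C.coord_sec i b hb, mul_one]
        rw [h1 b hb]
        have h2 : ContinuousAt (C.weight i) b :=
          (C.continuousOn_weight i).continuousAt ((C.isOpen_base i).mem_nhds hb)
        have h3 : Tendsto (fun b => ((C.weight i b : ℂ))⁻¹) (𝓝 b) (𝓝 ((C.weight i b : ℂ))⁻¹) :=
          ((Complex.continuous_ofReal.tendsto _).comp h2).inv₀
            (by exact_mod_cast (C.weight_pos i b hb).ne')
        refine h3.congr' ?_
        filter_upwards [(C.isOpen_base i).mem_nhds hb] with b' hb' using (h1 b' hb').symm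
    continuousOn_coord := by
      intro v hv
      refine ContinuousAt.continuousWithinAt ?_
      obtain ⟨h1, h2⟩ := (C.tendsto_iff hv).mp (tendsto_id (x := 𝓝 v))
      have h3 : ContinuousAt (C.weight i) (p v) :=
        (C.continuousOn_weight i).continuousAt ((C.isOpen_base i).mem_nhds hv)
      have h4 := ((Complex.continuous_ofReal.tendsto _).comp (h3.tendsto.comp h1)).mul h2
      unfold ContinuousAt
      beta_reduce
      rw [C.index_of_mem hv]
      refine h4.congr' ?_
      filter_upwards [h1 ((C.isOpen_base i).mem_nhds hv)] with w hw
      have hw' : C.index i (p w) = i := C.index_of_mem hw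
      rw [hw']
      rfl }

end LineCharts

end

end LineBundle

theorem LineBundle.norm_circle_smul (z : Circle) {B E : Type*} {p : E → B} [BanachFibers p] {v : E} (h : ‖toFiber p v‖ = 1) :
    ‖toFiber p ((z : ℂ) • toFiber p v).1‖ = 1 := by
  rw [norm_smul_toFiber, h, Circle.norm_coe, one_mul]

/-! ### The twist of unitary elements -/

namespace UnitaryTwist

open Filter Topology LineBundle

section

variable {G X E : Type*} [TopologicalSpace G] [TopologicalSpace E]
  {𝓖 : GroupoidStr G X} {p : E → G} [BanachFibers p]

/-- The product computed over p v and p w agrees with that computed over g and h, to which they are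
only propositionally equal. -/
theorem tmul_val {𝓛 : GroupoidFellBundle 𝓖 p} {g h : G} (v : BundleFiber p g)
    (w : BundleFiber p h) (c : 𝓖.src (p v.1) = 𝓖.rng (p w.1)) (c' : 𝓖.src g = 𝓖.rng h) :
    𝓛.tmul v.1 w.1 c = (𝓛.mul c' v w).1 := by
  obtain ⟨v, rfl⟩ := v
  obtain ⟨w, rfl⟩ := w
  rfl

variable (𝓛 : GroupoidFellBundle 𝓖 p)

theorem proj_tmul (v w : E) (c : 𝓖.src (p v) = 𝓖.rng (p w)) :
    p (𝓛.tmul v w c) = 𝓖.mul (p v) (p w) c := (𝓛.mul c (toFiber p v) (toFiber p w)).2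

theorem proj_tstar (v : E) : p (𝓛.tstar v) = 𝓖.inv (p v) := (𝓛.star (toFiber p v)).2

theorem norm_tstar (v : E) : ‖toFiber p (𝓛.tstar v)‖ = ‖toFiber p v‖ := by
  rw [GroupoidFellBundle.tstar, norm_toFiber, 𝓛.norm_star]

theorem src_tmul (v w : E) (c : 𝓖.src (p v) = 𝓖.rng (p w)) :
    𝓖.src (p (𝓛.tmul v w c)) = 𝓖.src (p w) := by
  rw [proj_tmul 𝓛, 𝓖.src_mul]

theorem rng_tmul (v w : E) (c : 𝓖.src (p v) = 𝓖.rng (p w)) :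
    𝓖.rng (p (𝓛.tmul v w c)) = 𝓖.rng (p v) := by
  rw [proj_tmul 𝓛, 𝓖.rng_mul]

theorem src_tstar (v : E) : 𝓖.src (p (𝓛.tstar v)) = 𝓖.rng (p v) := by
  rw [proj_tstar 𝓛, 𝓖.src_inv]

theorem rng_tstar (v : E) : 𝓖.rng (p (𝓛.tstar v)) = 𝓖.src (p v) := by
  rw [proj_tstar 𝓛, 𝓖.rng_inv]

theorem tmul_assoc (u v w : E) (c : 𝓖.src (p u) = 𝓖.rng (p v))
    (c' : 𝓖.src (p v) = 𝓖.rng (p w)) (d : 𝓖.src (p (𝓛.tmul u v c)) = 𝓖.rng (p w))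
    (d' : 𝓖.src (p u) = 𝓖.rng (p (𝓛.tmul v w c'))) :
    𝓛.tmul (𝓛.tmul u v c) w d = 𝓛.tmul u (𝓛.tmul v w c') d' := by
  have e := proj_tmul 𝓛 u v c ▸ d
  have e' := proj_tmul 𝓛 v w c' ▸ d'
  exact (tmul_val (𝓛.mul c (toFiber p u) (toFiber p v)) (toFiber p w) d e).trans
    ((𝓛.mul_assoc c c' e e' _ _ _).trans
      (tmul_val (toFiber p u) (𝓛.mul c' (toFiber p v) (toFiber p w)) d' e').symm)

theorem tmul_smul_left (z : ℂ) (v w : E) (c : 𝓖.src (p (z • toFiber p v).1) = 𝓖.rng (p w))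
    (c' : 𝓖.src (p v) = 𝓖.rng (p w)) :
    𝓛.tmul (z • toFiber p v).1 w c = (z • toFiber p (𝓛.tmul v w c')).1 := by
  refine (tmul_val (z • toFiber p v) (toFiber p w) c c').trans
    (Eq.trans (congrArg Subtype.val ?_)
      (smul_toFiber z (𝓛.mul c' (toFiber p v) (toFiber p w))).symm)
  rw [map_smul, LinearMap.smul_apply]

theorem tmul_smul_right (z : ℂ) (v w : E) (c : 𝓖.src (p v) = 𝓖.rng (p (z • toFiber p w).1))
    (c' : 𝓖.src (p v) = 𝓖.rng (p w)) :
    𝓛.tmul v (z • toFiber p w).1 c = (z • toFiber p (𝓛.tmul v w c')).1 := by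
  refine (tmul_val (toFiber p v) (z • toFiber p w) c c').trans
    (Eq.trans (congrArg Subtype.val ?_)
      (smul_toFiber z (𝓛.mul c' (toFiber p v) (toFiber p w))).symm)
  rw [map_smul]

variable {𝓛}

theorem isEmbedding_val : IsEmbedding fun σ : 𝓛.Unitaries => σ.1 :=
  ⟨⟨rfl⟩, fun _ _ h => Subtype.ext h⟩

theorem continuous_val : Continuous fun σ : 𝓛.Unitaries => σ.1 := continuous_induced_dom

theorem continuous_proj_val : Continuous fun σ : 𝓛.Unitaries => p σ.1 :=
  𝓛.isUSCBanachBundle.continuous_proj.comp continuous_val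

variable [TopologicalSpace X]

/-- The properties of a Fell line bundle which yield the twist of its unitary elements. -/
structure UnitalData (𝓛 : GroupoidFellBundle 𝓖 p) where
  isTopological : 𝓖.IsTopological
  locallyCompactSpace : LocallyCompactSpace E
  continuous_norm : Continuous fun v : E => ‖toFiber p v‖
  continuous_smul : Continuous fun q : ℂ × E => ((q.1 • toFiber p q.2).1 : E)
  one : ∀ x : X, BundleFiber p (𝓖.unit x)
  continuous_one : Continuous fun x => (one x).1
  norm_one : ∀ x, ‖one x‖ = 1
  one_mul : ∀ (x : X) (v : E) c, x = 𝓖.rng (p v) → 𝓛.tmul (one x).1 v c = v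
  mul_one : ∀ (x : X) (v : E) c, x = 𝓖.src (p v) → 𝓛.tmul v (one x).1 c = v
  norm_tmul : ∀ (v w : E) c, ‖toFiber p (𝓛.tmul v w c)‖ = ‖toFiber p v‖ * ‖toFiber p w‖
  star_mul_self : ∀ (v : E) c, 𝓛.tmul (𝓛.tstar v) v c =
    (((‖toFiber p v‖ : ℂ) ^ 2) • one (𝓖.src (p v))).1
  mul_star_self : ∀ (v : E) c, 𝓛.tmul v (𝓛.tstar v) c =
    (((‖toFiber p v‖ : ℂ) ^ 2) • one (𝓖.rng (p v))).1
  exists_unitSection : ∀ g : G, ∃ U : Set G, IsOpen U ∧ g ∈ U ∧ Nonempty (UnitSection p U)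

/-! ### The central extension formed by the unitary elements -/

namespace UnitalData

variable (D : UnitalData 𝓛)

theorem proj_one (x : X) : p (D.one x).1 = 𝓖.unit x := (D.one x).2

theorem norm_toFiber_one (x : X) : ‖toFiber p (D.one x).1‖ = 1 :=
  (norm_toFiber _).trans (D.norm_one x)

theorem src_one (x : X) : 𝓖.src (p (D.one x).1) = x := by rw [D.proj_one, 𝓖.src_unit]

theorem rng_one (x : X) : 𝓖.rng (p (D.one x).1) = x := by rw [D.proj_one, 𝓖.rng_unit]

/-- Two-sided units are unique: u = u · 1 = 1. -/
theorem isOne_iff {x : X} {u : E} : 𝓛.IsOne x u ↔ u = (D.one x).1 := by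
  constructor
  · rintro ⟨h, h'⟩
    obtain ⟨⟨c, h1⟩, -⟩ := h' (D.one x).1 (D.proj_one x)
    exact (D.mul_one x u c (by rw [h, 𝓖.src_unit])).symm.trans h1
  · rintro rfl
    refine ⟨D.proj_one x, fun w hw => ⟨⟨?_, D.one_mul x w _ ?_⟩, ⟨?_, D.mul_one x w _ ?_⟩⟩⟩
    · rw [D.src_one, hw, 𝓖.rng_unit]
    · rw [hw, 𝓖.rng_unit]
    · rw [D.rng_one, hw, 𝓖.src_unit]
    · rw [hw, 𝓖.src_unit]

include D in
-- Both v* v and v v* are ‖v‖² times a unit element of norm one.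
theorem isUnitary_iff {v : E} : 𝓛.IsUnitary v ↔ ‖toFiber p v‖ = 1 := by
  constructor
  · rintro ⟨⟨c, h⟩, -⟩
    have h1 := D.isOne_iff.mp h
    rw [D.star_mul_self] at h1
    have h2 : ((‖toFiber p v‖ : ℂ) ^ 2) • D.one (𝓖.src (p v)) = D.one (𝓖.src (p v)) :=
      Subtype.ext h1
    replace h2 := congrArg norm h2
    rw [norm_smul, D.norm_one, norm_pow, Complex.norm_real, norm_norm] at h2
    have h3 : ‖toFiber p v‖ ^ 2 = 1 := by simpa using h2
    exact (pow_eq_one_iff_of_nonneg (norm_nonneg _) two_ne_zero).mp h3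
  · intro h
    refine ⟨⟨src_tstar 𝓛 v, D.isOne_iff.mpr ?_⟩, ⟨(rng_tstar 𝓛 v).symm, D.isOne_iff.mpr ?_⟩⟩
    · rw [D.star_mul_self, h, Complex.ofReal_one, one_pow, one_smul]
    · rw [D.mul_star_self, h, Complex.ofReal_one, one_pow, one_smul]

include D in
theorem norm_unitary (σ : 𝓛.Unitaries) : ‖toFiber p σ.1‖ = 1 := D.isUnitary_iff.mp σ.2

/-- An element of norm one as a unitary element. -/
def unitary (v : E) (h : ‖toFiber p v‖ = 1) : 𝓛.Unitaries := ⟨v, D.isUnitary_iff.mpr h⟩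

include D in
theorem exists_circle_smul {v w : E} (h : p v = p w) (hv : ‖toFiber p v‖ = 1)
    (hw : ‖toFiber p w‖ = 1) : ∃ z : Circle, v = ((z : ℂ) • toFiber p w).1 := by
  obtain ⟨U, -, -, ⟨σ⟩⟩ := D.exists_unitSection (p v)
  have h1 : σ.coord v / σ.coord w ∈ Submonoid.unitSphere ℂ := by
    refine mem_sphere_zero_iff_norm.mpr ?_
    rw [norm_div, σ.norm_coord, σ.norm_coord, hv, hw, div_one]
  exact ⟨⟨_, h1⟩, σ.eq_smul_of_proj_eq h (by rw [hw]; exact one_ne_zero)⟩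

include D in
-- The unitaries are the level set ‖v‖ = 1 of a continuous norm, hence closed in the locally compact
-- total space.
theorem locallyCompactSpace_unitaries : LocallyCompactSpace 𝓛.Unitaries := by
  have := D.locallyCompactSpace
  refine IsClosedEmbedding.locallyCompactSpace (f := fun σ : 𝓛.Unitaries => σ.1)
    ⟨isEmbedding_val, ?_⟩
  have : Set.range (fun σ : 𝓛.Unitaries => σ.1) = (fun v => ‖toFiber p v‖) ⁻¹' {1} := by
    ext v
    exact ⟨fun ⟨σ, h⟩ => h ▸ D.norm_unitary σ, fun h => ⟨D.unitary v h, rfl⟩⟩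
  rw [this]
  exact isClosed_singleton.preimage D.continuous_norm

/-- The groupoid of unitary elements. -/
def str : GroupoidStr 𝓛.Unitaries X where
  src σ := 𝓖.src (p σ.1)
  rng σ := 𝓖.rng (p σ.1)
  unit x := D.unitary (D.one x).1 (D.norm_toFiber_one x)
  mul σ τ c := D.unitary (𝓛.tmul σ.1 τ.1 c) (by
    rw [D.norm_tmul, D.norm_unitary, D.norm_unitary, _root_.one_mul])
  inv σ := D.unitary (𝓛.tstar σ.1) (by rw [norm_tstar, D.norm_unitary])
  src_unit := D.src_one
  rng_unit := D.rng_one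
  src_mul σ τ c := src_tmul 𝓛 σ.1 τ.1 c
  rng_mul σ τ c := rng_tmul 𝓛 σ.1 τ.1 c
  src_inv σ := src_tstar 𝓛 σ.1
  rng_inv σ := rng_tstar 𝓛 σ.1
  mul_assoc σ τ ρ c c' d d' := Subtype.ext (tmul_assoc 𝓛 σ.1 τ.1 ρ.1 c c' d d')
  unit_mul σ c := Subtype.ext (D.one_mul _ σ.1 c rfl)
  mul_unit σ c := Subtype.ext (D.mul_one _ σ.1 c rfl)
  mul_inv σ c := Subtype.ext (by
    refine (D.mul_star_self σ.1 c).trans ?_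
    rw [D.norm_unitary, Complex.ofReal_one, one_pow, one_smul]
    rfl)
  inv_mul σ c := Subtype.ext (by
    refine (D.star_mul_self σ.1 c).trans ?_
    rw [D.norm_unitary, Complex.ofReal_one, one_pow, one_smul]
    rfl)

theorem isTopological_str : D.str.IsTopological where
  isEmbedding_unit := by
    refine Function.LeftInverse.isEmbedding (f := D.str.src) D.str.src_unit
      (D.isTopological.continuous_src.comp continuous_proj_val) ?_
    exact continuous_induced_rng.mpr D.continuous_one
  continuous_src := D.isTopological.continuous_src.comp continuous_proj_val
  continuous_rng := D.isTopological.continuous_rng.comp continuous_proj_val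
  continuous_mul := by
    refine continuous_induced_rng.mpr ?_
    have h : Continuous fun q : {q : 𝓛.Unitaries × 𝓛.Unitaries //
        D.str.src q.1 = D.str.rng q.2} =>
        (⟨(q.1.1.1, q.1.2.1), q.2⟩ : {q : E × E // 𝓖.src (p q.1) = 𝓖.rng (p q.2)}) :=
      Continuous.subtype_mk
        ((continuous_val.comp (continuous_fst.comp continuous_subtype_val)).prodMk
          (continuous_val.comp (continuous_snd.comp continuous_subtype_val))) _
    exact 𝓛.continuous_mul.comp h
  continuous_inv := continuous_induced_rng.mpr (𝓛.continuous_star.comp continuous_val)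

/-- The inclusion of the trivial bundle of circles. -/
def ι (q : Circle × X) : 𝓛.Unitaries :=
  D.unitary ((q.1 : ℂ) • toFiber p (D.one q.2).1).1 (norm_circle_smul q.1 (D.norm_toFiber_one q.2))

theorem proj_ι (q : Circle × X) : p (D.ι q).1 = 𝓖.unit q.2 :=
  (proj_smul _ _).trans (D.proj_one _)

theorem src_ι (q : Circle × X) : 𝓖.src (p (D.ι q).1) = q.2 := by
  rw [D.proj_ι, 𝓖.src_unit]

theorem rng_ι (q : Circle × X) : 𝓖.rng (p (D.ι q).1) = q.2 := by
  rw [D.proj_ι, 𝓖.rng_unit]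

theorem tmul_ι_left (z : Circle) (x : X) (v : E) (c : 𝓖.src (p (D.ι (z, x)).1) = 𝓖.rng (p v))
    (h : x = 𝓖.rng (p v)) : 𝓛.tmul (D.ι (z, x)).1 v c = ((z : ℂ) • toFiber p v).1 :=
  (tmul_smul_left 𝓛 z (D.one x).1 v c (by rw [D.src_one, h])).trans
    (smul_val_congr (D.one_mul x v _ h) z)

theorem tmul_ι_right (z : Circle) (x : X) (v : E) (c : 𝓖.src (p v) = 𝓖.rng (p (D.ι (z, x)).1))
    (h : x = 𝓖.src (p v)) : 𝓛.tmul v (D.ι (z, x)).1 c = ((z : ℂ) • toFiber p v).1 :=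
  (tmul_smul_right 𝓛 z v (D.one x).1 c (by rw [D.rng_one, h])).trans
    (smul_val_congr (D.mul_one x v _ h) z)

theorem continuous_ι : Continuous D.ι := by
  refine continuous_induced_rng.mpr (D.continuous_smul.comp (Continuous.prodMk ?_ ?_))
  · exact continuous_subtype_val.comp continuous_fst
  · exact D.continuous_one.comp continuous_snd

theorem injective_ι : Function.Injective D.ι := by
  rintro ⟨z, x⟩ ⟨w, y⟩ h
  obtain rfl : x = y := by
    have := congrArg (fun σ : 𝓛.Unitaries => 𝓖.src (p σ.1)) h
    rwa [D.src_ι, D.src_ι] at this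
  have h1 : (z : ℂ) • toFiber p (D.one x).1 = (w : ℂ) • toFiber p (D.one x).1 :=
    Subtype.ext (congrArg (fun σ : 𝓛.Unitaries => σ.1) h)
  have h0 : toFiber p (D.one x).1 ≠ 0 := by
    rw [← norm_ne_zero_iff, D.norm_toFiber_one]
    exact one_ne_zero
  rw [Circle.ext (smul_left_injective ℂ h0 h1)]

/-- Both components are recovered continuously from ι(z, x): the point x as its source, and z as a
quotient of coordinates relative to a local unit section. -/
theorem isEmbedding_ι : IsEmbedding D.ι := by
  refine ⟨isInducing_iff_nhds.mpr fun q => ?_, D.injective_ι⟩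
  refine le_antisymm (D.continuous_ι.tendsto q).le_comap ?_
  change Tendsto id (comap D.ι (𝓝 (D.ι q))) (𝓝 q)
  set l := comap D.ι (𝓝 (D.ι q))
  have hl : Tendsto D.ι l (𝓝 (D.ι q)) := tendsto_comap
  have hx : Tendsto (fun r : Circle × X => r.2) l (𝓝 q.2) := by
    have h := ((D.isTopological.continuous_src.comp continuous_proj_val).tendsto (D.ι q)).comp hl
    have h' : ∀ r, ((𝓖.src ∘ fun σ : 𝓛.Unitaries => p σ.1) ∘ D.ι) r = r.2 := D.src_ι
    have h'' : (𝓖.src ∘ fun σ : 𝓛.Unitaries => p σ.1) (D.ι q) = q.2 := D.src_ι q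
    rw [h''] at h
    exact h.congr h'
  obtain ⟨U, hU, hq, ⟨σ⟩⟩ := D.exists_unitSection (𝓖.unit q.2)
  have hσ : ∀ v : E, p v = 𝓖.unit q.2 → ContinuousAt σ.coord v := fun v hv =>
    σ.continuousOn_coord.continuousAt
      ((hU.preimage 𝓛.isUSCBanachBundle.continuous_proj).mem_nhds
        (by rw [Set.mem_preimage, hv]; exact hq))
  have h1 : Tendsto (fun r => σ.coord (D.ι r).1) l (𝓝 (σ.coord (D.ι q).1)) :=
    (hσ _ (D.proj_ι q)).tendsto.comp ((continuous_val.tendsto _).comp hl)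
  have h2 : Tendsto (fun r : Circle × X => σ.coord (D.one r.2).1) l
      (𝓝 (σ.coord (D.one q.2).1)) :=
    (hσ _ (D.proj_one q.2)).tendsto.comp ((D.continuous_one.tendsto _).comp hx)
  have h0 : ∀ x, σ.coord (D.one x).1 ≠ 0 := fun x => by
    rw [← norm_ne_zero_iff, σ.norm_coord, D.norm_toFiber_one]
    exact one_ne_zero
  -- The coordinate is homogeneous, so dividing that of z · 1_x by that of 1_x leaves z. The
  -- identity holds for all r, even off the set where σ is continuous.
  have h3 : ∀ r : Circle × X, σ.coord (D.ι r).1 / σ.coord (D.one r.2).1 = r.1 := fun r => by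
    refine (congrArg (· / _) (σ.coord_smul (r.1 : ℂ) (D.one r.2).1)).trans ?_
    exact mul_div_cancel_right₀ _ (h0 _)
  have h4 := h1.div h2 (h0 _)
  simp only [Pi.div_def, h3] at h4
  exact Tendsto.prodMk_nhds (tendsto_subtype_rng.mpr h4) hx

/-- The unitary element of a unit section over a given arrow. -/
def unitSec {U : Set G} (σ : UnitSection p U) (g : G) : 𝓛.Unitaries :=
  D.unitary (σ.sec g).1 ((norm_toFiber _).trans (σ.norm_sec g))

theorem continuousAt_unitSec {U : Set G} (σ : UnitSection p U) (hU : IsOpen U) {g : G}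
    (hg : g ∈ U) : ContinuousAt (D.unitSec σ) g :=
  isEmbedding_val.continuousAt_iff.mpr (σ.continuousOn_sec.continuousAt (hU.mem_nhds hg))

/-- Multiplication of a unitary element by a complex number of modulus one. -/
def smulUnitary (z : ℂ) (hz : ‖z‖ = 1) (σ : 𝓛.Unitaries) : 𝓛.Unitaries :=
  D.unitary (z • toFiber p σ.1).1 (by rw [norm_smul_toFiber, hz, D.norm_unitary, _root_.one_mul])

theorem continuous_smulUnitary (z : ℂ) (hz : ‖z‖ = 1) : Continuous (D.smulUnitary z hz) :=
  continuous_induced_rng.mpr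
    ((D.continuous_smul.comp (Continuous.prodMk_right z)).comp continuous_val)

include D in
theorem surjective_proj_val : Function.Surjective fun σ : 𝓛.Unitaries => p σ.1 := by
  intro g
  obtain ⟨U, -, -, ⟨σ⟩⟩ := D.exists_unitSection g
  exact ⟨D.unitSec σ g, (σ.sec g).2⟩

include D in
/-- Local sections of the twist through a given element. -/
theorem exists_section (τ : 𝓛.Unitaries) :
    ∃ (U : Set G) (σ : UnitSection p U) (s : G → 𝓛.Unitaries), IsOpen U ∧ p τ.1 ∈ U ∧
      ContinuousAt s (p τ.1) ∧ s (p τ.1) = τ ∧ ∀ g,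
      (s g).1 = (σ.coord τ.1 • σ.sec g).1 := by
  obtain ⟨U, hU, hτ, ⟨σ⟩⟩ := D.exists_unitSection (p τ.1)
  have hz : ‖σ.coord τ.1‖ = 1 := (σ.norm_coord τ.1).trans (D.norm_unitary τ)
  have h : ∀ g, (D.smulUnitary _ hz (D.unitSec σ g)).1 = (σ.coord τ.1 • σ.sec g).1 :=
    fun g => smul_toFiber _ _
  refine ⟨U, σ, fun g => D.smulUnitary _ hz (D.unitSec σ g), hU, hτ, ?_, ?_, h⟩
  · exact (D.continuous_smulUnitary _ hz).continuousAt.comp (D.continuousAt_unitSec σ hU hτ)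
  · exact Subtype.ext ((h _).trans (σ.coord_smul_sec τ.1))

include D in
-- Through every unitary passes a section of the projection, continuous at its base point; this
-- forces openness.
theorem isOpenMap_proj_val : IsOpenMap fun σ : 𝓛.Unitaries => p σ.1 := by
  refine IsOpenMap.of_sections fun τ => ?_
  obtain ⟨U, σ, s, -, -, h1, h2, h3⟩ := D.exists_section τ
  refine ⟨s, h1, h2, fun g => ?_⟩
  change p (s g).1 = g
  rw [h3]
  exact (σ.coord τ.1 • σ.sec g).2

/-- The twist of unitary elements of a Fell line bundle. -/
def twist : GroupoidTwist 𝓖 𝓛.Unitaries where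
  str := D.str
  isTopological := D.isTopological_str
  locallyCompactSpace := D.locallyCompactSpace_unitaries
  ι := D.ι
  π σ := p σ.1
  src_ι := D.src_ι
  rng_ι := D.rng_ι
  ι_mul z w x c := Subtype.ext (by
    refine Eq.trans ?_ (D.tmul_ι_left z x _ c (D.rng_ι (w, x)).symm).symm
    exact (smul_smul_toFiber _ _ _).symm)
  isEmbedding_ι := D.isEmbedding_ι
  src_π _ := rfl
  rng_π _ := rfl
  π_mul σ τ c _ := proj_tmul 𝓛 σ.1 τ.1 c
  continuous_π := continuous_proj_val
  isOpenMap_π := D.isOpenMap_proj_val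
  surjective_π := D.surjective_proj_val
  exact σ x := by
    constructor
    · intro h
      obtain ⟨z, hz⟩ := D.exists_circle_smul (h.trans (D.proj_one x).symm) (D.norm_unitary σ)
        (D.norm_toFiber_one x)
      exact ⟨z, Subtype.ext hz⟩
    · rintro ⟨z, rfl⟩
      exact D.proj_ι _
  central z σ c d := Subtype.ext
    ((D.tmul_ι_left z _ σ.1 c rfl).trans (D.tmul_ι_right z _ σ.1 d rfl).symm)

include D in
theorem isOpenQuotientMap_smul : IsOpenQuotientMap
    fun q : ℂ × 𝓛.Unitaries => ((q.1 • toFiber p q.2.1).1 : E) where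
  surjective v := by
    obtain ⟨U, -, -, ⟨σ⟩⟩ := D.exists_unitSection (p v)
    exact ⟨(σ.coord v, D.unitSec σ (p v)), (smul_toFiber _ _).trans (σ.coord_smul_sec v)⟩
  continuous := D.continuous_smul.comp
    (continuous_fst.prodMk (continuous_val.comp continuous_snd))
  isOpenMap := by
    refine IsOpenMap.of_sections ?_
    rintro ⟨z, τ⟩
    obtain ⟨U, σ, s, hU, hτ, h1, h2, h3⟩ := D.exists_section τ
    have h0 : σ.coord τ.1 ≠ 0 := by
      rw [← norm_ne_zero_iff, σ.norm_coord, D.norm_unitary]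
      exact one_ne_zero
    have hp : p (z • toFiber p τ.1).1 = p τ.1 := proj_smul _ _
    -- A section through (z, τ): the second component follows the section s through τ, and the first
    -- is the scalar that carries s(p v) to v. Since s = coord(τ) · sec, that scalar is the quotient
    -- of coordinates.
    refine ⟨fun v => (σ.coord v / σ.coord τ.1, s (p v)), ?_, ?_, ?_⟩
    · refine ContinuousAt.prodMk (ContinuousAt.div_const ?_ _) ?_
      · refine σ.continuousOn_coord.continuousAt
          ((hU.preimage 𝓛.isUSCBanachBundle.continuous_proj).mem_nhds ?_)
        exact (congrArg (· ∈ U) hp).mpr hτ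
      · refine ContinuousAt.comp (g := s) ?_ 𝓛.isUSCBanachBundle.continuous_proj.continuousAt
        exact (congrArg (ContinuousAt s) hp).mpr h1
    · refine Prod.ext ?_ ((congrArg s hp).trans h2)
      exact (congrArg (· / _) (σ.coord_smul z τ.1)).trans (mul_div_cancel_right₀ _ h0)
    · intro v
      refine (smul_val_congr (h3 (p v)) _).trans ((smul_toFiber _ _).trans ?_)
      rw [← mul_smul, div_mul_cancel₀ _ h0]
      exact σ.coord_smul_sec v

include D in
theorem smul_eq_smul_iff (q r : ℂ × 𝓛.Unitaries) :
    (q.1 • toFiber p q.2.1).1 = (r.1 • toFiber p r.2.1).1 ↔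
      ∃ z : Circle, r.1 = (z⁻¹ : Circle) * q.1 ∧ r.2.1 = ((z : ℂ) • toFiber p q.2.1).1 := by
  obtain ⟨a, σ⟩ := q
  obtain ⟨b, τ⟩ := r
  constructor
  · intro h
    have hp : p τ.1 = p σ.1 := by
      have := congrArg p h
      exact (proj_smul _ _).symm.trans (this.symm.trans (proj_smul _ _))
    obtain ⟨z, hz⟩ := D.exists_circle_smul hp (D.norm_unitary τ) (D.norm_unitary σ)
    refine ⟨z, ?_, hz⟩
    -- Writing τ = z σ turns aσ = bτ into aσ = (bz)σ, and σ ≠ 0 gives a = bz.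
    have h1 : a • toFiber p σ.1 = (b * z) • toFiber p σ.1 :=
      Subtype.ext (h.trans ((smul_val_congr hz b).trans (smul_smul_toFiber _ _ _)))
    have h0 : toFiber p σ.1 ≠ 0 := by
      rw [← norm_ne_zero_iff, D.norm_unitary]
      exact one_ne_zero
    have h2 : a = b * z := smul_left_injective ℂ h0 h1
    change b = _ * a
    rw [h2, Circle.coe_inv, mul_comm b, inv_mul_cancel_left₀ (Circle.coe_ne_zero z)]
  · rintro ⟨z, h1, h2⟩
    refine Eq.trans ?_ ((smul_val_congr h2 b).trans (smul_smul_toFiber _ _ _)).symm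
    have h3 : b * z = a := by
      change b = _ * a at h1
      rw [h1, Circle.coe_inv, mul_comm, mul_inv_cancel_left₀ (Circle.coe_ne_zero z)]
    rw [h3]

theorem isTwistOfUnitaries : 𝓛.IsTwistOfUnitaries D.twist where
  π_eq _ := rfl
  mul_eq _ _ _ _ := rfl
  inv_eq _ := rfl
  ι_eq _ x := ⟨(D.one x).1, D.isOne_iff.mpr rfl, rfl⟩
  isOpenQuotientMap_smul := D.isOpenQuotientMap_smul
  smul_eq_smul_iff := D.smul_eq_smul_iff

end UnitalData

end

end UnitaryTwist

namespace FellLine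

open Filter Topology LineBundle

section

variable {S : Type*} [InverseSemigroup S] {A : S → Type*}
  [∀ s, NormedAddCommGroup (A s)] [∀ s, NormedSpace ℂ (A s)] [∀ s, CompleteSpace (A s)]
  {𝓐 : FellBundle S A}

/-! ### The unit elements of the line bundle -/

section

variable (hsat : 𝓐.IsSaturated) (hab : 𝓐.IsSemiAbelian)

include hab in
theorem pair_idem {x : 𝓐.Spectrum} {p q : 𝓐.Tot} (hp : Idem p.1) (hq : Idem q.1)
    (h : SameGerm x p.1 q.1) : pair x p q = (starRingEnd ℂ) (val x p) * val x q := by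
  obtain ⟨d, hd, h1, h2⟩ := h.exists_val
  rw [pair_eq hab hd h1 h2, val_mul x (idem_mul hp hd).inv (idem_mul hq hd),
    val_star x (idem_mul hp hd), val_mul x hp hd, val_mul x hq hd, h1, mul_one, mul_one]

include hsat hab in
-- Left multiplication by c acts through the value of c at the range, by `val_theta`; right
-- multiplication acts through the value at the source. The two cases give the two unit laws.
theorem pair_idem_mul {y : 𝓐.Spectrum} {c q u : 𝓐.Tot} (hc : Idem c.1)
    (hy : y ∈ 𝓐.srcDom u.1) (h : SameGerm y u.1 q.1) (h' : SameGerm y u.1 (c * q).1) :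
    pair y u (c * q) = pair y u q * val (theta hsat hab u.1 y) c := by
  obtain ⟨d, hd, h1, h2, h3⟩ := exists_val_common h h'
  have hyd : y ∈ 𝓐.dom hd := (mem_dom hd).mpr ⟨d, rfl, by rw [h1]; exact one_ne_zero⟩
  obtain ⟨hud, hθ⟩ := theta_mul_idem hsat hab hy hyd
  have h4 := val_theta hsat hab hud (p := u * d) (q := q * d) (k := c) rfl h2.symm hc
  rw [pair_eq hab hd h1 h3, pair_eq hab hd h1 h2, mul_assoc c q d, h4, hθ]

theorem exists_idem_val (x : 𝓐.Spectrum) : ∃ c : 𝓐.Tot, Idem c.1 ∧ val x c = 1 := by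
  obtain ⟨e, he, h⟩ := exists_mem_dom x
  obtain ⟨c, rfl, hc⟩ := exists_val_eq_one h
  exact ⟨c, he, hc⟩

theorem mem_dom_of_val {x : 𝓐.Spectrum} {c : 𝓐.Tot} (hc : Idem c.1) (h : val x c = 1) :
    x ∈ 𝓐.dom hc := (mem_dom hc).mpr ⟨c, rfl, by rw [h]; exact one_ne_zero⟩

/-- An element over an idempotent with value `1` at `x`. -/
noncomputable def oneTot (x : 𝓐.Spectrum) : 𝓐.Tot := (exists_idem_val x).choose

theorem idem_oneTot (x : 𝓐.Spectrum) : Idem (oneTot x).1 := (exists_idem_val x).choose_spec.1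

theorem val_oneTot (x : 𝓐.Spectrum) : val x (oneTot x) = 1 := (exists_idem_val x).choose_spec.2

theorem mem_dom_oneTot (x : 𝓐.Spectrum) : x ∈ 𝓐.dom (idem_oneTot x) :=
  mem_dom_of_val (idem_oneTot x) (val_oneTot x)

theorem mem_srcDom_oneTot (x : 𝓐.Spectrum) : x ∈ 𝓐.srcDom (oneTot x).1 :=
  (srcDom_idem (idem_oneTot x)).mpr (mem_dom_oneTot x)

/-- The unit element of the fiber over `x`. -/
noncomputable def oneL (x : 𝓐.Spectrum) : BundleFiber 𝓐.proj (gunit x) :=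
  ⟨mkL (oneTot x) x (mem_srcDom_oneTot x),
    (gunit_eq (idem_oneTot x) (mem_dom_oneTot x) _).symm⟩

include hab in
theorem pair_oneTot_self (x : 𝓐.Spectrum) : pair x (oneTot x) (oneTot x) = 1 := by
  rw [pair_idem hab (idem_oneTot x) (idem_oneTot x) (SameGerm.refl _ _), val_oneTot]
  simp

include hsat hab in
-- In the coordinate of a unit vector over v, multiplication by the representative of 1_x
-- contributes its value at the range x of v, which is 1.
theorem mulL_oneL {x : 𝓐.Spectrum} {v : 𝓐.L}
    (c : 𝓐.germSrc (𝓐.proj (oneL x).1) = grng hsat hab (𝓐.proj v))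
    (h : x = grng hsat hab (𝓐.proj v)) : mulL hsat hab (oneL x).1 v c = v := by
  obtain ⟨q, y, hy, rfl⟩ := exists_mkL v
  have h' : theta hsat hab q.1 y = x := h.symm
  obtain ⟨h1, e1⟩ := mulL_eq hsat hab (v := (oneL x).1) (w := mkL q y hy) rfl rfl c
  obtain ⟨u, hu, hu1⟩ := exists_pair_self_eq_one hsat hab hy
  have h2 : SameGerm y ((oneTot x).1 * q.1) q.1 :=
    SameGerm.idem_mul hsat hab hy (idem_oneTot x) (by rw [h']; exact mem_dom_oneTot x)
  have h3 : SameGerm y u.1 q.1 := by rw [hu]; exact SameGerm.refl _ _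
  refine e1.trans (mkL_eq hab rfl h2 (h3.trans h2.symm) (by rw [hu1]; exact one_ne_zero) ?_)
  rw [pair_idem_mul hsat hab (idem_oneTot x) (by rw [hu]; exact hy) h3 (h3.trans h2.symm),
    hu, h', val_oneTot, mul_one]

include hsat hab in
theorem mulL_oneL_right {x : 𝓐.Spectrum} {v : 𝓐.L}
    (c : 𝓐.germSrc (𝓐.proj v) = grng hsat hab (𝓐.proj (oneL x).1))
    (h : x = 𝓐.germSrc (𝓐.proj v)) : mulL hsat hab v (oneL x).1 c = v := by
  obtain ⟨q, y, hy, rfl⟩ := exists_mkL v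
  obtain rfl : x = y := h
  obtain ⟨h1, e1⟩ := mulL_eq hsat hab (v := mkL q x hy) (w := (oneL x).1) rfl rfl c
  obtain ⟨u, hu, hu1⟩ := exists_pair_self_eq_one hsat hab hy
  have h2 : SameGerm x (q.1 * (oneTot x).1) q.1 :=
    SameGerm.mul_idem (idem_oneTot x) (mem_dom_oneTot x)
  have h3 : SameGerm x u.1 q.1 := by rw [hu]; exact SameGerm.refl _ _
  refine e1.trans (mkL_eq hab rfl h2 (h3.trans h2.symm) (by rw [hu1]; exact one_ne_zero) ?_)
  rw [pair_mul_idem hab h3 (idem_oneTot x) (by rw [val_oneTot]; exact one_ne_zero), val_oneTot,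
    mul_one]

variable [BanachFibers 𝓐.proj] (H : 𝓐.HasCanonicalFibers)

include hab H in
theorem norm_oneL (x : 𝓐.Spectrum) : ‖oneL x‖ = 1 := by
  have h := norm_sq_mkL hab H (oneL x) rfl
  rw [pair_oneTot_self hab] at h
  have h' : ‖oneL x‖ ^ 2 = 1 := by exact_mod_cast h
  exact (pow_eq_one_iff_of_nonneg (norm_nonneg _) two_ne_zero).mp h'

include hsat hab H in
-- Over a unit the line bundle is trivialized by 1_x, and an element over an idempotent becomes its
-- value at x. Applied to a* a and a a* this gives v* v = ‖v‖² · 1 and v v* = ‖v‖² · 1.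
theorem mkL_idem {p : 𝓐.Tot} (hp : Idem p.1) {x : 𝓐.Spectrum} (hx : x ∈ 𝓐.srcDom p.1) :
    mkL p x hx = (val x p • oneL x).1 := by
  have hxp : x ∈ 𝓐.dom hp := (srcDom_idem hp).mp hx
  have h : 𝓐.proj (mkL p x hx) = gunit x := (gunit_eq hp hxp hx).symm
  refine congrArg Subtype.val (a₁ := (⟨mkL p x hx, h⟩ : BundleFiber 𝓐.proj (gunit x)))
    (fiber_ext hab (gunit_eq (idem_oneTot x) (mem_dom_oneTot x) (mem_srcDom_oneTot x)) ?_ ?_)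
  · rw [pair_oneTot_self hab]
    exact one_ne_zero
  · rw [coordL_smul H hsat hab]
    change pair x (oneTot x) p = _ * pair x (oneTot x) (oneTot x)
    rw [pair_oneTot_self hab, pair_idem hab (idem_oneTot x) hp
      (SameGerm.of_idem (mem_dom_oneTot x) hxp), val_oneTot]
    simp

theorem continuous_oneL :
    let _ := topologyL H hsat hab
    Continuous fun x : 𝓐.Spectrum => (oneL x).1 := by
  let _ := topologyL H hsat hab
  refine continuous_iff_continuousAt.mpr fun x => ?_
  have hp : ∀ x : 𝓐.Spectrum, 𝓐.proj (oneL x).1 = gunit x := fun x => (oneL x).2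
  refine (tendsto_L_iff H hsat hab (u := oneTot x) ?_).mpr ⟨?_, ?_⟩
  · exact germ_mem_chartBase (hx := mem_srcDom_oneTot x)
      (by rw [pair_oneTot_self hab]; exact one_ne_zero)
  · simp only [hp]
    exact continuous_gunit.tendsto x
  -- The representative `oneTot y` is chosen point by point, with no continuity in y. Its value at y
  -- is always 1, so the coordinate of 1_y relative to the fixed `oneTot x` is the conjugate of the
  -- value of `oneTot x` at y.
  · have h1 : ∀ y ∈ 𝓐.dom (idem_oneTot x), (starRingEnd ℂ) (val y (oneTot x)) =
        coordL hab (oneTot x) (oneL y).1 := by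
      intro y hy
      change _ = pair y (oneTot x) (oneTot y)
      rw [pair_idem hab (idem_oneTot x) (idem_oneTot y)
        (SameGerm.of_idem hy (mem_dom_oneTot y)), val_oneTot, mul_one]
    rw [← h1 x (mem_dom_oneTot x)]
    refine Tendsto.congr' ?_
      ((Complex.continuous_conj.comp (continuous_val (oneTot x))).tendsto x)
    filter_upwards [(isOpen_dom (idem_oneTot x)).mem_nhds (mem_dom_oneTot x)] with y hy
      using h1 y hy

/-- The data which define the twist of unitary elements of the line bundle. -/
noncomputable def unitalData :
    let _ := topologyL H hsat hab
    UnitaryTwist.UnitalData (fellLineBundle hsat hab H) :=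
  let _ := topologyL H hsat hab
  { isTopological := (isEtale_germGroupoid hsat hab).toIsTopological
    locallyCompactSpace :=
      haveI := locallyCompactSpace_germ 𝓐
      (lineCharts H hsat hab).locallyCompactSpace
    continuous_norm := (lineCharts H hsat hab).continuous_norm
    continuous_smul := (lineCharts H hsat hab).continuous_smul
    one := oneL
    continuous_one := continuous_oneL hsat hab H
    norm_one := norm_oneL hab H
    one_mul := fun _ _ c h => mulL_oneL hsat hab c h
    mul_one := fun _ _ c h => mulL_oneL_right hsat hab c h
    norm_tmul := fun v w c => (norm_toFiber _).trans (norm_fiberMul hsat hab H c _ _)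
    star_mul_self := by
      intro v c
      obtain ⟨q, y, hy, rfl⟩ := exists_mkL v
      obtain ⟨h1, e1⟩ := mulL_eq hsat hab (starL_mkL hsat hab hy) rfl c
      refine (e1.trans (mkL_idem hsat hab H (idem_star_mul rfl) h1)).trans ?_
      rw [norm_mkL_sq H (toFiber 𝓐.proj (mkL q y hy)) rfl]
      rfl
    mul_star_self := by
      intro v c
      obtain ⟨q, y, hy, rfl⟩ := exists_mkL v
      obtain ⟨h1, e1⟩ := mulL_eq hsat hab (v := mkL q y hy) rfl (starL_mkL hsat hab hy) c
      refine (e1.trans (mkL_idem hsat hab H (idem_mul_star rfl) h1)).trans ?_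
      -- The product v v* is the class of q q* over the range, and its value there is (q* q)(y) =
      -- ‖v‖².
      rw [norm_mkL_sq H (toFiber 𝓐.proj (mkL q y hy)) rfl,
        val_theta_mul_star hsat hab hy rfl rfl]
      rfl
    exists_unitSection := fun g => by
      obtain ⟨u, hu⟩ := (lineCharts H hsat hab).exists_mem_base g
      exact ⟨_, isOpen_chartBase hab u, hu, ⟨(lineCharts H hsat hab).unitSection u⟩⟩ }

end

end

end FellLine

/-! ### The main theorem -/

theorem theoremT {S : Type*} [InverseSemigroup S] {A : S → Type*}
    [∀ s, NormedAddCommGroup (A s)] [∀ s, NormedSpace ℂ (A s)] [∀ s, CompleteSpace (A s)]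
    (𝓐 : FellBundle S A) (hsat : 𝓐.IsSaturated) (hab : 𝓐.IsSemiAbelian) :
    Equivalence 𝓐.GermRel ∧ Equivalence 𝓐.TripRel ∧
    ∃ θ : ∀ s : S, 𝓐.srcDom s ≃ₜ 𝓐.rngDom s, 𝓐.IsCanonicalAction θ ∧
    ∃ 𝓖 : GroupoidStr 𝓐.Germ 𝓐.Spectrum, 𝓐.IsGermGroupoid θ 𝓖 ∧ 𝓖.IsEtale ∧
    ∃ _ : BanachFibers 𝓐.proj, 𝓐.HasCanonicalFibers ∧
    ∃ τ : TopologicalSpace 𝓐.L,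
      𝓐.IsBundleTopology τ ∧ (∀ τ' : TopologicalSpace 𝓐.L, 𝓐.IsBundleTopology τ' → τ' = τ) ∧
    ∃ 𝓛 : GroupoidFellBundle 𝓖 𝓐.proj, 𝓐.HasCanonicalOperations θ 𝓛 ∧ 𝓛.IsFellLineBundle ∧
    ∃ T : GroupoidTwist 𝓖 𝓛.Unitaries, 𝓛.IsTwistOfUnitaries T := by
  refine ⟨FellLine.equivalence_germRel 𝓐, FellLine.equivalence_tripRel hsat hab,
    FellLine.thetaHomeo hsat hab, FellLine.isCanonicalAction_thetaHomeo hsat hab,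
    FellLine.germGroupoid hsat hab, FellLine.isGermGroupoid_germGroupoid hsat hab,
    FellLine.isEtale_germGroupoid hsat hab, FellLine.banachFibers hsat hab,
    FellLine.hasCanonicalFibers_banachFibers hsat hab, ?_⟩
  let _ := FellLine.banachFibers hsat hab
  have H := FellLine.hasCanonicalFibers_banachFibers hsat hab
  let _ := FellLine.topologyL H hsat hab
  exact ⟨FellLine.topologyL H hsat hab, FellLine.isBundleTopology_topologyL H hsat hab,
    fun _ h => FellLine.eq_topologyL H hsat hab h, FellLine.fellLineBundle hsat hab H,
    FellLine.hasCanonicalOperations_fellLineBundle hsat hab H,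
    FellLine.isFellLineBundle_fellLineBundle hsat hab H,
    UnitaryTwist.UnitalData.twist (FellLine.unitalData hsat hab H),
    UnitaryTwist.UnitalData.isTwistOfUnitaries (FellLine.unitalData hsat hab H)⟩
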